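/- Let $\mathbb R_+=[0,\infty)$. Say that a function $u$ is $C^1$ on a relatively open subset $S$ of $\mathbb R_+\times[0,1]$ (or of $[0,1]$, or of $\mathbb R_+$) if it is continuous on $S$ and has continuous first derivatives in the interior of $S$ that extend continuously to all points of $S$; derivatives at boundary points are one-sided. Write $g\in PC^1([0,1])$ if $g:[0,1]\to\mathbb R$ satisfies: (i) $g$ is left-continuous on $(0,1]$; (ii) for every $x\in[0,1)$ the limits $\lim_{y\to x^+}g(y)$ and $\lim_{h\to0^+,\,y\to x^+}h^{-1}(g(y+h)-g(y))$ exist and are finite; (iii) for every $x\in(0,1]$ the limit $\lim_{h\to0^-}h^{-1}(g(x+h)-g(x))$ exists and is finite; (iv) there is a finite set $J\subset(0,1)$ such that $g$ is differentiable with continuous derivative on $(0,1)\setminus J$. For a function $u$ of $(t,x)$ write $u[t]=u(t,\cdot)$, and let $\|\cdot\|_p$ be the norm of $L^p(0,1)$, $1\le p\le\infty$. **Theorem.** Let $\varphi\in PC^1([0,1])$, $b\in C^1(\mathbb R_+)$, $f,a,v\in C^1(\mathbb R_+\times[0,1])$, with $v>0$. Let $\xi_0,\dots,\xi_N\in[0,1]$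 with $\xi_0=0$ be such that $\varphi\in C^1([0,1]\setminus\{\xi_0,\dots,\xi_N\})$. Let $r_i$ be the solution of $\dot r_i(t)=v(t,r_i(t))$, $r_i(0)=\xi_i$, followed as long as it stays in $[0,1]$, i.e. on $[0,T_i]$ if it reaches $1$ at a time $T_i\ge 0$, and on $[0,\infty)$ (put $T_i=\infty$) if it never reaches $1$. Let $$\Omega=\bigcup_{i=0}^N\{(t,r_i(t)) : t\ge 0,\ t\le T_i\}.$$ Then there is a unique function $w:\mathbb R_+\times[0,1]\to\mathbb R$ of class $C^1\big((\mathbb R_+\times[0,1])\setminus\Omega\big)$, with $w[t]\in PC^1([0,1])$ for all $t\ge0$, such that $$\frac{\partial w}{\partial t}(t,x)+v(t,x)\frac{\partial w}{\partial x}(t,x)=a(t,x)w(t,x)+f(t,x)\quad\text{for all }(t,x)\in(\mathbb R_+\times[0,1])\setminus\Omega,$$ $$w(0,x)=\varphi(x)\ \text{ for } x\in(0,1],\qquad w(t,0)=b(t)\ \text{ for } t\ge0 .$$ For $t\ge0$ put $$v_{\min}(t)=\min_{[0,t]\times[0,1]}v,\qquad v_{\max}(t)=\max_{[0,t]\times[0,1]}\frac{\partial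 v}{\partial x},\qquad A(t)=\max_{[0,t]\times[0,1]}a,$$ let $h(s)=1$ for $s<0$ and $h(s)=0$ for $s\ge0$, and for $\mu\ge 0$ and $g:\mathbb R_+\to\mathbb R$ put $$M_{t,\mu}(g)=\max_{\max(0,\,t-1/v_{\min}(t))\le s\le t}\big(g(s)\exp(-\mu(t-s))\big).$$ Then the following estimates hold. For all $t\ge0$, $p\in(1,\infty)$ and $\mu\ge0$ with $\mu>-A(t)$ and $\mu>-p^{-1}v_{\max}(t)-A(t)-v_{\min}(t)$: $$\begin{aligned}\|w[t]\|_p\le{}&\exp\!\big((A(t)+p^{-1}v_{\max}(t))\,t\big)\,h\!\Big(t-\tfrac1{v_{\min}(t)}\Big)\|\varphi\|_p\\&+\frac1{v_{\min}(t)}\exp\!\Big(1+\frac{\mu+p^{-1}v_{\max}(t)+A(t)}{v_{\min}(t)}\Big)\,M_{t,\mu}\big(s\mapsto\|f[s]\|_p\big)\\&+\left(v_{\min}(t)\,\frac{\exp\!\Big(\frac{p(\mu+A(t))}{v_{\min}(t)}\Big)-1}{p(\mu+A(t))}\right)^{1/p}M_{t,\mu}\big(s\mapsto|b(s)|\big).\end{aligned}\tag{2.10}$$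 For all $t\ge0$ and $\mu\ge0$ with $\mu>-A(t)$: $$\begin{aligned}\|w[t]\|_\infty\le{}&\exp(tA(t))\,h\!\Big(t-\tfrac1{v_{\min}(t)}\Big)\|\varphi\|_\infty\\&+\frac1{v_{\min}(t)}\exp\!\Big(1+\frac{\mu+A(t)}{v_{\min}(t)}\Big)M_{t,\mu}\big(s\mapsto\|f[s]\|_\infty\big)\\&+\exp\!\Big(\frac{\mu+A(t)}{v_{\min}(t)}\Big)M_{t,\mu}\big(s\mapsto|b(s)|\big).\end{aligned}\tag{2.11}$$ Moreover, if $b(0)=\varphi(0)$ and $\varphi\in C^0([0,1])$, then $w\in C^0(\mathbb R_+\times[0,1])$. Finally, if $\varphi\in C^1([0,1])$, $b(0)=\varphi(0)$ and $\dot b(0)+v(0,0)\varphi'(0)=a(0,0)b(0)+f(0,0)$, then $w\in C^1(\mathbb R_+\times[0,1])$. -/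

import Mathlib

open Set Filter Topology MeasureTheory

noncomputable section

namespace LinTransport

/-- The closed half strip `[0, ∞) × [0, 1]` of pairs `(t, x)`. Functions of `(t, x)` are modelled
as `ℝ → ℝ → ℝ`; every notion below only looks at their values on this set. -/
def strip : Set (ℝ × ℝ) := Ici 0 ×ˢ Icc 0 1

/-- `u` is of class `C¹` on a (relatively open) subset `S` of the strip. On such sets this
is the same as: `u` is continuous on `S`, continuously differentiable in the interior of `S`, and
the derivatives extend continuously to all points of `S`. -/
def C1On (u : ℝ → ℝ → ℝ) (S : Set (ℝ × ℝ)) : Prop := ContDiffOn ℝ 1 (Function.uncurry u) S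

/-- The partial derivative in `t`, one-sided at `t = 0`. -/
def dt (u : ℝ → ℝ → ℝ) (t x : ℝ) : ℝ := derivWithin (fun s => u s x) (Ici 0) t

/-- The partial derivative in `x`, one-sided at `x = 0` and `x = 1`. -/
def dx (u : ℝ → ℝ → ℝ) (t x : ℝ) : ℝ := derivWithin (fun y => u t y) (Icc 0 1) x

/-- Piecewise `C¹` functions on `[0, 1]`: left-continuous functions that need not be continuous. -/
structure PC1 (g : ℝ → ℝ) : Prop where
  leftCont : ∀ x ∈ Ioc (0 : ℝ) 1, Tendsto g (𝓝[<] x) (𝓝 (g x))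
  rightLim : ∀ x ∈ Ico (0 : ℝ) 1, ∃ l : ℝ, Tendsto g (𝓝[>] x) (𝓝 l)
  /-- joint limit of the difference quotients as `h → 0+` and `y → x+` -/
  rightDeriv : ∀ x ∈ Ico (0 : ℝ) 1, ∃ l : ℝ,
    Tendsto (fun q : ℝ × ℝ => q.1⁻¹ * (g (q.2 + q.1) - g q.2)) (𝓝[>] 0 ×ˢ 𝓝[>] x) (𝓝 l)
  leftDeriv : ∀ x ∈ Ioc (0 : ℝ) 1, ∃ l : ℝ,
    Tendsto (fun h : ℝ => h⁻¹ * (g (x + h) - g x)) (𝓝[<] 0) (𝓝 l)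
  piecewise : ∃ J : Finset ℝ, (J : Set ℝ) ⊆ Ioo 0 1 ∧
    (∀ x ∈ Ioo (0 : ℝ) 1 \ J, DifferentiableAt ℝ g x) ∧
    ContinuousOn (deriv g) (Ioo (0 : ℝ) 1 \ J)

/-- The characteristic issuing from `(0, ξ)`: all points `(t, r t)`, `t ≥ 0`, where `r` solves
`r' = v(s, r)`, `r 0 = ξ` on `[0, t]` and stays in `[0, 1]` there. The point at which
the characteristic reaches `x = 1` (if there is one) is its last point, and belongs to it. -/
def charCurve (v : ℝ → ℝ → ℝ) (ξ : ℝ) : Set (ℝ × ℝ) :=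
  {z | 0 ≤ z.1 ∧ ∃ r : ℝ → ℝ, r 0 = ξ ∧ r z.1 = z.2 ∧
    ∀ s ∈ Icc 0 z.1, r s ∈ Icc (0 : ℝ) 1 ∧ HasDerivWithinAt r (v s (r s)) (Icc 0 z.1) s}

/-- The union of the characteristics issuing from the points `(0, ξ i)`. -/
def breakSet {N : ℕ} (v : ℝ → ℝ → ℝ) (ξ : Fin (N + 1) → ℝ) : Set (ℝ × ℝ) :=
  ⋃ i, charCurve v (ξ i)

/-- `w` solves the initial-boundary value problem `w_t + v w_x = a w + f`, `w(0, x) = φ(x)`,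
`w(t, 0) = b(t)`, in the class of functions that are `C¹` off the characteristics issuing from
the points `(0, ξ i)` and have piecewise `C¹` profiles. -/
structure IsSolution {N : ℕ} (v a f : ℝ → ℝ → ℝ) (φ b : ℝ → ℝ) (ξ : Fin (N + 1) → ℝ)
    (w : ℝ → ℝ → ℝ) : Prop where
  c1 : C1On w (strip \ breakSet v ξ)
  pc1 : ∀ t, 0 ≤ t → PC1 (w t)
  pde : ∀ t x, (t, x) ∈ strip \ breakSet v ξ →
    dt w t x + v t x * dx w t x = a t x * w t x + f t x
  init : ∀ x ∈ Ioc (0 : ℝ) 1, w 0 x = φ x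
  bdry : ∀ t, 0 ≤ t → w t 0 = b t

/-- The minimum of `u` over `[0, t] × [0, 1]`. -/
def minUpTo (u : ℝ → ℝ → ℝ) (t : ℝ) : ℝ :=
  sInf (Function.uncurry u '' (Icc 0 t ×ˢ Icc 0 1))

/-- The maximum of `u` over `[0, t] × [0, 1]`. -/
def maxUpTo (u : ℝ → ℝ → ℝ) (t : ℝ) : ℝ :=
  sSup (Function.uncurry u '' (Icc 0 t ×ˢ Icc 0 1))

/-- Lebesgue measure on `[0, 1]`. -/
def unitVol : Measure ℝ := volume.restrict (Icc 0 1)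

/-- The norm of `L^p(0, 1)`, `1 ≤ p ≤ ∞`. -/
def nrm (p : ENNReal) (g : ℝ → ℝ) : ℝ := (eLpNorm g p unitVol).toReal

/-- The cut-off `h`: one on the negative half line, zero elsewhere. -/
def cut (s : ℝ) : ℝ := if s < 0 then 1 else 0

/-- The fading-memory maximum of `g(s) exp(-μ (t - s))` over `max (0, t - δ) ≤ s ≤ t`. -/
def memMax (δ μ t : ℝ) (g : ℝ → ℝ) : ℝ :=
  sSup ((fun s => g s * Real.exp (-μ * (t - s))) '' Icc (max 0 (t - δ)) t)

end LinTransport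

end

open Set Filter Topology MeasureTheory

noncomputable section

namespace LinTransport

/-! Along a characteristic r' = v(t, r) the equation becomes the linear ordinary equation w' = a w +
f. Since v > 0, the value of w is therefore fixed by its value where the characteristic enters the
strip: φ on the line t = 0, or b on the line x = 0.

This is reduced to a pure Cauchy problem. On [0, T] × [0, 1] the coefficients are replaced by C¹
coefficients on the plane whose speed is bounded and bounded below by a positive constant
(`exists_extension_pos`); that speed has a global C¹ flow `Φ` and a C¹ foot map `X`
(`exists_isFlow`). The boundary values are carried back along the flow to fictitious initial values
at nonpositive feet (`inflow`), and the solution is the growth factor times data at the foot plus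
accumulated source (`mixedSol`). Because `X` is C¹, increasing in x and constant along
characteristics, the regularity of w at (t, x) is that of the one-variable function `fullData` at `X
t x`. The set Ω is the preimage of the ξ_i (`mem_breakSet_iff`), and the two compatibility
conditions say that values and slopes of `fullData` match at 0.

For uniqueness, off Ω the difference of two solutions divided by the growth factor is constant along
characteristics and zero at the entrance; on Ω left-continuity of the profiles decides. Solutions
for different T hence agree and patch together.

For the estimates, a characteristic ending at (t, x) has spent at most x / v_min in the strip,
whence the memory window and the cut-off. The sup bound then follows from variation of constants. In
L^p the pointwise bound splits into three parts. The initial and source parts are moved by the flow,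
whose Jacobian is at most exp(v_max (t - s)) (`lintegral_flow_le`), the source part also using a
Minkowski inequality (`lintegral_rpow_lintegral_le`). The boundary part is dominated by a constant
times exp((μ + A) x / v_min), which is integrated explicitly. -/

/-- The partial derivative in the second variable of a function on the plane. -/
def px (u : ℝ → ℝ → ℝ) (t x : ℝ) : ℝ := fderiv ℝ (Function.uncurry u) (t, x) (0, 1)

/-- The partial derivative in the first variable of a function on the plane. -/
def pt (u : ℝ → ℝ → ℝ) (t x : ℝ) : ℝ := fderiv ℝ (Function.uncurry u) (t, x) (1, 0)

/-! ### Calculus with continuous partial derivatives. -/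

section Partials

variable {u : ℝ → ℝ → ℝ}

theorem continuous_px (hu : ContDiff ℝ 1 (Function.uncurry u)) :
    Continuous (Function.uncurry (px u)) :=
  (hu.continuous_fderiv (by norm_num)).clm_apply continuous_const

theorem hasFDerivAt_uncurry (hu : ContDiff ℝ 1 (Function.uncurry u)) (z : ℝ × ℝ) :
    HasFDerivAt (Function.uncurry u) (fderiv ℝ (Function.uncurry u) z) z :=
  (hu.differentiable (by norm_num) z).hasFDerivAt

theorem hasDerivAt_px (hu : ContDiff ℝ 1 (Function.uncurry u)) (t x : ℝ) :
    HasDerivAt (u t) (px u t x) x := by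
  have h : HasDerivAt (fun y : ℝ => (t, y)) ((0 : ℝ), (1 : ℝ)) x :=
    (hasDerivAt_const x t).prodMk (hasDerivAt_id x)
  exact (hasFDerivAt_uncurry hu (t, x)).comp_hasDerivAt x h

theorem hasDerivAt_pt (hu : ContDiff ℝ 1 (Function.uncurry u)) (t x : ℝ) :
    HasDerivAt (fun s => u s x) (pt u t x) t := by
  have h : HasDerivAt (fun s : ℝ => (s, x)) ((1 : ℝ), (0 : ℝ)) t :=
    (hasDerivAt_id t).prodMk (hasDerivAt_const t x)
  exact (hasFDerivAt_uncurry hu (t, x)).comp_hasDerivAt t h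

/-- Chain rule along a curve `(p s, q s)`. -/
theorem hasDerivAt_comp_curve (hu : ContDiff ℝ 1 (Function.uncurry u)) {p q : ℝ → ℝ} {p' q' s : ℝ}
    (hp : HasDerivAt p p' s) (hq : HasDerivAt q q' s) :
    HasDerivAt (fun s => u (p s) (q s)) (p' * pt u (p s) (q s) + q' * px u (p s) (q s)) s := by
  have h := (hasFDerivAt_uncurry hu (p s, q s)).comp_hasDerivAt s (hp.prodMk hq)
  have e : fderiv ℝ (Function.uncurry u) (p s, q s) (p', q')
      = p' * pt u (p s) (q s) + q' * px u (p s) (q s) := by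
    have : ((p', q') : ℝ × ℝ) = p' • ((1 : ℝ), (0 : ℝ)) + q' • ((0 : ℝ), (1 : ℝ)) := by simp
    rw [this, map_add, map_smul, map_smul]; rfl
  rw [e] at h
  exact h

/-- A function with continuous partial derivatives is continuously differentiable. -/
theorem contDiff_one_of_partials {u₁ u₂ : ℝ → ℝ → ℝ}
    (h₁ : ∀ t x, HasDerivAt (fun s => u s x) (u₁ t x) t)
    (h₂ : ∀ t x, HasDerivAt (u t) (u₂ t x) x)
    (c₁ : Continuous (Function.uncurry u₁)) (c₂ : Continuous (Function.uncurry u₂)) :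
    ContDiff ℝ 1 (Function.uncurry u) := by
  let f₁ : ℝ → ℝ → ℝ →L[ℝ] ℝ := fun t x => ContinuousLinearMap.toSpanSingleton ℝ (u₁ t x)
  let f₂ : ℝ → ℝ → ℝ →L[ℝ] ℝ := fun t x => ContinuousLinearMap.toSpanSingleton ℝ (u₂ t x)
  have k₁ : Continuous (Function.uncurry f₁) :=
    (ContinuousLinearMap.toSpanSingletonCLE (𝕜 := ℝ) (E := ℝ)).continuous.comp c₁
  have k₂ : Continuous (Function.uncurry f₂) :=
    (ContinuousLinearMap.toSpanSingletonCLE (𝕜 := ℝ) (E := ℝ)).continuous.comp c₂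
  rw [contDiff_one_iff_hasFDerivAt]
  refine ⟨fun z => (f₁ z.1 z.2).coprod (f₂ z.1 z.2), ?_, fun z => ?_⟩
  · exact (ContinuousLinearMap.coprodEquivL (𝕜 := ℝ) (E := ℝ) (F := ℝ) (G := ℝ) ℝ).continuous.comp (k₁.prodMk k₂)
  · exact (hasStrictFDerivAt_uncurry_coprod (f := u) (f₁ := f₁) (f₂ := f₂) (u := z)
      (Eventually.of_forall fun v => (h₁ v.1 v.2).hasFDerivAt)
      (Eventually.of_forall fun v => (h₂ v.1 v.2).hasFDerivAt)
      k₁.continuousAt k₂.continuousAt).hasFDerivAt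

/-- The primitive in time of a `C¹` function of two variables is `C¹`. -/
theorem contDiff_primitive (hu : ContDiff ℝ 1 (Function.uncurry u)) :
    ContDiff ℝ 1 (Function.uncurry fun t x => ∫ s in (0 : ℝ)..t, u s x) := by
  have cu := hu.continuous
  have cx := continuous_px hu
  refine contDiff_one_of_partials (u₁ := u) (u₂ := fun t x => ∫ s in (0 : ℝ)..t, px u s x)
    (fun t x => ?_) (fun t x => ?_) cu ?_
  · have c : Continuous fun s => u s x := cu.comp (by fun_prop : Continuous fun s : ℝ => (s, x))
    exact intervalIntegral.integral_hasDerivAt_right (c.intervalIntegrable _ _)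
      c.aestronglyMeasurable.stronglyMeasurableAtFilter c.continuousAt
  -- Differentiation under the integral: the dominating constant bounds the x-derivative on a
  -- compact rectangle around the segment of integration.
  · obtain ⟨C, hC⟩ := ((isCompact_uIcc (a := (0 : ℝ)) (b := t)).prod
      (isCompact_Icc (a := x - 1) (b := x + 1))).exists_bound_of_continuousOn cx.continuousOn
    refine (intervalIntegral.hasDerivAt_integral_of_dominated_loc_of_deriv_le
      (F := fun y s => u s y) (F' := fun y s => px u s y) (bound := fun _ => C)
      (Icc_mem_nhds (by linarith) (by linarith) : Icc (x - 1) (x + 1) ∈ 𝓝 x)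
      (Eventually.of_forall fun y => ?_) ?_ ?_ ?_ ?_ ?_).2
    · exact (cu.comp (by fun_prop : Continuous fun s : ℝ => (s, y))).aestronglyMeasurable
    · exact (cu.comp (by fun_prop : Continuous fun s : ℝ => (s, x))).intervalIntegrable _ _
    · exact (cx.comp (by fun_prop : Continuous fun s : ℝ => (s, x))).aestronglyMeasurable
    · exact Eventually.of_forall fun s hs y hy => hC (s, y) ⟨uIoc_subset_uIcc hs, hy⟩
    · exact intervalIntegrable_const
    · exact Eventually.of_forall fun s _ y _ => hasDerivAt_px hu s y
  · have : Continuous (Function.uncurry fun (z : ℝ × ℝ) s => px u s z.2) :=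
      cx.comp (by fun_prop : Continuous fun w : (ℝ × ℝ) × ℝ => (w.2, w.1.2))
    exact intervalIntegral.continuous_parametric_intervalIntegral_of_continuous this continuous_fst

end Partials

/-! ### Global solutions of scalar equations. -/

section ODE

/-- Global solvability of a scalar equation with bounded and Lipschitz right-hand side. -/
theorem exists_global_solution {V : ℝ → ℝ → ℝ} (hV : Continuous (Function.uncurry V)) {M K : NNReal}
    (hM : ∀ t x, |V t x| ≤ M) (hK : ∀ t, LipschitzWith K (V t)) (x₀ : ℝ) :
    ∃ r : ℝ → ℝ, r 0 = x₀ ∧ ∀ t, HasDerivAt r (V t (r t)) t := by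
  have main : ∀ n : ℕ, ∃ r : ℝ → ℝ, r 0 = x₀ ∧ ∀ t ∈ Icc (-(n + 1 : ℝ)) (n + 1),
      HasDerivWithinAt r (V t (r t)) (Icc (-(n + 1 : ℝ)) (n + 1)) t := by
    intro n
    have h0 : (0 : ℝ) ∈ Icc (-(n + 1 : ℝ)) (n + 1) := by
      constructor <;> [have := n.cast_nonneg (α := ℝ); have := n.cast_nonneg (α := ℝ)] <;> linarith
    -- The radius `M * (n + 1)` is the farthest a solution of speed at most `M` can travel in time
    -- `n + 1`, so the Picard–Lindelöf condition holds on the whole interval.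
    have pl : IsPicardLindelof V (⟨0, h0⟩ : Icc (-(n + 1 : ℝ)) (n + 1)) x₀ (M * (n + 1)) 0 M K :=
      { lipschitzOnWith := fun t _ => (hK t).lipschitzOnWith
        continuousOn := fun x _ =>
          (hV.comp (by fun_prop : Continuous fun s : ℝ => (s, x))).continuousOn
        norm_le := fun t _ x _ => hM t x
        mul_max_le := by simp }
    exact pl.exists_eq_forall_mem_Icc_hasDerivWithinAt₀
  choose r hr0 hr using main
  have hder : ∀ n : ℕ, ∀ t ∈ Ioo (-(n + 1 : ℝ)) (n + 1), HasDerivAt (r n) (V t (r n t)) t :=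
    fun n t ht => (hr n t (Ioo_subset_Icc_self ht)).hasDerivAt (Icc_mem_nhds ht.1 ht.2)
  have agree : ∀ m n : ℕ, m ≤ n → ∀ t ∈ Ioo (-(m + 1 : ℝ)) (m + 1), r m t = r n t := by
    intro m n hmn
    have hmn' : (m : ℝ) ≤ n := by exact_mod_cast hmn
    have hm := m.cast_nonneg (α := ℝ)
    refine ODE_solution_unique_of_mem_Ioo (v := V) (s := fun _ => univ) (K := K) (t₀ := 0)
      (fun t _ => (hK t).lipschitzOnWith) ⟨by linarith, by linarith⟩
      (fun t ht => ⟨hder m t ht, trivial⟩)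
      (fun t ht => ⟨hder n t ⟨by linarith [ht.1], by linarith [ht.2]⟩, trivial⟩) ?_
    rw [hr0, hr0]
  refine ⟨fun t => r ⌈|t|⌉₊ t, by simp [hr0], fun t => ?_⟩
  -- The index is one larger than needed, so that a whole neighbourhood of `t` lies in |s| < N,
  -- where every local piece coincides with `r N`.
  set N := ⌈|t|⌉₊ + 1 with hN
  have key : ∀ s : ℝ, |s| < N → r ⌈|s|⌉₊ s = r N s := by
    intro s hs
    refine agree _ _ (Nat.ceil_le.2 hs.le) s ?_
    have := Nat.le_ceil |s|
    exact abs_lt.1 (by linarith)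
  have htN : |t| < N := by
    have := Nat.le_ceil |t|
    push_cast [hN]; linarith
  have h1 := hder N t (abs_lt.1 (by linarith))
  have ev : (fun s => r ⌈|s|⌉₊ s) =ᶠ[𝓝 t] r N := by
    filter_upwards [(isOpen_lt continuous_abs continuous_const).mem_nhds htN] with s hs
    exact key s hs
  have := h1.congr_of_eventuallyEq ev
  rwa [← key t htN] at this

/-- Solutions of a scalar linear homogeneous equation. -/
theorem eq_exp_integral_mul {D k : ℝ → ℝ} (hk : Continuous k)
    (hD : ∀ t, HasDerivAt D (k t * D t) t) (t : ℝ) :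
    D t = Real.exp (∫ s in (0 : ℝ)..t, k s) * D 0 := by
  have hI : ∀ t, HasDerivAt (fun t => ∫ s in (0 : ℝ)..t, k s) (k t) t := fun t =>
    intervalIntegral.integral_hasDerivAt_right (hk.intervalIntegrable _ _)
      hk.aestronglyMeasurable.stronglyMeasurableAtFilter hk.continuousAt
  have h : ∀ t, HasDerivAt (fun t => Real.exp (-∫ s in (0 : ℝ)..t, k s) * D t) 0 t := by
    intro t
    convert! (hI t).neg.exp.mul (hD t) using 1
    ring
  have := is_const_of_deriv_eq_zero (fun t => (h t).differentiableAt) (fun t => (h t).deriv) t 0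
  simp only [intervalIntegral.integral_same, neg_zero, Real.exp_zero, one_mul] at this
  rw [← this, ← mul_assoc, ← Real.exp_add]
  simp

end ODE

/-! ### The C¹ flow of a bounded speed and its inverse. -/

/-- `Φ t ξ` is the position at time `t` of the characteristic of `V` through `(0, ξ)`, and `X t x` is
the foot on the line `t = 0` of the characteristic through `(t, x)`. -/
structure IsFlow (V Φ X : ℝ → ℝ → ℝ) : Prop where
  contDiff_flow : ContDiff ℝ 1 (Function.uncurry Φ)
  contDiff_foot : ContDiff ℝ 1 (Function.uncurry X)
  flow_zero : ∀ ξ, Φ 0 ξ = ξ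
  hasDerivAt_time : ∀ t ξ, HasDerivAt (fun s => Φ s ξ) (V t (Φ t ξ)) t
  hasDerivAt_space : ∀ t ξ,
    HasDerivAt (Φ t) (Real.exp (∫ s in (0 : ℝ)..t, px V s (Φ s ξ))) ξ
  foot_flow : ∀ t ξ, X t (Φ t ξ) = ξ
  flow_foot : ∀ t x, Φ t (X t x) = x

/-- The mean slope of `V t` between `x` and `y`. -/
def meanSlope (V : ℝ → ℝ → ℝ) (t x y : ℝ) : ℝ := ∫ θ in (0 : ℝ)..1, px V t (x + θ * (y - x))

section MeanSlope

variable {V : ℝ → ℝ → ℝ}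

theorem continuous_meanSlope (hV : ContDiff ℝ 1 (Function.uncurry V)) :
    Continuous fun p : ℝ × ℝ × ℝ => meanSlope V p.1 p.2.1 p.2.2 := by
  have : Continuous (Function.uncurry fun (p : ℝ × ℝ × ℝ) θ =>
      px V p.1 (p.2.1 + θ * (p.2.2 - p.2.1))) :=
    (continuous_px hV).comp (by fun_prop : Continuous fun w : (ℝ × ℝ × ℝ) × ℝ =>
      (w.1.1, w.1.2.1 + w.2 * (w.1.2.2 - w.1.2.1)))
  exact intervalIntegral.continuous_parametric_intervalIntegral_of_continuous' this 0 1

theorem meanSlope_self (t x : ℝ) : meanSlope V t x x = px V t x := by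
  simp [meanSlope]

/-- This makes the difference of two characteristics the solution of a linear equation D' = k D with
continuous k, including the limit case of equal arguments, where k is the x-derivative of the speed.
-/
theorem meanSlope_mul (hV : ContDiff ℝ 1 (Function.uncurry V)) (t x y : ℝ) :
    meanSlope V t x y * (y - x) = V t y - V t x := by
  have hd : ∀ θ : ℝ, HasDerivAt (fun θ => V t (x + θ * (y - x)))
      (px V t (x + θ * (y - x)) * (y - x)) θ := fun θ =>
    (hasDerivAt_px hV t _).comp θ
      (by simpa using ((hasDerivAt_id θ).mul_const (y - x)).const_add x)
  have hc : Continuous fun θ : ℝ => px V t (x + θ * (y - x)) * (y - x) :=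
    ((continuous_px hV).comp (by fun_prop : Continuous fun θ : ℝ => (t, x + θ * (y - x)))).mul
      continuous_const
  have := intervalIntegral.integral_eq_sub_of_hasDerivAt (fun θ _ => hd θ)
    (hc.intervalIntegrable 0 1)
  rw [intervalIntegral.integral_mul_const] at this
  simpa [meanSlope] using this

theorem abs_meanSlope_le {K : NNReal} (hK : ∀ t x, |px V t x| ≤ K) (t x y : ℝ) :
    |meanSlope V t x y| ≤ K := by
  have := intervalIntegral.norm_integral_le_of_norm_le_const (a := 0) (b := 1) (C := K)
    (f := fun θ => px V t (x + θ * (y - x))) (fun θ _ => hK _ _)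
  simpa [meanSlope] using this

end MeanSlope

theorem hasDerivAt_primitive {k : ℝ → ℝ} (hk : Continuous k) (t : ℝ) :
    HasDerivAt (fun t => ∫ s in (0 : ℝ)..t, k s) (k t) t :=
  intervalIntegral.integral_hasDerivAt_right (hk.intervalIntegrable _ _)
    hk.aestronglyMeasurable.stronglyMeasurableAtFilter hk.continuousAt

/-- Everything rests on the identity r_η(t) - r_ξ(t) = exp(∫ mean slope) (η - ξ). It gives Lipschitz
bounds in both directions, hence joint continuity and injectivity, and its limit η → ξ is the
derivative in ξ. Surjectivity follows from |r_ξ(t) - ξ| ≤ M |t|, and smoothness of the inverse from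
the inverse function theorem for (t, ξ) ↦ (t, r_ξ(t)). -/
theorem exists_isFlow {V : ℝ → ℝ → ℝ} (hV : ContDiff ℝ 1 (Function.uncurry V)) {M K : NNReal}
    (hM : ∀ t x, |V t x| ≤ M) (hK : ∀ t x, |px V t x| ≤ K) : ∃ Φ X, IsFlow V Φ X := by
  have hLip : ∀ t, LipschitzWith K (V t) := fun t =>
    lipschitzWith_of_nnnorm_deriv_le (fun x => (hasDerivAt_px hV t x).differentiableAt) fun x => by
      rw [(hasDerivAt_px hV t x).deriv]; exact hK t x
  choose r hr0 hr using exists_global_solution hV.continuous hM hLip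
  have rc : ∀ ξ, Continuous (r ξ) := fun ξ =>
    continuous_iff_continuousAt.2 fun t => (hr ξ t).continuousAt
  have kc : ∀ ξ η, Continuous fun s => meanSlope V s (r ξ s) (r η s) := fun ξ η =>
    (continuous_meanSlope hV).comp (continuous_id.prodMk ((rc ξ).prodMk (rc η)))
  have diff : ∀ t ξ η, r η t - r ξ t =
      Real.exp (∫ s in (0 : ℝ)..t, meanSlope V s (r ξ s) (r η s)) * (η - ξ) := by
    intro t ξ η
    have := eq_exp_integral_mul (D := fun t => r η t - r ξ t) (kc ξ η) (fun t => by
      rw [meanSlope_mul hV]; exact (hr η t).sub (hr ξ t)) t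
    simpa [hr0] using this
  have ib : ∀ t ξ η, |∫ s in (0 : ℝ)..t, meanSlope V s (r ξ s) (r η s)| ≤ K * |t| := by
    intro t ξ η
    have := intervalIntegral.norm_integral_le_of_norm_le_const (a := 0) (b := t) (C := K)
      (f := fun s => meanSlope V s (r ξ s) (r η s)) (fun θ _ => abs_meanSlope_le hK _ _ _)
    simpa using this
  have upper : ∀ t ξ η, |r η t - r ξ t| ≤ Real.exp (K * |t|) * |η - ξ| := by
    intro t ξ η
    rw [diff, abs_mul, Real.abs_exp]
    gcongr
    exact (abs_le.1 (ib t ξ η)).2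
  have lower : ∀ t ξ η, |η - ξ| ≤ Real.exp (K * |t|) * |r η t - r ξ t| := by
    intro t ξ η
    rw [diff, abs_mul, Real.abs_exp, ← mul_assoc, ← Real.exp_add]
    refine le_mul_of_one_le_left (abs_nonneg _) (Real.one_le_exp ?_)
    linarith [(abs_le.1 (ib t ξ η)).1]
  have Φc : Continuous fun z : ℝ × ℝ => r z.2 z.1 := by
    refine continuous_iff_continuousAt.2 fun z => ?_
    rw [ContinuousAt, tendsto_iff_dist_tendsto_zero]
    have h : Tendsto (fun w : ℝ × ℝ => Real.exp (K * |w.1|) * |w.2 - z.2| +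
        |r z.2 w.1 - r z.2 z.1|) (𝓝 z) (𝓝 0) := by
      have : Continuous fun w : ℝ × ℝ => Real.exp (K * |w.1|) * |w.2 - z.2| +
          |r z.2 w.1 - r z.2 z.1| := by
        have := rc z.2
        fun_prop
      simpa using this.tendsto z
    refine squeeze_zero (fun _ => dist_nonneg) (fun w => ?_) h
    rw [Real.dist_eq]
    calc |r w.2 w.1 - r z.2 z.1| = |(r w.2 w.1 - r z.2 w.1) + (r z.2 w.1 - r z.2 z.1)| := by ring_nf
      _ ≤ _ := (abs_add_le _ _).trans (add_le_add (upper _ _ _) le_rfl)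
  have Ec : ∀ t ξ, Continuous fun η =>
      Real.exp (∫ s in (0 : ℝ)..t, meanSlope V s (r ξ s) (r η s)) := by
    intro t ξ
    have : Continuous (Function.uncurry fun (η : ℝ) s => meanSlope V s (r ξ s) (r η s)) :=
      (continuous_meanSlope hV).comp (continuous_snd.prodMk
        (((rc ξ).comp continuous_snd).prodMk (Φc.comp (continuous_snd.prodMk continuous_fst))))
    exact Real.continuous_exp.comp
      (intervalIntegral.continuous_parametric_intervalIntegral_of_continuous' this 0 t)
  have space : ∀ t ξ, HasDerivAt (fun ξ => r ξ t)
      (Real.exp (∫ s in (0 : ℝ)..t, px V s (r ξ s))) ξ := by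
    intro t ξ
    -- The difference quotient is exactly the exponential of the integrated mean slope, which is
    -- continuous in `η`.
    rw [hasDerivAt_iff_tendsto_slope]
    have h := ((Ec t ξ).tendsto ξ).mono_left (nhdsWithin_le_nhds (s := {ξ}ᶜ))
    simp only [meanSlope_self] at h
    refine h.congr' ?_
    filter_upwards [self_mem_nhdsWithin] with η hη
    have hne : η - ξ ≠ 0 := sub_ne_zero.2 hη
    rw [slope_def_field, diff, mul_div_assoc, div_self hne, mul_one]
  have hΦ : ContDiff ℝ 1 (Function.uncurry fun t ξ => r ξ t) := by
    refine contDiff_one_of_partials (u₁ := fun t ξ => V t (r ξ t)) (fun t ξ => hr ξ t)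
      (fun t ξ => space t ξ) (hV.continuous.comp (continuous_fst.prodMk Φc)) ?_
    have : Continuous (Function.uncurry fun (z : ℝ × ℝ) s => px V s (r z.2 s)) :=
      (continuous_px hV).comp (continuous_snd.prodMk
        (Φc.comp (continuous_snd.prodMk (continuous_snd.comp continuous_fst))))
    exact Real.continuous_exp.comp
      (intervalIntegral.continuous_parametric_intervalIntegral_of_continuous this continuous_fst)
  have bound : ∀ t ξ, |r ξ t - ξ| ≤ M * |t| := by
    intro t ξ
    have := convex_univ.norm_image_sub_le_of_norm_hasDerivWithin_le (C := M) (f := r ξ)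
      (fun s _ => (hr ξ s).hasDerivWithinAt) (fun s _ => hM s _) (mem_univ 0) (mem_univ t)
    simpa [hr0] using this
  have surj : ∀ t x, ∃ ξ, r ξ t = x := by
    intro t
    refine Continuous.surjective (f := fun ξ => r ξ t)
      (Φc.comp (continuous_const.prodMk continuous_id)) ?_ ?_
    · refine tendsto_atTop_mono (f := fun ξ => ξ + -(M * |t|)) (fun ξ => ?_)
        (tendsto_atTop_add_const_right _ _ tendsto_id)
      linarith [(abs_le.1 (bound t ξ)).1]
    · have h : ∀ ξ, r ξ t ≤ ξ + M * |t| := fun ξ => by linarith [(abs_le.1 (bound t ξ)).2]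
      exact tendsto_atBot_mono h (tendsto_atBot_add_const_right _ _ tendsto_id)
  choose X hX using surj
  have inj : ∀ t ξ, X t (r ξ t) = ξ := by
    intro t ξ
    have := lower t ξ (X t (r ξ t))
    rw [hX] at this
    simpa [sub_eq_zero] using this
  have Xc : Continuous fun z : ℝ × ℝ => X z.1 z.2 := by
    refine continuous_iff_continuousAt.2 fun z => ?_
    rw [ContinuousAt, tendsto_iff_dist_tendsto_zero]
    have h : Tendsto (fun w : ℝ × ℝ => Real.exp (K * |w.1|) *
        |w.2 - r (X z.1 z.2) w.1|) (𝓝 z) (𝓝 0) := by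
      have : Continuous fun w : ℝ × ℝ => Real.exp (K * |w.1|) *
          |w.2 - r (X z.1 z.2) w.1| := by
        have := rc (X z.1 z.2)
        fun_prop
      simpa [hX] using this.tendsto z
    refine squeeze_zero (fun _ => dist_nonneg) (fun w => ?_) h
    rw [Real.dist_eq]
    simpa [hX] using lower w.1 (X z.1 z.2) (X w.1 w.2)
  let H : ℝ × ℝ ≃ₜ ℝ × ℝ :=
    { toFun := fun z => (z.1, r z.2 z.1)
      invFun := fun z => (z.1, X z.1 z.2)
      left_inv := fun z => by simp [inj]
      right_inv := fun z => by simp [hX]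
      continuous_toFun := continuous_fst.prodMk Φc
      continuous_invFun := continuous_fst.prodMk Xc }
  let e : ℝ × ℝ → ℝ := fun z => Real.exp (∫ s in (0 : ℝ)..z.1, px V s (r z.2 s))
  have he : ∀ z, e z ≠ 0 := fun z => (Real.exp_pos _).ne'
  -- The derivative is triangular with diagonal entries 1 and `e z`, so its inverse is explicit.
  let D : ∀ z : ℝ × ℝ, (ℝ × ℝ) ≃L[ℝ] (ℝ × ℝ) := fun z =>
    ContinuousLinearEquiv.equivOfInverse
      ((ContinuousLinearMap.fst ℝ ℝ ℝ).prod
        (V z.1 (r z.2 z.1) • ContinuousLinearMap.fst ℝ ℝ ℝ + e z • ContinuousLinearMap.snd ℝ ℝ ℝ))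
      ((ContinuousLinearMap.fst ℝ ℝ ℝ).prod
        ((e z)⁻¹ • (ContinuousLinearMap.snd ℝ ℝ ℝ -
          V z.1 (r z.2 z.1) • ContinuousLinearMap.fst ℝ ℝ ℝ)))
      (fun w => by ext <;> simp; rw [inv_mul_cancel_left₀ (he z)])
      (fun w => by ext <;> simp; rw [mul_inv_cancel_left₀ (he z)]; ring)
  have hH : ContDiff ℝ 1 H := contDiff_fst.prodMk hΦ
  have hD : ∀ z, HasFDerivAt H (D z : (ℝ × ℝ) →L[ℝ] (ℝ × ℝ)) z := by
    intro z
    have h1 := hasFDerivAt_uncurry hΦ z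
    have e1 : fderiv ℝ (Function.uncurry fun t ξ => r ξ t) z =
        V z.1 (r z.2 z.1) • ContinuousLinearMap.fst ℝ ℝ ℝ +
          e z • ContinuousLinearMap.snd ℝ ℝ ℝ := by
      ext
      · have := (hasDerivAt_pt hΦ z.1 z.2).unique (hr z.2 z.1)
        simpa [pt] using this
      · have := (hasDerivAt_px hΦ z.1 z.2).unique (space z.1 z.2)
        simpa [px, e] using this
    rw [e1] at h1
    exact hasFDerivAt_fst.prodMk h1
  have hX1 : ContDiff ℝ 1 H.symm := H.contDiff_symm hD hH
  exact ⟨fun t ξ => r ξ t, X, hΦ, contDiff_snd.comp hX1, hr0, fun t ξ => hr ξ t, space, inj, hX⟩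

/-! ### Gluing and reflecting C¹ functions. -/

section Glue

variable {E : Type*} [NormedAddCommGroup E] [NormedSpace ℝ E]

/-- `u` has the derivative `u'` within `S`, which is continuous on `S`. -/
def HasC1Deriv (u : E → ℝ) (u' : E → E →L[ℝ] ℝ) (S : Set E) : Prop :=
  ContinuousOn u' S ∧ ∀ z ∈ S, HasFDerivWithinAt u (u' z) S z

/-- Any continuous derivative field will do, so that glued fields can be used directly, without
unique differentiability of the set. -/
theorem HasC1Deriv.contDiffOn {u : E → ℝ} {u' : E → E →L[ℝ] ℝ} {S : Set E}
    (h : HasC1Deriv u u' S) : ContDiffOn ℝ 1 u S := by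
  rw [← zero_add (1 : WithTop ℕ∞), contDiffOn_succ_iff_hasFDerivWithinAt (by simp)]
  intro x hx
  refine ⟨S, by rw [insert_eq_of_mem hx]; exact self_mem_nhdsWithin, by simp, u', h.2, ?_⟩
  exact contDiffOn_zero.2 h.1

theorem hasC1Deriv_fderivWithin {u : E → ℝ} {S : Set E} (hS : UniqueDiffOn ℝ S)
    (h : ContDiffOn ℝ 1 u S) : HasC1Deriv u (fderivWithin ℝ u S) S :=
  ⟨h.continuousOn_fderivWithin hS (by norm_num),
    fun z hz => (h.differentiableOn (by norm_num) z hz).hasFDerivWithinAt⟩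

open Classical in
/-- Gluing of `C¹` functions on two closed sets. -/
theorem HasC1Deriv.union {u : E → ℝ} {d₁ d₂ : E → E →L[ℝ] ℝ} {S₁ S₂ : Set E}
    (hS₁ : IsClosed S₁) (hS₂ : IsClosed S₂) (h₁ : HasC1Deriv u d₁ S₁) (h₂ : HasC1Deriv u d₂ S₂)
    (h : ∀ z ∈ S₁ ∩ S₂, d₁ z = d₂ z) : HasC1Deriv u (S₁.piecewise d₁ d₂) (S₁ ∪ S₂) := by
  have e₁ : EqOn (S₁.piecewise d₁ d₂) d₁ S₁ := piecewise_eqOn _ _ _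
  have e₂ : EqOn (S₁.piecewise d₁ d₂) d₂ S₂ := by
    intro z hz
    by_cases hz₁ : z ∈ S₁
    · rw [e₁ hz₁, h z ⟨hz₁, hz⟩]
    · exact piecewise_eq_of_notMem _ _ _ hz₁
  refine ⟨(h₁.1.congr e₁).union_of_isClosed (h₂.1.congr e₂) hS₁ hS₂, fun z hz => ?_⟩
  -- At points outside a closed set, having a derivative within it is an empty condition; only
  -- points of the set matter.
  have k : ∀ {S : Set E} {d : E → E →L[ℝ] ℝ}, IsClosed S → HasC1Deriv u d S →
      EqOn (S₁.piecewise d₁ d₂) d S → HasFDerivWithinAt u (S₁.piecewise d₁ d₂ z) S z := by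
    intro S d hS hd he
    by_cases hz : z ∈ S
    · rw [he hz]; exact hd.2 z hz
    · exact HasFDerivWithinAt.of_notMem_closure (by rwa [hS.closure_eq])
  exact (k hS₁ h₁ e₁).union (k hS₂ h₂ e₂)

open Classical in
/-- Extension of a `C¹` function by reflection in a hyperplane. -/
theorem HasC1Deriv.exists_reflect {u : E → ℝ} {u' : E → E →L[ℝ] ℝ} {S : Set E}
    (h : HasC1Deriv u u' S) (hS : IsClosed S) (L : E →L[ℝ] E) (c : E)
    (hR : ∀ z, L (L z + c) + c = z) (hfix : ∀ z ∈ S, L z + c ∈ S → L z + c = z)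
    (hmid : ∀ z ∈ S, (2⁻¹ : ℝ) • (z + (L z + c)) ∈ S) :
    ∃ w w', HasC1Deriv w w' (S ∪ (fun z => L z + c) ⁻¹' S) ∧ EqOn w u S := by
  set R : E → E := fun z => L z + c with hRdef
  set mid : E → E := fun z => (2⁻¹ : ℝ) • (z + R z) with hmiddef
  have Rc : Continuous R := L.continuous.add continuous_const
  have mc : Continuous mid := (continuous_id.add Rc).const_smul _
  have RD : ∀ z, HasFDerivAt R L z := fun z => L.hasFDerivAt.add_const c
  have mD : ∀ z, HasFDerivAt mid ((2⁻¹ : ℝ) • (ContinuousLinearMap.id ℝ E + L)) z := fun z =>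
    ((hasFDerivAt_id z).add (RD z)).const_smul _
  have mids : MapsTo mid (R ⁻¹' S) S := by
    intro z hz
    have := hmid (R z) hz
    have e : L (R z) + c = z := hR z
    rw [e, add_comm] at this
    exact this
  have midfix : ∀ z, R z = z → mid z = z := by
    intro z hz
    simp only [hmiddef, hz, ← two_smul ℝ z, smul_smul]; norm_num
  -- `mid` projects onto the mirror, and the reflection is odd about the trace of `u` there. On the
  -- mirror the derivative is u'∘(1 + L) - u'∘L = u', so normal slopes match as well as values.
  let w : E → ℝ := fun z => if z ∈ S then u z else 2 * u (mid z) - u (R z)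
  have w₁ : EqOn w u S := fun z hz => if_pos hz
  have w₂ : EqOn w (fun z => 2 * u (mid z) - u (R z)) (R ⁻¹' S) := by
    intro z hz
    by_cases hz' : z ∈ S
    · have := hfix z hz' hz
      have e : R z = z := this
      simp only [w, if_pos hz', midfix z e, e]; ring
    · simp only [w, if_neg hz']
  let d : E → E →L[ℝ] ℝ := fun z =>
    (u' (mid z)).comp (ContinuousLinearMap.id ℝ E + L) - (u' (R z)).comp L
  have h₂ : HasC1Deriv w d (R ⁻¹' S) := by
    refine ⟨?_, fun z hz => ?_⟩
    · have k₁ : ContinuousOn (fun z => u' (mid z)) (R ⁻¹' S) := h.1.comp mc.continuousOn mids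
      have k₂ : ContinuousOn (fun z => u' (R z)) (R ⁻¹' S) :=
        h.1.comp Rc.continuousOn fun z hz => hz
      have k₃ := k₁.clm_comp (continuousOn_const (c := ContinuousLinearMap.id ℝ E + L))
      have k₄ := k₂.clm_comp (continuousOn_const (c := L))
      exact k₃.sub k₄
    · refine HasFDerivWithinAt.congr ?_ w₂ (w₂ hz)
      have k₁ := ((h.2 _ (mids hz)).comp z (mD z).hasFDerivWithinAt mids).const_mul 2
      have k₂ := (h.2 _ hz).comp z (RD z).hasFDerivWithinAt fun y hy => hy
      refine (k₁.sub k₂).congr_fderiv ?_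
      ext y
      simp [d]
  refine ⟨w, _, HasC1Deriv.union hS (hS.preimage Rc)
    ⟨h.1, fun z hz => (h.2 z hz).congr w₁ (w₁ hz)⟩ h₂ ?_, w₁⟩
  rintro z ⟨hz, hz'⟩
  have e : R z = z := hfix z hz hz'
  ext y
  simp [d, e, midfix z e]

end Glue

/-! ### Extending the coefficients from the strip to the plane. -/

section Extension

variable {u : ℝ → ℝ → ℝ}

theorem isClosed_strip : IsClosed strip := isClosed_Ici.prod isClosed_Icc

theorem uniqueDiffOn_strip : UniqueDiffOn ℝ strip :=
  (uniqueDiffOn_Ici 0).prod (uniqueDiffOn_Icc one_pos)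

/-- A `C¹` function on the strip extends to a neighbourhood of the strip. -/
theorem exists_extension_wide (hu : C1On u strip) :
    ∃ w : ℝ × ℝ → ℝ, ContDiffOn ℝ 1 w (univ ×ˢ Icc (-1) 3) ∧ EqOn w (Function.uncurry u) strip := by
  let L₁ : ℝ × ℝ →L[ℝ] ℝ × ℝ :=
    (-ContinuousLinearMap.fst ℝ ℝ ℝ).prod (ContinuousLinearMap.snd ℝ ℝ ℝ)
  let L₂ : ℝ × ℝ →L[ℝ] ℝ × ℝ :=
    (ContinuousLinearMap.fst ℝ ℝ ℝ).prod (-ContinuousLinearMap.snd ℝ ℝ ℝ)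
  -- Reflections in t = 0, x = 0 and x = 1 enlarge the domain successively to ℝ × [0, 1], ℝ × [-1,
  -- 1] and ℝ × [-1, 3].
  obtain ⟨w₁, d₁, h₁, e₁⟩ := (hasC1Deriv_fderivWithin uniqueDiffOn_strip hu).exists_reflect
    isClosed_strip L₁ 0 (fun z => by ext <;> simp [L₁])
    (fun z hz hz' => by
      simp only [strip, mem_prod, mem_Ici, L₁] at hz hz'
      ext <;> simp [L₁] at hz' ⊢
      linarith [hz.1])
    (fun z hz => by
      simp only [strip, mem_prod, mem_Ici, mem_Icc, L₁] at hz ⊢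
      simp
      constructor <;> linarith [hz.2.1, hz.2.2])
  have s₁ : strip ∪ (fun z => L₁ z + 0) ⁻¹' strip = univ ×ˢ Icc 0 1 := by
    ext z
    simp only [strip, mem_union, mem_prod, mem_Ici, mem_preimage, L₁, mem_univ, true_and]
    simp
    have := le_total 0 z.1
    tauto
  rw [s₁] at h₁
  have c₁ : IsClosed ((univ : Set ℝ) ×ˢ Icc (0 : ℝ) 1) := isClosed_univ.prod isClosed_Icc
  obtain ⟨w₂, d₂, h₂, e₂⟩ := h₁.exists_reflect c₁ L₂ 0 (fun z => by ext <;> simp [L₂])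
    (fun z hz hz' => by
      simp only [mem_prod, mem_Icc, mem_univ, true_and, L₂] at hz hz'
      ext <;> simp [L₂] at hz' ⊢
      linarith [hz.1])
    (fun z hz => by
      simp only [mem_prod, mem_univ, true_and, mem_Icc, L₂] at hz ⊢
      simp)
  have s₂ : univ ×ˢ Icc 0 1 ∪ (fun z => L₂ z + 0) ⁻¹' (univ ×ˢ Icc (0 : ℝ) 1)
      = univ ×ˢ Icc (-1) 1 := by
    ext z
    simp only [mem_union, mem_prod, mem_preimage, L₂, mem_univ, true_and]
    simp
    constructor
    · rintro (h | h) <;> constructor <;> linarith [h.1, h.2]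
    · rintro h
      rcases le_total 0 z.2 with h0 | h0
      · exact Or.inl ⟨h0, h.2⟩
      · exact Or.inr ⟨h0, by linarith [h.1]⟩
  rw [s₂] at h₂
  have c₂ : IsClosed ((univ : Set ℝ) ×ˢ Icc (-1 : ℝ) 1) := isClosed_univ.prod isClosed_Icc
  obtain ⟨w₃, d₃, h₃, e₃⟩ := h₂.exists_reflect c₂ L₂ (0, 2) (fun z => by ext <;> simp [L₂])
    (fun z hz hz' => by
      simp only [mem_prod, mem_Icc, mem_univ, true_and, L₂] at hz hz'
      ext <;> simp [L₂] at hz' ⊢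
      linarith [hz.2])
    (fun z hz => by
      simp only [mem_prod, mem_univ, true_and, mem_Icc, L₂] at hz ⊢
      simp; constructor <;> linarith [hz.1])
  have s₃ : univ ×ˢ Icc (-1) 1 ∪ (fun z => L₂ z + (0, 2)) ⁻¹' (univ ×ˢ Icc (-1 : ℝ) 1)
      = univ ×ˢ Icc (-1) 3 := by
    ext z
    simp only [mem_union, mem_prod, mem_preimage, L₂, mem_univ, true_and]
    simp
    constructor
    · rintro (h | h) <;> constructor <;> linarith [h.1, h.2]
    · rintro h
      rcases le_total 1 z.2 with h0 | h0
      · exact Or.inr ⟨by linarith [h.2], by linarith⟩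
      · exact Or.inl ⟨h.1, h0⟩
  rw [s₃] at h₃
  refine ⟨w₃, h₃.contDiffOn, fun z hz => ?_⟩
  have m₁ : z ∈ (univ : Set ℝ) ×ˢ Icc (0 : ℝ) 1 := ⟨trivial, hz.2⟩
  have m₂ : z ∈ (univ : Set ℝ) ×ˢ Icc (-1 : ℝ) 1 := ⟨trivial, by linarith [hz.2.1], hz.2.2⟩
  rw [e₃ m₂, e₂ m₁, e₁ hz]

/-- A `C¹` function on the strip agrees on `[0, T] × [0, 1]` with a compactly supported `C¹`
function on the plane. -/
theorem exists_extension (hu : C1On u strip) {T : ℝ} (hT : 0 < T) :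
    ∃ U : ℝ → ℝ → ℝ, ContDiff ℝ 1 (Function.uncurry U) ∧ HasCompactSupport (Function.uncurry U) ∧
      ∀ t ∈ Icc 0 T, ∀ x ∈ Icc (0 : ℝ) 1, U t x = u t x := by
  obtain ⟨w, hw, he⟩ := exists_extension_wide hu
  -- The bumps equal 1 on [0, T] and [0, 1]. The second is supported in [-1/2, 3/2], well inside the
  -- interval [-1, 3] where the wide extension is C¹.
  let χ₁ : ContDiffBump (T / 2) := ⟨T / 2, T / 2 + 1, by positivity, by linarith⟩
  let χ₂ : ContDiffBump (1 / 2 : ℝ) := ⟨1 / 2, 1, by positivity, by norm_num⟩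
  let χ : ℝ × ℝ → ℝ := fun z => χ₁ z.1 * χ₂ z.2
  have hχ : ContDiff ℝ 1 χ :=
    (χ₁.contDiff.comp contDiff_fst).mul (χ₂.contDiff.comp contDiff_snd)
  have hsupp : Function.support χ ⊆
      Metric.closedBall (T / 2) (T / 2 + 1) ×ˢ Metric.closedBall (1 / 2) 1 := by
    intro z hz
    have h1 : χ₁ z.1 ≠ 0 := left_ne_zero_of_mul hz
    have h2 : χ₂ z.2 ≠ 0 := right_ne_zero_of_mul hz
    have h1' : z.1 ∈ Function.support χ₁ := h1
    have h2' : z.2 ∈ Function.support χ₂ := h2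
    rw [χ₁.support_eq] at h1'
    rw [χ₂.support_eq] at h2'
    exact ⟨Metric.ball_subset_closedBall h1', Metric.ball_subset_closedBall h2'⟩
  have hcl : IsCompact (Metric.closedBall (T / 2) (T / 2 + 1) ×ˢ Metric.closedBall (1 / 2 : ℝ) 1) :=
    (isCompact_closedBall _ _).prod (isCompact_closedBall _ _)
  have hcs : HasCompactSupport χ := HasCompactSupport.of_support_subset_isCompact hcl hsupp
  have hts : tsupport χ ⊆ _ := closure_minimal hsupp hcl.isClosed
  have hU : ContDiff ℝ 1 (fun z => χ z * w z) := by
    refine contDiff_iff_contDiffAt.2 fun z => ?_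
    by_cases hz : z ∈ tsupport fun z => χ z * w z
    swap
    · exact contDiffAt_const.congr_of_eventuallyEq (notMem_tsupport_iff_eventuallyEq.1 hz)
    have hz' := hts (tsupport_mul_subset_left hz)
    refine hχ.contDiffAt.mul (hw.contDiffAt ?_)
    have : z.2 ∈ Metric.closedBall (1 / 2 : ℝ) 1 := hz'.2
    rw [Real.closedBall_eq_Icc] at this
    exact prod_mem_nhds univ_mem (Icc_mem_nhds (by linarith [this.1]) (by linarith [this.2]))
  refine ⟨fun t x => χ (t, x) * w (t, x), hU, hcs.mul_right, fun t ht x hx => ?_⟩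
  have h1 : χ₁ t = 1 := χ₁.one_of_mem_closedBall (by
    rw [Real.closedBall_eq_Icc]; constructor <;> simp only [χ₁] <;>
      linarith [ht.1, ht.2])
  have h2 : χ₂ x = 1 := χ₂.one_of_mem_closedBall (by
    rw [Real.closedBall_eq_Icc]; constructor <;> simp only [χ₂] <;>
      linarith [hx.1, hx.2])
  have h3 := he (x := (t, x)) ⟨ht.1, hx⟩
  simp only [χ, h1, h2, h3, one_mul, Function.uncurry]

/-- A positive `C¹` function on the strip agrees on `[0, T] × [0, 1]` with a positive
function on the plane whose values and `x`-derivative are bounded and which is bounded below. -/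
theorem exists_extension_pos (hu : C1On u strip)
    (hpos : ∀ t x : ℝ, 0 ≤ t → x ∈ Icc (0 : ℝ) 1 → 0 < u t x) {T : ℝ} (hT : 0 < T) :
    ∃ U : ℝ → ℝ → ℝ, ContDiff ℝ 1 (Function.uncurry U) ∧
      (∃ m > 0, ∀ t x, m ≤ U t x) ∧ (∃ M : NNReal, ∀ t x, |U t x| ≤ M) ∧
      (∃ K : NNReal, ∀ t x, |px U t x| ≤ K) ∧
      ∀ t ∈ Icc 0 T, ∀ x ∈ Icc (0 : ℝ) 1, U t x = u t x := by
  -- Extending the logarithm with compact support and exponentiating keeps the speed positive,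
  -- bounded, bounded away from zero and with bounded x-derivative.
  have hl : C1On (fun t x => Real.log (u t x)) strip :=
    ContDiffOn.log (f := Function.uncurry u) hu fun z hz => (hpos z.1 z.2 hz.1 hz.2).ne'
  obtain ⟨W, hW, hc, he⟩ := exists_extension hl hT
  obtain ⟨C, hC⟩ := hc.exists_bound_of_continuous hW.continuous
  obtain ⟨C', hC'⟩ := (hc.fderiv (𝕜 := ℝ)).exists_bound_of_continuous
    (hW.continuous_fderiv (by norm_num))
  have hV : ContDiff ℝ 1 (Function.uncurry fun t x => Real.exp (W t x)) := Real.contDiff_exp.comp hW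
  have hle : ∀ t x, |W t x| ≤ C := fun t x => hC (t, x)
  have hub : ∀ t x, |Real.exp (W t x)| ≤ Real.exp C := fun t x => by
    rw [Real.abs_exp]; exact Real.exp_le_exp.2 (abs_le.1 (hle t x)).2
  refine ⟨fun t x => Real.exp (W t x), hV, ⟨Real.exp (-C), Real.exp_pos _, fun t x =>
    Real.exp_le_exp.2 (abs_le.1 (hle t x)).1⟩, ⟨⟨Real.exp C, (Real.exp_pos _).le⟩, hub⟩,
    ⟨⟨Real.exp C * |C'|, by positivity⟩, fun t x => ?_⟩, fun t ht x hx => ?_⟩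
  · have h1 := (hasDerivAt_px hV t x).unique (hasDerivAt_px hW t x).exp
    rw [h1, abs_mul]
    refine mul_le_mul (hub t x) ?_ (abs_nonneg _) (Real.exp_pos _).le
    have h2 := (fderiv ℝ (Function.uncurry W) (t, x)).le_opNorm (0, 1)
    have h3 : ‖((0 : ℝ), (1 : ℝ))‖ = 1 := by simp [Prod.norm_def]
    rw [h3, mul_one] at h2
    exact h2.trans ((hC' (t, x)).trans (le_abs_self _))
  · simp only [he t ht x hx]
    exact Real.exp_log (hpos t x ht.1 hx)

end Extension

/-! ### The Cauchy problem on the plane. -/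

/-- Coefficients on the whole plane, with a flow for the positive speed `V`. -/
structure IsModel (V A F Φ X : ℝ → ℝ → ℝ) : Prop extends IsFlow V Φ X where
  contDiff_speed : ContDiff ℝ 1 (Function.uncurry V)
  contDiff_coeff : ContDiff ℝ 1 (Function.uncurry A)
  contDiff_source : ContDiff ℝ 1 (Function.uncurry F)
  lower : ∃ m > 0, ∀ t x, m ≤ V t x
  lip : ∃ K : NNReal, ∀ t, LipschitzWith K (V t)

/-- The solution factor of the homogeneous equation along the characteristic through `(0, ξ)`. -/
def growth (A Φ : ℝ → ℝ → ℝ) (t ξ : ℝ) : ℝ := Real.exp (∫ s in (0 : ℝ)..t, A s (Φ s ξ))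

/-- The contribution of the source along the characteristic through `(0, ξ)`. -/
def accum (A F Φ : ℝ → ℝ → ℝ) (t ξ : ℝ) : ℝ := ∫ s in (0 : ℝ)..t, F s (Φ s ξ) / growth A Φ s ξ

/-- The solution with data `ψ` on the line `t = 0`. -/
def cauchySol (A F Φ X : ℝ → ℝ → ℝ) (ψ : ℝ → ℝ) (t x : ℝ) : ℝ :=
  growth A Φ t (X t x) * (ψ (X t x) + accum A F Φ t (X t x))

namespace IsModel

variable {V A F Φ X : ℝ → ℝ → ℝ}

theorem speed_pos (h : IsModel V A F Φ X) (t x : ℝ) : 0 < V t x := by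
  obtain ⟨m, hm, hl⟩ := h.lower
  exact hm.trans_le (hl t x)

theorem strictMono_flow (h : IsModel V A F Φ X) (t : ℝ) : StrictMono (Φ t) :=
  strictMono_of_hasDerivAt_pos (fun ξ => h.hasDerivAt_space t ξ) fun _ => Real.exp_pos _

theorem strictMono_foot (h : IsModel V A F Φ X) (t : ℝ) : StrictMono (X t) := by
  intro x y hxy
  rw [← (h.strictMono_flow t).lt_iff_lt, h.flow_foot, h.flow_foot]
  exact hxy

theorem strictMono_time (h : IsModel V A F Φ X) (ξ : ℝ) : StrictMono fun t => Φ t ξ :=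
  strictMono_of_hasDerivAt_pos (fun t => h.hasDerivAt_time t ξ) fun _ => h.speed_pos _ _

theorem foot_zero (h : IsModel V A F Φ X) (x : ℝ) : X 0 x = x := by
  have := h.flow_foot 0 x
  rwa [h.flow_zero] at this

theorem foot_le (h : IsModel V A F Φ X) {t : ℝ} (ht : 0 ≤ t) (x : ℝ) : X t x ≤ x := by
  have := (h.strictMono_time (X t x)).monotone ht
  simpa [h.flow_zero, h.flow_foot] using this

theorem continuous_flow (h : IsModel V A F Φ X) : Continuous (Function.uncurry Φ) :=
  h.contDiff_flow.continuous

theorem continuous_foot (h : IsModel V A F Φ X) : Continuous (Function.uncurry X) :=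
  h.contDiff_foot.continuous

theorem px_foot_pos (h : IsModel V A F Φ X) (t x : ℝ) : 0 < px X t x := by
  have h1 := (hasDerivAt_px h.contDiff_foot t (Φ t (X t x))).comp (X t x)
    (h.hasDerivAt_space t (X t x))
  have h2 : HasDerivAt (X t ∘ Φ t) 1 (X t x) := by
    have : X t ∘ Φ t = id := funext fun ξ => h.foot_flow t ξ
    rw [this]; exact hasDerivAt_id _
  have h3 := h1.unique h2
  rw [h.flow_foot] at h3
  refine pos_of_mul_pos_left (b := Real.exp (∫ s in (0 : ℝ)..t, px V s (Φ s (X t x)))) ?_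
    (Real.exp_pos _).le
  rw [h3]; exact one_pos

/-- Derivative of a `C¹` function along a characteristic. -/
theorem hasDerivAt_along (h : IsModel V A F Φ X) {u : ℝ → ℝ → ℝ}
    (hu : ContDiff ℝ 1 (Function.uncurry u)) (t ξ : ℝ) :
    HasDerivAt (fun s => u s (Φ s ξ)) (pt u t (Φ t ξ) + V t (Φ t ξ) * px u t (Φ t ξ)) t := by
  simpa using hasDerivAt_comp_curve hu (hasDerivAt_id t) (h.hasDerivAt_time t ξ)

/-- The foot is constant along each characteristic; the chain rule turns this into the homogeneous
transport equation. -/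
theorem transport_foot (h : IsModel V A F Φ X) (t x : ℝ) : pt X t x + V t x * px X t x = 0 := by
  have h1 := h.hasDerivAt_along h.contDiff_foot t (X t x)
  have h2 : HasDerivAt (fun s => X s (Φ s (X t x))) 0 t := by
    simp only [h.foot_flow]; exact hasDerivAt_const _ _
  have h3 := h1.unique h2
  rwa [h.flow_foot] at h3

/-- The time at which the characteristic through `(0, ξ)` meets the line `x = 0`. -/
theorem exists_hitting (h : IsModel V A F Φ X) : ∃ θ : ℝ → ℝ, ContDiff ℝ 1 θ ∧
    (∀ ξ, Φ (θ ξ) ξ = 0) ∧ ∀ t, θ (X t 0) = t := by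
  obtain ⟨m, hm, hl⟩ := h.lower
  -- The hitting time inverts t ↦ X t 0, a C¹ function whose derivative never vanishes, by the
  -- transport equation for the foot.
  have hd : ∀ t, HasDerivAt (fun s => -X s 0) (V t 0 * px X t 0) t := fun t => by
    have := (hasDerivAt_pt h.contDiff_foot t 0).neg
    rwa [show -pt X t 0 = V t 0 * px X t 0 by linarith [h.transport_foot t 0]] at this
  have hp : ∀ t, 0 < V t 0 * px X t 0 := fun t => mul_pos (h.speed_pos t 0) (h.px_foot_pos t 0)
  have hmono : StrictMono fun s => -X s 0 := strictMono_of_hasDerivAt_pos hd hp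
  -- With speed at least `m`, a characteristic from `ξ` must cross x = 0 between the times -|ξ|/m
  -- and |ξ|/m.
  have grow : ∀ ξ, ∀ s t : ℝ, s ≤ t → m * (t - s) ≤ Φ t ξ - Φ s ξ := by
    intro ξ s t hst
    refine convex_univ.mul_sub_le_image_sub_of_le_deriv (f := fun t => Φ t ξ)
      (fun t _ => (h.hasDerivAt_time t ξ).continuousAt.continuousWithinAt)
      (fun t _ => (h.hasDerivAt_time t ξ).differentiableAt.differentiableWithinAt)
      (fun t _ => ?_) s trivial t trivial hst
    rw [(h.hasDerivAt_time t ξ).deriv]; exact hl _ _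
  have hit : ∀ ξ, ∃ t, Φ t ξ = 0 := by
    intro ξ
    have hc : Continuous fun t => Φ t ξ :=
      continuous_iff_continuousAt.2 fun t => (h.hasDerivAt_time t ξ).continuousAt
    have e : m * (|ξ| / m) = |ξ| := by field_simp
    have h0 : 0 ≤ |ξ| / m := by positivity
    have h1 := grow ξ 0 (|ξ| / m) h0
    have h2 := grow ξ (-(|ξ| / m)) 0 (by linarith)
    rw [h.flow_zero] at h1 h2
    simp only [sub_zero, zero_sub, neg_neg, e] at h1 h2
    obtain ⟨t, -, ht⟩ := intermediate_value_Icc (by linarith : -(|ξ| / m) ≤ |ξ| / m)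
      hc.continuousOn (show (0 : ℝ) ∈ Icc _ _ from
        ⟨by linarith [le_abs_self ξ], by linarith [neg_abs_le ξ]⟩)
    exact ⟨t, ht⟩
  have hsurj : Function.Surjective fun s => -X s 0 := by
    intro y
    obtain ⟨t, ht⟩ := hit (-y)
    refine ⟨t, ?_⟩
    have := h.foot_flow t (-y)
    rw [ht] at this
    simp [this]
  let H : ℝ ≃ₜ ℝ := (hmono.orderIsoOfSurjective _ hsurj).toHomeomorph
  have hC : ContDiff ℝ 1 (H.symm : ℝ → ℝ) :=
    H.contDiff_symm_deriv (f' := fun t => V t 0 * px X t 0) (fun t => (hp t).ne') hd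
      (h.contDiff_foot.comp (contDiff_id.prodMk contDiff_const)).neg
  have e1 : ∀ y, -X (H.symm y) 0 = y := fun y => H.apply_symm_apply y
  have e2 : ∀ t, H.symm (-X t 0) = t := fun t => H.symm_apply_apply t
  refine ⟨fun ξ => H.symm (-ξ), hC.comp contDiff_neg, fun ξ => ?_, e2⟩
  have h1 : X (H.symm (-ξ)) 0 = ξ := by linarith [e1 (-ξ)]
  have h2 := h.flow_foot (H.symm (-ξ)) 0
  rwa [h1] at h2

theorem growth_pos (A Φ : ℝ → ℝ → ℝ) (t ξ : ℝ) : 0 < growth A Φ t ξ := Real.exp_pos _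

theorem contDiff_coeff_flow (h : IsModel V A F Φ X) :
    ContDiff ℝ 1 (Function.uncurry fun t ξ => A t (Φ t ξ)) :=
  h.contDiff_coeff.comp (contDiff_fst.prodMk h.contDiff_flow)

theorem contDiff_growth (h : IsModel V A F Φ X) : ContDiff ℝ 1 (Function.uncurry (growth A Φ)) :=
  Real.contDiff_exp.comp (contDiff_primitive h.contDiff_coeff_flow)

theorem contDiff_integrand (h : IsModel V A F Φ X) :
    ContDiff ℝ 1 (Function.uncurry fun t ξ => F t (Φ t ξ) / growth A Φ t ξ) :=
  ContDiff.div (h.contDiff_source.comp (contDiff_fst.prodMk h.contDiff_flow)) h.contDiff_growth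
    fun z => (growth_pos A Φ z.1 z.2).ne'

theorem contDiff_accum (h : IsModel V A F Φ X) : ContDiff ℝ 1 (Function.uncurry (accum A F Φ)) :=
  contDiff_primitive h.contDiff_integrand

theorem hasDerivAt_growth (h : IsModel V A F Φ X) (t ξ : ℝ) :
    HasDerivAt (fun s => growth A Φ s ξ) (A t (Φ t ξ) * growth A Φ t ξ) t := by
  have hc : Continuous fun s => A s (Φ s ξ) :=
    h.contDiff_coeff_flow.continuous.comp (by fun_prop : Continuous fun s : ℝ => (s, ξ))
  rw [mul_comm]
  exact (hasDerivAt_primitive hc t).exp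

theorem hasDerivAt_accum (h : IsModel V A F Φ X) (t ξ : ℝ) :
    HasDerivAt (fun s => accum A F Φ s ξ) (F t (Φ t ξ) / growth A Φ t ξ) t :=
  hasDerivAt_primitive (h.contDiff_integrand.continuous.comp
    (by fun_prop : Continuous fun s : ℝ => (s, ξ))) t

theorem contDiff_growth_foot (h : IsModel V A F Φ X) :
    ContDiff ℝ 1 (Function.uncurry fun t x => growth A Φ t (X t x)) :=
  h.contDiff_growth.comp (contDiff_fst.prodMk h.contDiff_foot)

theorem contDiff_accum_foot (h : IsModel V A F Φ X) :
    ContDiff ℝ 1 (Function.uncurry fun t x => accum A F Φ t (X t x)) :=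
  h.contDiff_accum.comp (contDiff_fst.prodMk h.contDiff_foot)

theorem transport_growth (h : IsModel V A F Φ X) (t x : ℝ) :
    pt (fun t x => growth A Φ t (X t x)) t x + V t x * px (fun t x => growth A Φ t (X t x)) t x
      = A t x * growth A Φ t (X t x) := by
  have h1 := h.hasDerivAt_along h.contDiff_growth_foot t (X t x)
  simp only [h.foot_flow] at h1
  have h3 := h1.unique (h.hasDerivAt_growth t (X t x))
  rwa [h.flow_foot] at h3

theorem transport_accum (h : IsModel V A F Φ X) (t x : ℝ) :
    pt (fun t x => accum A F Φ t (X t x)) t x + V t x * px (fun t x => accum A F Φ t (X t x)) t x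
      = F t x / growth A Φ t (X t x) := by
  have h1 := h.hasDerivAt_along h.contDiff_accum_foot t (X t x)
  simp only [h.foot_flow] at h1
  have h3 := h1.unique (h.hasDerivAt_accum t (X t x))
  rwa [h.flow_foot] at h3

theorem fderiv_apply_speed (u : ℝ → ℝ → ℝ) (t x c : ℝ) :
    fderiv ℝ (Function.uncurry u) (t, x) (1, c) = pt u t x + c * px u t x := by
  have : ((1 : ℝ), c) = ((1 : ℝ), (0 : ℝ)) + c • ((0 : ℝ), (1 : ℝ)) := by simp
  rw [this, map_add, map_smul]; rfl

/-- `cauchySol` solves the transport equation wherever the data are differentiable. -/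
theorem hasFDerivWithinAt_cauchySol (h : IsModel V A F Φ X) {ψ : ℝ → ℝ} {d t x : ℝ}
    {S : Set (ℝ × ℝ)} {I : Set ℝ} (hS : MapsTo (Function.uncurry X) S I)
    (hψ : HasDerivWithinAt ψ d I (X t x)) :
    ∃ D : ℝ × ℝ →L[ℝ] ℝ, HasFDerivWithinAt (Function.uncurry (cauchySol A F Φ X ψ)) D S (t, x) ∧
      D (1, V t x) = A t x * cauchySol A F Φ X ψ t x + F t x := by
  have hX := (hasFDerivAt_uncurry h.contDiff_foot (t, x)).hasFDerivWithinAt (s := S)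
  have hg := (hasFDerivAt_uncurry h.contDiff_growth_foot (t, x)).hasFDerivWithinAt (s := S)
  have hq := (hasFDerivAt_uncurry h.contDiff_accum_foot (t, x)).hasFDerivWithinAt (s := S)
  have hc : HasFDerivWithinAt (ψ ∘ Function.uncurry X) _ S (t, x) :=
    HasDerivWithinAt.comp_hasFDerivWithinAt (t, x) hψ hX hS
  refine ⟨_, hg.mul (hc.add hq), ?_⟩
  have g0 := (growth_pos A Φ t (X t x)).ne'
  -- In the direction (1, V), the data at the foot contribute nothing, the growth factor produces
  -- the term with `A`, and the accumulated source divided by growth restores `F`.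
  simp only [_root_.add_apply, _root_.smul_apply, fderiv_apply_speed,
    h.transport_foot, h.transport_growth, h.transport_accum, smul_eq_mul, Function.uncurry_apply_pair,
    cauchySol]
  field_simp
  ring

end IsModel

/-! ### One-sided regularity and piecewise C¹ functions. -/

/-- `g` and its derivative have finite limits from the right at `x`. -/
def RightC1 (g : ℝ → ℝ) (x : ℝ) : Prop := ∃ (l L : ℝ) (g' : ℝ → ℝ), Tendsto g (𝓝[>] x) (𝓝 l) ∧
  (∀ᶠ y in 𝓝[>] x, HasDerivAt g (g' y) y) ∧ Tendsto g' (𝓝[>] x) (𝓝 L)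

section RightC1

variable {g k : ℝ → ℝ} {x : ℝ}

theorem rightC1_of_contDiff (hg : ContDiff ℝ 1 g) : RightC1 g x :=
  ⟨g x, deriv g x, deriv g, (hg.continuous.tendsto x).mono_left nhdsWithin_le_nhds,
    Eventually.of_forall fun y => (hg.differentiable (by norm_num) y).hasDerivAt,
    ((hg.continuous_deriv (by norm_num)).tendsto x).mono_left nhdsWithin_le_nhds⟩

theorem RightC1.congr (hg : RightC1 g x) (h : g =ᶠ[𝓝[>] x] k) : RightC1 k x := by
  obtain ⟨l, L, g', h1, h2, h3⟩ := hg
  refine ⟨l, L, g', h1.congr' h, ?_, h3⟩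
  filter_upwards [h2, eventually_eventually_nhdsWithin.2 h, self_mem_nhdsWithin] with y hy he hyx
  rw [isOpen_Ioi.nhdsWithin_eq hyx] at he
  exact hy.congr_of_eventuallyEq (he.mono fun _ => Eq.symm)

theorem RightC1.add (hg : RightC1 g x) (hk : RightC1 k x) : RightC1 (fun y => g y + k y) x := by
  obtain ⟨l, L, g', h1, h2, h3⟩ := hg
  obtain ⟨m, M, k', j1, j2, j3⟩ := hk
  refine ⟨_, _, fun y => g' y + k' y, h1.add j1, ?_, h3.add j3⟩
  filter_upwards [h2, j2] with y hy jy using hy.add jy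

theorem RightC1.mul (hg : RightC1 g x) (hk : RightC1 k x) : RightC1 (fun y => g y * k y) x := by
  obtain ⟨l, L, g', h1, h2, h3⟩ := hg
  obtain ⟨m, M, k', j1, j2, j3⟩ := hk
  refine ⟨_, _, fun y => g' y * k y + g y * k' y, h1.mul j1, ?_, (h3.mul j1).add (h1.mul j3)⟩
  filter_upwards [h2, j2] with y hy jy using hy.mul jy

theorem RightC1.comp {u : ℝ → ℝ} (hu : ContDiff ℝ 1 u) (hm : StrictMono u)
    (hg : RightC1 g (u x)) : RightC1 (fun y => g (u y)) x := by
  obtain ⟨l, L, g', h1, h2, h3⟩ := hg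
  have ht : Tendsto u (𝓝[>] x) (𝓝[>] (u x)) :=
    tendsto_nhdsWithin_of_tendsto_nhds_of_eventually_within _
      ((hu.continuous.tendsto x).mono_left nhdsWithin_le_nhds)
      (by filter_upwards [self_mem_nhdsWithin] with y hy using hm hy)
  have hd := ((hu.continuous_deriv (by norm_num)).tendsto x).mono_left
    (nhdsWithin_le_nhds (s := Ioi x))
  refine ⟨l, _, fun y => g' (u y) * deriv u y, h1.comp ht, ?_, (h3.comp ht).mul hd⟩
  filter_upwards [ht.eventually h2] with y hy
  exact hy.comp y (hu.differentiable (by norm_num) y).hasDerivAt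

/-- By the mean value theorem each quotient equals g' at an intermediate point, which is forced to x
from the right. The condition with g' is stable under products and compositions, unlike the joint
quotient limit taken directly. -/
theorem RightC1.tendsto_quotient (hg : RightC1 g x) : ∃ L : ℝ,
    Tendsto (fun q : ℝ × ℝ => q.1⁻¹ * (g (q.2 + q.1) - g q.2)) (𝓝[>] 0 ×ˢ 𝓝[>] x) (𝓝 L) := by
  obtain ⟨l, L, g', -, h2, h3⟩ := hg
  refine ⟨L, Metric.tendsto_nhds.2 fun ε hε => ?_⟩
  have hev := h2.and (Metric.tendsto_nhds.1 h3 ε hε)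
  obtain ⟨z, hz, hzs⟩ := mem_nhdsGT_iff_exists_Ioo_subset.1 hev
  -- Half of the good interval is allotted to the base point and half to the increment, so that
  -- their sum stays below `z`.
  have hz' : 0 < (z - x) / 2 := by have : x < z := hz; linarith
  have e1 : Ioo 0 ((z - x) / 2) ∈ 𝓝[>] (0 : ℝ) := Ioo_mem_nhdsGT hz'
  have e2 : Ioo x (x + (z - x) / 2) ∈ 𝓝[>] x := Ioo_mem_nhdsGT (by linarith)
  filter_upwards [prod_mem_prod e1 e2] with q hq
  have hq1 := hq.1
  have hq2 := hq.2
  have hsub : ∀ c ∈ Icc q.2 (q.2 + q.1), c ∈ Ioo x z := fun c hc =>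
    ⟨hq2.1.trans_le hc.1, by linarith [hc.2, hq1.2, hq2.2]⟩
  obtain ⟨c, hc, hce⟩ := exists_hasDerivAt_eq_slope g g' (by linarith [hq1.1] : q.2 < q.2 + q.1)
    (fun c hc => (hzs (hsub c hc)).1.continuousAt.continuousWithinAt)
    (fun c hc => (hzs (hsub c (Ioo_subset_Icc_self hc))).1)
  have e : q.1⁻¹ * (g (q.2 + q.1) - g q.2) = g' c := by
    rw [hce, add_sub_cancel_left]; ring
  rw [e]
  exact (hzs (hsub c (Ioo_subset_Icc_self hc))).2

end RightC1

section PC1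

variable {g k : ℝ → ℝ}

theorem tendsto_left_quotient_iff {x l : ℝ} :
    Tendsto (fun h : ℝ => h⁻¹ * (g (x + h) - g x)) (𝓝[<] 0) (𝓝 l) ↔
      HasDerivWithinAt g l (Iic x) x := by
  rw [← hasDerivWithinAt_Iio_iff_Iic, hasDerivWithinAt_iff_tendsto_slope' self_notMem_Iio]
  constructor
  · intro h
    have ht : Tendsto (fun y => y - x) (𝓝[<] x) (𝓝[<] 0) := by
      refine tendsto_nhdsWithin_of_tendsto_nhds_of_eventually_within _ ?_ ?_
      · have : Tendsto (fun y : ℝ => y - x) (𝓝 x) (𝓝 (x - x)) := tendsto_id.sub_const x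
        rw [sub_self] at this
        exact this.mono_left nhdsWithin_le_nhds
      · filter_upwards [self_mem_nhdsWithin] with y hy using sub_neg.2 (mem_Iio.1 hy)
    refine (h.comp ht).congr fun y => ?_
    simp [slope_def_field, div_eq_inv_mul]
  · intro h
    have ht : Tendsto (fun h => x + h) (𝓝[<] 0) (𝓝[<] x) := by
      refine tendsto_nhdsWithin_of_tendsto_nhds_of_eventually_within _ ?_ ?_
      · have : Tendsto (fun y : ℝ => x + y) (𝓝 0) (𝓝 (x + 0)) := tendsto_id.const_add x
        rw [add_zero] at this
        exact this.mono_left nhdsWithin_le_nhds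
      · filter_upwards [self_mem_nhdsWithin] with y hy
        have : y < 0 := hy
        show x + y < x
        linarith
    refine (h.comp ht).congr fun y => ?_
    simp [slope_def_field, div_eq_inv_mul]

theorem PC1.hasDerivWithinAt_left (hg : PC1 g) {x : ℝ} (hx : x ∈ Ioc (0 : ℝ) 1) :
    ∃ l, HasDerivWithinAt g l (Iic x) x := by
  obtain ⟨l, hl⟩ := hg.leftDeriv x hx
  exact ⟨l, tendsto_left_quotient_iff.1 hl⟩

/-- Just to the right of x there are no break points. Freezing y and letting h → 0 in the joint
limit then shows that g'(y) is close to L. -/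
theorem PC1.rightC1 (hg : PC1 g) {x : ℝ} (hx : x ∈ Ico (0 : ℝ) 1) : RightC1 g x := by
  obtain ⟨l, hl⟩ := hg.rightLim x hx
  obtain ⟨L, hL⟩ := hg.rightDeriv x hx
  obtain ⟨J, -, hJ, -⟩ := hg.piecewise
  have hd : ∀ᶠ y in 𝓝[>] x, HasDerivAt g (deriv g y) y := by
    have h1 : Ioo x 1 ∈ 𝓝[>] x := Ioo_mem_nhdsGT hx.2
    have h2 : ((J : Set ℝ) \ {x})ᶜ ∈ 𝓝 x :=
      ((J.finite_toSet.subset sdiff_subset).isClosed.isOpen_compl).mem_nhds (by simp)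
    filter_upwards [h1, nhdsWithin_le_nhds h2] with y hy hyJ
    refine (hJ y ⟨⟨hx.1.trans_lt hy.1, hy.2⟩, fun hmem => hyJ ⟨hmem, ?_⟩⟩).hasDerivAt
    exact hy.1.ne'
  refine ⟨l, L, deriv g, hl, hd, Metric.tendsto_nhds.2 fun ε hε => ?_⟩
  have h1 := (Filter.eventually_swap_iff.1 (Metric.tendsto_nhds.1 hL (ε / 2) (by linarith))).curry
  filter_upwards [h1, hd] with y hy hdy
  have h2 := hdy.tendsto_slope_zero_right
  have h3 : dist (deriv g y) L ≤ ε / 2 := by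
    refine le_of_tendsto (h2.dist tendsto_const_nhds) ?_
    filter_upwards [hy] with t ht
    exact le_of_lt ht
  linarith

theorem pc1_of (hl : ∀ x ∈ Ioc (0 : ℝ) 1, ∃ l, HasDerivWithinAt g l (Iic x) x)
    (hr : ∀ x ∈ Ico (0 : ℝ) 1, RightC1 g x) {J : Finset ℝ} (hJ : (J : Set ℝ) ⊆ Ioo 0 1)
    (hd : ContDiffOn ℝ 1 g (Ioo 0 1 \ J)) : PC1 g where
  leftCont x hx := by
    obtain ⟨l, hl⟩ := hl x hx
    exact hl.continuousWithinAt.mono_left (nhdsWithin_mono x Iio_subset_Iic_self)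
  rightLim x hx := by
    obtain ⟨l, -, -, h, -⟩ := hr x hx
    exact ⟨l, h⟩
  rightDeriv x hx := (hr x hx).tendsto_quotient
  leftDeriv x hx := by
    obtain ⟨l, hl⟩ := hl x hx
    exact ⟨l, tendsto_left_quotient_iff.2 hl⟩
  piecewise := by
    have ho : IsOpen (Ioo (0 : ℝ) 1 \ J) := isOpen_Ioo.sdiff J.finite_toSet.isClosed
    exact ⟨J, hJ, fun x hx => (hd.differentiableOn (by norm_num)).differentiableAt (ho.mem_nhds hx),
      hd.continuousOn_deriv_of_isOpen ho (by norm_num)⟩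

end PC1

/-! ### The mixed problem as a Cauchy problem with continued data. -/

/-- `θ ξ` is the time at which the characteristic through `(0, ξ)` meets the line `x = 0`. -/
structure IsHitting (Φ X : ℝ → ℝ → ℝ) (θ : ℝ → ℝ) : Prop where
  contDiff : ContDiff ℝ 1 θ
  flow_hit : ∀ ξ, Φ (θ ξ) ξ = 0
  hit_foot : ∀ t, θ (X t 0) = t

/-- The values on the line `t = 0` that produce the boundary values `b` on the line `x = 0`. -/
def inflow (A F Φ : ℝ → ℝ → ℝ) (θ b : ℝ → ℝ) (ξ : ℝ) : ℝ :=
  b (θ ξ) / growth A Φ (θ ξ) ξ - accum A F Φ (θ ξ) ξ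

/-- The initial values `φ`, continued to negative arguments by `inflow`. -/
def fullData (A F Φ : ℝ → ℝ → ℝ) (θ φ b : ℝ → ℝ) (ξ : ℝ) : ℝ :=
  -- The corner ξ = 0 belongs to the boundary branch. As `X t` is increasing, this makes the
  -- profiles left-continuous across the characteristic from the corner.
  if ξ ≤ 0 then inflow A F Φ θ b ξ else φ ξ

/-- The solution of the initial-boundary value problem. -/
def mixedSol (A F Φ X : ℝ → ℝ → ℝ) (θ φ b : ℝ → ℝ) : ℝ → ℝ → ℝ :=
  cauchySol A F Φ X (fullData A F Φ θ φ b)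

theorem growth_zero (A Φ : ℝ → ℝ → ℝ) (ξ : ℝ) : growth A Φ 0 ξ = 1 := by simp [growth]

theorem accum_zero (A F Φ : ℝ → ℝ → ℝ) (ξ : ℝ) : accum A F Φ 0 ξ = 0 := by simp [accum]

namespace IsModel

variable {V A F Φ X : ℝ → ℝ → ℝ} {θ φ b : ℝ → ℝ}

theorem exists_isHitting (h : IsModel V A F Φ X) : ∃ θ, IsHitting Φ X θ := by
  obtain ⟨θ, h1, h2, h3⟩ := h.exists_hitting
  exact ⟨θ, h1, h2, h3⟩

theorem hit_zero (h : IsModel V A F Φ X) (hθ : IsHitting Φ X θ) : θ 0 = 0 := by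
  have := hθ.hit_foot 0
  rwa [h.foot_zero] at this

theorem hit_nonneg (h : IsModel V A F Φ X) (hθ : IsHitting Φ X θ) {ξ : ℝ} (hξ : ξ ≤ 0) :
    0 ≤ θ ξ := by
  rw [← (h.strictMono_time ξ).le_iff_le]
  simp only [hθ.flow_hit, h.flow_zero]
  exact hξ

theorem contDiffOn_inflow (h : IsModel V A F Φ X) (hθ : IsHitting Φ X θ)
    (hb : ContDiffOn ℝ 1 b (Ici 0)) : ContDiffOn ℝ 1 (inflow A F Φ θ b) (Iic 0) := by
  have h1 : ContDiffOn ℝ 1 (fun ξ => b (θ ξ)) (Iic 0) :=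
    hb.comp hθ.contDiff.contDiffOn fun ξ hξ => h.hit_nonneg hθ hξ
  have h2 : ContDiff ℝ 1 fun ξ => growth A Φ (θ ξ) ξ :=
    h.contDiff_growth.comp (hθ.contDiff.prodMk contDiff_id)
  have h3 : ContDiff ℝ 1 fun ξ => accum A F Φ (θ ξ) ξ :=
    h.contDiff_accum.comp (hθ.contDiff.prodMk contDiff_id)
  exact (h1.div h2.contDiffOn fun ξ _ => (growth_pos A Φ _ _).ne').sub h3.contDiffOn

theorem inflow_zero (h : IsModel V A F Φ X) (hθ : IsHitting Φ X θ) :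
    inflow A F Φ θ b 0 = b 0 := by
  simp [inflow, h.hit_zero hθ, growth_zero, accum_zero]

/-- This is the left slope of the continued data at the corner; it equals φ'(0) exactly under the
first-order compatibility condition. -/
theorem derivWithin_inflow (h : IsModel V A F Φ X) (hθ : IsHitting Φ X θ)
    (hb : ContDiffOn ℝ 1 b (Ici 0)) : HasDerivWithinAt (inflow A F Φ θ b)
      ((A 0 0 * b 0 + F 0 0 - derivWithin b (Ici 0) 0) / V 0 0) (Iic 0) 0 := by
  have t0 := h.hit_zero hθ
  have hV := (h.speed_pos 0 0).ne'
  have hd := (hθ.contDiff.differentiable (by norm_num) 0).hasDerivAt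
  have p1 : pt Φ 0 0 = V 0 0 := by
    have := (hasDerivAt_pt h.contDiff_flow 0 0).unique (h.hasDerivAt_time 0 0)
    rwa [h.flow_zero] at this
  have p2 : px Φ 0 0 = 1 := by
    have := (hasDerivAt_px h.contDiff_flow 0 0).unique (h.hasDerivAt_space 0 0)
    simpa using this
  have g1 : pt (growth A Φ) 0 0 = A 0 0 := by
    have := (hasDerivAt_pt h.contDiff_growth 0 0).unique (h.hasDerivAt_growth 0 0)
    simpa [growth_zero, h.flow_zero] using this
  have g2 : px (growth A Φ) 0 0 = 0 := by
    refine (hasDerivAt_px h.contDiff_growth 0 0).unique ?_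
    simp only [show growth A Φ 0 = fun _ => 1 from funext (growth_zero A Φ)]
    exact hasDerivAt_const _ _
  have q1 : pt (accum A F Φ) 0 0 = F 0 0 := by
    have := (hasDerivAt_pt h.contDiff_accum 0 0).unique (h.hasDerivAt_accum 0 0)
    simpa [growth_zero, h.flow_zero] using this
  have q2 : px (accum A F Φ) 0 0 = 0 := by
    refine (hasDerivAt_px h.contDiff_accum 0 0).unique ?_
    simp only [show accum A F Φ 0 = fun _ => 0 from funext (accum_zero A F Φ)]
    exact hasDerivAt_const _ _
  have hΦ := hasDerivAt_comp_curve h.contDiff_flow hd (hasDerivAt_id (0 : ℝ))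
  have hG := hasDerivAt_comp_curve h.contDiff_growth hd (hasDerivAt_id (0 : ℝ))
  have hQ := hasDerivAt_comp_curve h.contDiff_accum hd (hasDerivAt_id (0 : ℝ))
  simp only [id, t0, p1, p2, g1, g2, q1, q2] at hΦ hG hQ
  -- Differentiating Φ(θ(ξ), ξ) = 0 at ξ = 0.
  have hθ' : deriv θ 0 * V 0 0 = -1 := by
    have : HasDerivAt (fun s => Φ (θ s) s) 0 0 := by
      simp only [hθ.flow_hit]; exact hasDerivAt_const _ _
    linarith [hΦ.unique this]
  have hB : HasDerivWithinAt b (derivWithin b (Ici 0) 0) (Ici 0) (θ 0) := by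
    rw [t0]
    exact (hb.differentiableOn (by norm_num) 0 self_mem_Ici).hasDerivWithinAt
  have hB' : HasDerivWithinAt (fun ξ => b (θ ξ)) _ (Iic 0) 0 :=
    hB.scomp 0 hd.hasDerivWithinAt fun ξ hξ => h.hit_nonneg hθ hξ
  refine ((hB'.div hG.hasDerivWithinAt (growth_pos A Φ _ _).ne').sub
    hQ.hasDerivWithinAt).congr_deriv ?_
  simp only [t0, growth_zero, smul_eq_mul]
  have : deriv θ 0 = -1 / V 0 0 := by field_simp; exact hθ'
  rw [this]
  field_simp
  ring

theorem eqOn_fullData_inflow : EqOn (fullData A F Φ θ φ b) (inflow A F Φ θ b) (Iic 0) :=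
  fun _ hξ => if_pos hξ

theorem eqOn_fullData : EqOn (fullData A F Φ θ φ b) φ (Ioi 0) :=
  fun _ hξ => if_neg (not_le.2 hξ)

theorem contDiffAt_fullData_neg (h : IsModel V A F Φ X) (hθ : IsHitting Φ X θ)
    (hb : ContDiffOn ℝ 1 b (Ici 0)) {x : ℝ} (hx : x < 0) :
    ContDiffAt ℝ 1 (fullData A F Φ θ φ b) x := by
  refine ((h.contDiffOn_inflow hθ hb).contDiffAt (Iic_mem_nhds hx)).congr_of_eventuallyEq ?_
  filter_upwards [Iic_mem_nhds hx] with y hy using eqOn_fullData_inflow hy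

theorem contDiffOn_fullData (h : IsModel V A F Φ X) (hθ : IsHitting Φ X θ)
    (hb : ContDiffOn ℝ 1 b (Ici 0)) {s : Set ℝ} (hs : (0 : ℝ) ∈ s)
    (hφ : ContDiffOn ℝ 1 φ (Icc 0 1 \ s)) :
    ContDiffOn ℝ 1 (fullData A F Φ θ φ b) (Iic 1 \ s) := by
  rintro x ⟨hx1, hxs⟩
  rcases lt_trichotomy x 0 with hx | hx | hx
  · exact (h.contDiffAt_fullData_neg hθ hb hx).contDiffWithinAt
  · exact absurd (hx ▸ hs) hxs
  · have h1 := hφ x ⟨⟨hx.le, hx1⟩, hxs⟩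
    have h2 : ContDiffWithinAt ℝ 1 φ (Iic 1 \ s) x := by
      refine h1.mono_of_mem_nhdsWithin ?_
      filter_upwards [self_mem_nhdsWithin, nhdsWithin_le_nhds (Ioi_mem_nhds hx)] with y hy hy0
      exact ⟨⟨le_of_lt hy0, hy.1⟩, hy.2⟩
    refine h2.congr_of_eventuallyEq ?_ (eqOn_fullData hx)
    filter_upwards [nhdsWithin_le_nhds (Ioi_mem_nhds hx)] with y hy using eqOn_fullData hy

/-- From the left the corner is seen by the inflow branch alone; in `fullData_right` it is seen from
the right by `φ` alone. Hence no compatibility is needed for one-sided regularity. -/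
theorem fullData_left (h : IsModel V A F Φ X) (hθ : IsHitting Φ X θ)
    (hb : ContDiffOn ℝ 1 b (Ici 0)) (hφ : PC1 φ) {x : ℝ} (hx : x ≤ 1) :
    ∃ l, HasDerivWithinAt (fullData A F Φ θ φ b) l (Iic x) x := by
  rcases le_or_gt x 0 with h0 | h0
  · have h1 := ((h.contDiffOn_inflow hθ hb).differentiableOn (by norm_num) x h0).hasDerivWithinAt
    refine ⟨_, (h1.mono (Iic_subset_Iic.2 h0)).congr (fun y hy => ?_) (eqOn_fullData_inflow h0)⟩
    exact eqOn_fullData_inflow (le_trans hy h0)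
  · obtain ⟨l, hl⟩ := hφ.hasDerivWithinAt_left ⟨h0, hx⟩
    refine ⟨l, hl.congr_of_eventuallyEq ?_ (eqOn_fullData h0)⟩
    filter_upwards [nhdsWithin_le_nhds (Ioi_mem_nhds h0)] with y hy using eqOn_fullData hy

theorem fullData_right (h : IsModel V A F Φ X) (hθ : IsHitting Φ X θ)
    (hb : ContDiffOn ℝ 1 b (Ici 0)) (hφ : PC1 φ) {x : ℝ} (hx : x < 1) :
    RightC1 (fullData A F Φ θ φ b) x := by
  rcases lt_or_ge x 0 with h0 | h0
  · have ho : ContDiffOn ℝ 1 (fullData A F Φ θ φ b) (Iio 0) := fun y hy =>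
      (h.contDiffAt_fullData_neg hθ hb hy).contDiffWithinAt
    have hc := ho.continuousOn_deriv_of_isOpen isOpen_Iio (by norm_num)
    refine ⟨_, _, deriv (fullData A F Φ θ φ b),
      ((h.contDiffAt_fullData_neg hθ hb h0).continuousAt.tendsto).mono_left nhdsWithin_le_nhds, ?_,
      (hc.continuousAt (Iio_mem_nhds h0)).tendsto.mono_left nhdsWithin_le_nhds⟩
    filter_upwards [nhdsWithin_le_nhds (Iio_mem_nhds h0)] with y hy
    exact ((h.contDiffAt_fullData_neg hθ hb hy).differentiableAt (by norm_num)).hasDerivAt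
  · refine (hφ.rightC1 ⟨h0, hx⟩).congr ?_
    filter_upwards [self_mem_nhdsWithin] with y hy
    exact (eqOn_fullData (h0.trans_lt hy)).symm

theorem mapsTo_foot (h : IsModel V A F Φ X) : MapsTo (Function.uncurry X) strip (Iic 1) :=
  fun z hz => (h.foot_le hz.1 z.2).trans hz.2.2

/-- The break set consists of the points whose foot is a break point of the data. -/
theorem mem_breakSet_iff (h : IsModel V A F Φ X) {N : ℕ} {ξ : Fin (N + 1) → ℝ}
    (hξ : ∀ i, ξ i ∈ Icc (0 : ℝ) 1) {t x : ℝ} (hz : (t, x) ∈ strip) :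
    (t, x) ∈ breakSet V ξ ↔ X t x ∈ range ξ := by
  have ht : 0 ≤ t := hz.1
  simp only [breakSet, mem_iUnion, mem_range]
  refine exists_congr fun i => ⟨?_, fun hi => ?_⟩
  · rintro ⟨-, r, hr0, hrt, hr⟩
    obtain ⟨K, hK⟩ := h.lip
    have : EqOn r (fun s => Φ s (ξ i)) (Icc 0 t) := by
      refine ODE_solution_unique hK
        (fun s hs => (hr s hs).2.continuousWithinAt) (fun s hs => ?_)
        (fun s _ => (h.hasDerivAt_time s _).continuousAt.continuousWithinAt)
        (fun s _ => (h.hasDerivAt_time s _).hasDerivWithinAt) (by simp [hr0, h.flow_zero])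
      exact (hr s (Ico_subset_Icc_self hs)).2.mono_of_mem_nhdsWithin
        (mem_of_superset (Icc_mem_nhdsGE hs.2) (Icc_subset_Icc_left hs.1))
    have h1 := this ⟨ht, le_rfl⟩
    simp only at hrt h1
    rw [← hrt, h1, h.foot_flow]
  -- Characteristics increase in time, so up to time `t` the curve stays between its start `ξ i ≥ 0`
  -- and its end `x ≤ 1`.
  · have hx : Φ t (ξ i) = x := by rw [hi, h.flow_foot]
    refine ⟨ht, fun s => Φ s (ξ i), h.flow_zero _, hx, fun s hs => ⟨⟨?_, ?_⟩,
      (h.hasDerivAt_time s _).hasDerivWithinAt⟩⟩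
    · have := (h.strictMono_time (ξ i)).monotone hs.1
      simp only [h.flow_zero] at this
      exact (hξ i).1.trans this
    · have := (h.strictMono_time (ξ i)).monotone hs.2
      simp only [hx] at this
      exact this.trans hz.2.2

theorem dt_of_hasFDerivWithinAt {w : ℝ → ℝ → ℝ} {t x : ℝ} {D : ℝ × ℝ →L[ℝ] ℝ}
    (hz : (t, x) ∈ strip) (hD : HasFDerivWithinAt (Function.uncurry w) D strip (t, x)) :
    dt w t x = D (1, 0) := by
  have h1 : HasDerivWithinAt (fun s : ℝ => (s, x)) ((1 : ℝ), (0 : ℝ)) (Ici 0) t :=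
    ((hasDerivAt_id t).prodMk (hasDerivAt_const t x)).hasDerivWithinAt
  have hm : MapsTo (fun s : ℝ => (s, x)) (Ici 0) strip := fun s hs => ⟨hs, hz.2⟩
  exact (hD.comp_hasDerivWithinAt t h1 hm).derivWithin
    (uniqueDiffOn_Ici 0 t hz.1)

theorem dx_of_hasFDerivWithinAt {w : ℝ → ℝ → ℝ} {t x : ℝ} {D : ℝ × ℝ →L[ℝ] ℝ}
    (hz : (t, x) ∈ strip) (hD : HasFDerivWithinAt (Function.uncurry w) D strip (t, x)) :
    dx w t x = D (0, 1) := by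
  have h1 : HasDerivWithinAt (fun y : ℝ => (t, y)) ((0 : ℝ), (1 : ℝ)) (Icc 0 1) x :=
    ((hasDerivAt_const x t).prodMk (hasDerivAt_id x)).hasDerivWithinAt
  have hm : MapsTo (fun y : ℝ => (t, y)) (Icc 0 1) strip := fun s hs => ⟨hz.1, hs⟩
  exact (hD.comp_hasDerivWithinAt x h1 hm).derivWithin
    (uniqueDiffOn_Icc one_pos x hz.2)

theorem dt_add_mul_dx {w : ℝ → ℝ → ℝ} {t x c : ℝ} {D : ℝ × ℝ →L[ℝ] ℝ}
    (hz : (t, x) ∈ strip) (hD : HasFDerivWithinAt (Function.uncurry w) D strip (t, x)) :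
    dt w t x + c * dx w t x = D (1, c) := by
  rw [dt_of_hasFDerivWithinAt hz hD, dx_of_hasFDerivWithinAt hz hD]
  have : ((1 : ℝ), c) = ((1 : ℝ), (0 : ℝ)) + c • ((0 : ℝ), (1 : ℝ)) := by simp
  rw [this, map_add, map_smul]; rfl

theorem mixedSol_boundary (h : IsModel V A F Φ X) (hθ : IsHitting Φ X θ) {t : ℝ} (ht : 0 ≤ t) :
    mixedSol A F Φ X θ φ b t 0 = b t := by
  have h1 : X t 0 ≤ 0 := h.foot_le ht 0
  have g0 := (growth_pos A Φ t (X t 0)).ne'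
  simp only [mixedSol, cauchySol, fullData, if_pos h1, inflow, hθ.hit_foot]
  field_simp
  ring

theorem mixedSol_initial (h : IsModel V A F Φ X) {x : ℝ} (hx : 0 < x) :
    mixedSol A F Φ X θ φ b 0 x = φ x := by
  simp [mixedSol, cauchySol, growth_zero, accum_zero, h.foot_zero, fullData, not_le.2 hx]

/-- Regularity of `cauchySol` from regularity of the data. -/
theorem contDiffOn_cauchySol (h : IsModel V A F Φ X) {ψ : ℝ → ℝ} {I : Set ℝ}
    (hψ : ContDiffOn ℝ 1 ψ I) {S : Set (ℝ × ℝ)} (hS : MapsTo (Function.uncurry X) S I) :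
    C1On (cauchySol A F Φ X ψ) S :=
  h.contDiff_growth_foot.contDiffOn.mul
    ((hψ.comp h.contDiff_foot.contDiffOn hS).add h.contDiff_accum_foot.contDiffOn)

theorem continuousOn_cauchySol (h : IsModel V A F Φ X) {ψ : ℝ → ℝ} {I : Set ℝ}
    (hψ : ContinuousOn ψ I) {S : Set (ℝ × ℝ)} (hS : MapsTo (Function.uncurry X) S I) :
    ContinuousOn (Function.uncurry (cauchySol A F Φ X ψ)) S :=
  h.contDiff_growth_foot.continuous.continuousOn.mul
    ((hψ.comp h.contDiff_foot.continuous.continuousOn hS).add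
      h.contDiff_accum_foot.continuous.continuousOn)

/-- The increasing C¹ map `X t` carries left and right regularity of the data over to the profile,
and pulls a finite set of break points back to a finite set. -/
theorem pc1_mixedSol (h : IsModel V A F Φ X) (hθ : IsHitting Φ X θ)
    (hb : ContDiffOn ℝ 1 b (Ici 0)) (hφ : PC1 φ) {s : Set ℝ} (hs : (0 : ℝ) ∈ s) (hsf : s.Finite)
    (hφs : ContDiffOn ℝ 1 φ (Icc 0 1 \ s)) {t : ℝ} (ht : 0 ≤ t) :
    PC1 (mixedSol A F Φ X θ φ b t) := by
  have cX : ContDiff ℝ 1 (X t) := h.contDiff_foot.comp (contDiff_const.prodMk contDiff_id)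
  have cg : ContDiff ℝ 1 fun x => growth A Φ t (X t x) :=
    h.contDiff_growth_foot.comp (contDiff_const.prodMk contDiff_id)
  have cq : ContDiff ℝ 1 fun x => accum A F Φ t (X t x) :=
    h.contDiff_accum_foot.comp (contDiff_const.prodMk contDiff_id)
  have hfin : ({x | x ∈ Ioo (0 : ℝ) 1 ∧ X t x ∈ s}).Finite :=
    (hsf.preimage (h.strictMono_foot t).injective.injOn).subset fun x hx => hx.2
  refine pc1_of (J := hfin.toFinset) (fun x hx => ?_) (fun x hx => ?_) ?_ ?_
  · obtain ⟨l, hl⟩ := h.fullData_left (φ := φ) hθ hb hφ ((h.foot_le ht x).trans hx.2)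
    have h1 : HasDerivWithinAt (fun y => fullData A F Φ θ φ b (X t y)) _ (Iic x) x :=
      hl.scomp x (cX.differentiable (by norm_num) x).hasDerivAt.hasDerivWithinAt
        fun y hy => (h.strictMono_foot t).monotone hy
    exact ⟨_, (cg.differentiable (by norm_num) x).hasDerivAt.hasDerivWithinAt.mul
      (h1.add (cq.differentiable (by norm_num) x).hasDerivAt.hasDerivWithinAt)⟩
  · have h1 := h.fullData_right (φ := φ) hθ hb hφ ((h.foot_le ht x).trans_lt hx.2)
    exact (rightC1_of_contDiff cg).mul ((h1.comp cX (h.strictMono_foot t)).add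
      (rightC1_of_contDiff cq))
  · intro x hx
    have : x ∈ Ioo (0 : ℝ) 1 ∧ X t x ∈ s := by simpa using hx
    exact this.1
  · refine cg.contDiffOn.mul (((h.contDiffOn_fullData hθ hb hs hφs).comp cX.contDiffOn
      fun x hx => ?_).add cq.contDiffOn)
    refine ⟨(h.foot_le ht x).trans hx.1.2.le, fun hmem => hx.2 ?_⟩
    have : x ∈ Ioo (0 : ℝ) 1 ∧ X t x ∈ s := ⟨hx.1, hmem⟩
    simpa using this

/-- Existence for coefficients given on the whole plane. -/
theorem isSolution_mixedSol (h : IsModel V A F Φ X) (hθ : IsHitting Φ X θ)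
    (hb : ContDiffOn ℝ 1 b (Ici 0)) (hφ : PC1 φ) {N : ℕ} {ξ : Fin (N + 1) → ℝ}
    (hξ : ∀ i, ξ i ∈ Icc (0 : ℝ) 1) (hξ0 : ξ 0 = 0)
    (hφξ : ContDiffOn ℝ 1 φ (Icc 0 1 \ range ξ)) :
    IsSolution V A F φ b ξ (mixedSol A F Φ X θ φ b) := by
  have h0 : (0 : ℝ) ∈ range ξ := ⟨0, hξ0⟩
  have hψ := h.contDiffOn_fullData hθ hb h0 hφξ
  have hmaps : MapsTo (Function.uncurry X) (strip \ breakSet V ξ) (Iic 1 \ range ξ) := by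
    rintro ⟨t, x⟩ ⟨hz, hzb⟩
    exact ⟨h.mapsTo_foot hz, fun hm => hzb ((h.mem_breakSet_iff hξ hz).2 hm)⟩
  refine ⟨h.contDiffOn_cauchySol hψ hmaps,
    fun t ht => h.pc1_mixedSol hθ hb hφ h0 (finite_range ξ) hφξ ht, ?_,
    fun x hx => h.mixedSol_initial hx.1, fun t ht => h.mixedSol_boundary hθ ht⟩
  intro t x hz
  have hm := hmaps hz
  -- The break points form a finite, hence closed, set. The derivative therefore exists within all
  -- of `Iic 1`, and on the strip side within the full strip, as `dt` and `dx` require.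
  have hd : HasDerivWithinAt (fullData A F Φ θ φ b) _ (Iic 1) (X t x) :=
    ((hψ.differentiableOn (by norm_num) (X t x) hm).hasDerivWithinAt).mono_of_mem_nhdsWithin
      (inter_mem_nhdsWithin _ ((finite_range ξ).isClosed.isOpen_compl.mem_nhds hm.2))
  obtain ⟨D, hD, hDe⟩ := h.hasFDerivWithinAt_cauchySol h.mapsTo_foot hd
  exact (dt_add_mul_dx hz.1 hD).trans hDe

theorem continuousOn_mixedSol (h : IsModel V A F Φ X) (hθ : IsHitting Φ X θ)
    (hb : ContDiffOn ℝ 1 b (Ici 0)) (hφ : ContinuousOn φ (Icc 0 1)) (h0 : b 0 = φ 0) :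
    ContinuousOn (Function.uncurry (mixedSol A F Φ X θ φ b)) strip := by
  refine h.continuousOn_cauchySol (I := Iic 1) ?_ h.mapsTo_foot
  have e : EqOn (fullData A F Φ θ φ b) φ (Icc 0 1) := by
    intro x hx
    rcases hx.1.eq_or_lt with rfl | hx0
    · rw [eqOn_fullData_inflow self_mem_Iic, h.inflow_zero hθ, h0]
    · exact eqOn_fullData hx0
  rw [← Iic_union_Icc_eq_Iic zero_le_one]
  exact ((h.contDiffOn_inflow hθ hb).continuousOn.congr eqOn_fullData_inflow).union_of_isClosed
    (hφ.congr e) isClosed_Iic isClosed_Icc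

/-- The zeroth-order condition joins the two branches at 0; the first-order one, divided by the
positive speed at the corner, equates their slopes there. -/
theorem c1On_mixedSol (h : IsModel V A F Φ X) (hθ : IsHitting Φ X θ)
    (hb : ContDiffOn ℝ 1 b (Ici 0)) (hφ : ContDiffOn ℝ 1 φ (Icc 0 1)) (h0 : b 0 = φ 0)
    (h1 : derivWithin b (Ici 0) 0 + V 0 0 * derivWithin φ (Icc 0 1) 0 = A 0 0 * b 0 + F 0 0) :
    C1On (mixedSol A F Φ X θ φ b) strip := by
  refine h.contDiffOn_cauchySol (I := Iic 1) ?_ h.mapsTo_foot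
  have e : EqOn (fullData A F Φ θ φ b) φ (Icc 0 1) := by
    intro x hx
    rcases hx.1.eq_or_lt with rfl | hx0
    · rw [eqOn_fullData_inflow self_mem_Iic, h.inflow_zero hθ, h0]
    · exact eqOn_fullData hx0
  have k₁ := hasC1Deriv_fderivWithin (uniqueDiffOn_Iic 0)
    ((h.contDiffOn_inflow hθ hb).congr (eqOn_fullData_inflow (φ := φ)))
  have k₂ := hasC1Deriv_fderivWithin (uniqueDiffOn_Icc one_pos) (hφ.congr e)
  rw [← Iic_union_Icc_eq_Iic zero_le_one]
  refine (k₁.union isClosed_Iic isClosed_Icc k₂ ?_).contDiffOn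
  intro x hx
  obtain rfl : x = 0 := le_antisymm hx.1 hx.2.1
  have d₁ := (h.derivWithin_inflow hθ hb).congr (eqOn_fullData_inflow (φ := φ))
    (eqOn_fullData_inflow (φ := φ) self_mem_Iic)
  have d₂ := ((hφ.differentiableOn (by norm_num) 0 (left_mem_Icc.2 zero_le_one)).hasDerivWithinAt
    ).congr e (e (left_mem_Icc.2 zero_le_one))
  ext
  rw [fderivWithin_derivWithin, fderivWithin_derivWithin,
    d₁.derivWithin (uniqueDiffOn_Iic 0 0 self_mem_Iic),
    d₂.derivWithin (uniqueDiffOn_Icc one_pos 0 (left_mem_Icc.2 zero_le_one)),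
    div_eq_iff (h.speed_pos 0 0).ne']
  linarith

end IsModel

/-! ### Localisation in time, uniqueness and existence. -/

/-- Solutions of the initial-boundary value problem on the time interval `[0, T)`. -/
structure IsSolutionUpTo {N : ℕ} (T : ℝ) (v a f : ℝ → ℝ → ℝ) (φ b : ℝ → ℝ)
    (ξ : Fin (N + 1) → ℝ) (w : ℝ → ℝ → ℝ) : Prop where
  c1 : C1On w ((strip \ breakSet v ξ) ∩ {z | z.1 < T})
  pc1 : ∀ t, 0 ≤ t → t < T → PC1 (w t)
  pde : ∀ t x, (t, x) ∈ strip \ breakSet v ξ → t < T →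
    dt w t x + v t x * dx w t x = a t x * w t x + f t x
  init : ∀ x ∈ Ioc (0 : ℝ) 1, w 0 x = φ x
  bdry : ∀ t, 0 ≤ t → t < T → w t 0 = b t

/-- The hypotheses on the coefficients and the data. -/
structure Admissible {N : ℕ} (v a f : ℝ → ℝ → ℝ) (φ b : ℝ → ℝ) (ξ : Fin (N + 1) → ℝ) : Prop where
  speed : C1On v strip
  speed_pos : ∀ t x : ℝ, 0 ≤ t → x ∈ Icc (0 : ℝ) 1 → 0 < v t x
  coeff : C1On a strip
  source : C1On f strip
  bdry : ContDiffOn ℝ 1 b (Ici 0)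
  init : PC1 φ
  mem : ∀ i, ξ i ∈ Icc (0 : ℝ) 1
  zero : ξ 0 = 0
  init_c1 : ContDiffOn ℝ 1 φ (Icc 0 1 \ range ξ)

/-- The functions `u` and `U` agree on `[0, T] × [0, 1]`. -/
def AgreeUpTo (T : ℝ) (u U : ℝ → ℝ → ℝ) : Prop := ∀ t ∈ Icc 0 T, ∀ x ∈ Icc (0 : ℝ) 1, U t x = u t x

section Local

variable {N : ℕ} {T T' : ℝ} {v a f V A F w w₁ w₂ : ℝ → ℝ → ℝ} {φ b : ℝ → ℝ} {ξ : Fin (N + 1) → ℝ}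

theorem IsSolution.upTo (h : IsSolution v a f φ b ξ w) (T : ℝ) :
    IsSolutionUpTo T v a f φ b ξ w :=
  ⟨h.c1.mono inter_subset_left, fun t ht _ => h.pc1 t ht, fun t x hz _ => h.pde t x hz, h.init,
    fun t ht _ => h.bdry t ht⟩

theorem IsSolutionUpTo.mono (h : IsSolutionUpTo T v a f φ b ξ w) (hT : T' ≤ T) :
    IsSolutionUpTo T' v a f φ b ξ w :=
  ⟨h.c1.mono fun _ hz => ⟨hz.1, lt_of_lt_of_le hz.2 hT⟩, fun t ht hlt => h.pc1 t ht (hlt.trans_le hT),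
    fun t x hz hlt => h.pde t x hz (hlt.trans_le hT), h.init,
    fun t ht hlt => h.bdry t ht (hlt.trans_le hT)⟩

theorem AgreeUpTo.symm (h : AgreeUpTo T v V) : AgreeUpTo T V v :=
  fun t ht x hx => (h t ht x hx).symm

/-- The definition of the curve confines it to [0, 1], so only values of the speed on the common
rectangle are ever used. -/
theorem AgreeUpTo.charCurve_subset (h : AgreeUpTo T v V) {η : ℝ} {z : ℝ × ℝ} (hz : z.1 < T)
    (hc : z ∈ charCurve v η) : z ∈ charCurve V η := by
  obtain ⟨h0, r, hr0, hrz, hr⟩ := hc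
  refine ⟨h0, r, hr0, hrz, fun s hs => ⟨(hr s hs).1, ?_⟩⟩
  rw [h s ⟨hs.1, hs.2.trans hz.le⟩ _ (hr s hs).1]
  exact (hr s hs).2

theorem AgreeUpTo.mem_breakSet_iff (h : AgreeUpTo T v V) {z : ℝ × ℝ} (hz : z.1 < T) :
    z ∈ breakSet V ξ ↔ z ∈ breakSet v ξ := by
  simp only [breakSet, mem_iUnion]
  exact exists_congr fun i => ⟨h.symm.charCurve_subset hz, h.charCurve_subset hz⟩

theorem IsSolutionUpTo.congr_coeff (h : IsSolutionUpTo T v a f φ b ξ w) (hv : AgreeUpTo T v V)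
    (ha : AgreeUpTo T a A) (hf : AgreeUpTo T f F) : IsSolutionUpTo T V A F φ b ξ w := by
  refine ⟨h.c1.mono fun z hz => ⟨⟨hz.1.1, fun hm => hz.1.2 ((hv.mem_breakSet_iff hz.2).2 hm)⟩, hz.2⟩,
    h.pc1, fun t x hz ht => ?_, h.init, h.bdry⟩
  have hm : t ∈ Icc 0 T := ⟨hz.1.1, ht.le⟩
  rw [hv t hm x hz.1.2, ha t hm x hz.1.2, hf t hm x hz.1.2]
  exact h.pde t x ⟨hz.1, fun hm => hz.2 ((hv.mem_breakSet_iff ht).2 hm)⟩ ht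

end Local

namespace IsModel

variable {N : ℕ} {T : ℝ} {V A F Φ X w w₁ w₂ : ℝ → ℝ → ℝ} {θ φ b : ℝ → ℝ} {ξ : Fin (N + 1) → ℝ}

/-- The break set is closed in the strip, being there the preimage of a finite set under `X`.
Differentiability off it is thus differentiability within the strip. -/
theorem inter_compl_breakSet_mem_nhdsWithin (h : IsModel V A F Φ X)
    (hξ : ∀ i, ξ i ∈ Icc (0 : ℝ) 1) {z : ℝ × ℝ} (hz : z ∈ (strip \ breakSet V ξ) ∩ {z | z.1 < T}) :
    (strip \ breakSet V ξ) ∩ {z | z.1 < T} ∈ 𝓝[strip] z := by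
  have h1 : IsOpen {z : ℝ × ℝ | Function.uncurry X z ∉ range ξ} :=
    (finite_range ξ).isClosed.isOpen_compl.preimage h.continuous_foot
  have h2 : IsOpen {z : ℝ × ℝ | z.1 < T} := isOpen_lt continuous_fst continuous_const
  have hz1 : Function.uncurry X z ∉ range ξ := fun hm =>
    hz.1.2 ((h.mem_breakSet_iff hξ hz.1.1).2 hm)
  filter_upwards [self_mem_nhdsWithin, nhdsWithin_le_nhds (h1.mem_nhds hz1),
    nhdsWithin_le_nhds (h2.mem_nhds hz.2)] with y hy hy1 hy2
  exact ⟨⟨hy, fun hm => hy1 ((h.mem_breakSet_iff hξ hy).1 hm)⟩, hy2⟩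

/-- The transport equation in terms of the total derivative. -/
theorem hasFDerivWithinAt_of_isSolutionUpTo (h : IsModel V A F Φ X)
    (hξ : ∀ i, ξ i ∈ Icc (0 : ℝ) 1) (hw : IsSolutionUpTo T V A F φ b ξ w) {t x : ℝ}
    (hz : (t, x) ∈ strip \ breakSet V ξ) (ht : t < T) :
    ∃ D : ℝ × ℝ →L[ℝ] ℝ, HasFDerivWithinAt (Function.uncurry w) D strip (t, x) ∧
      D (1, V t x) = A t x * w t x + F t x := by
  have hd := ((hw.c1.differentiableOn (by norm_num) (t, x) ⟨hz, ht⟩).hasFDerivWithinAt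
    ).mono_of_mem_nhdsWithin (h.inter_compl_breakSet_mem_nhdsWithin hξ ⟨hz, ht⟩)
  exact ⟨_, hd, (dt_add_mul_dx hz.1 hd).symm.trans (hw.pde t x hz ht)⟩

/-- The entrance time into the strip of the characteristic through `(0, η)`. -/
theorem exists_entrance (h : IsModel V A F Φ X) (hθ : IsHitting Φ X θ) {t x : ℝ}
    (hz : (t, x) ∈ strip) : ∃ s₀ ∈ Icc 0 t, (0 < X t x ∧ s₀ = 0 ∨ X t x ≤ 0 ∧ s₀ = θ (X t x)) ∧
      ∀ s ∈ Icc s₀ t, (s, Φ s (X t x)) ∈ strip := by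
  have up : ∀ s ≤ t, Φ s (X t x) ≤ 1 := fun s hs => by
    have := (h.strictMono_time (X t x)).monotone hs
    simp only [h.flow_foot] at this
    exact this.trans hz.2.2
  rcases lt_or_ge 0 (X t x) with h0 | h0
  · refine ⟨0, ⟨le_rfl, hz.1⟩, Or.inl ⟨h0, rfl⟩, fun s hs => ⟨hs.1, ?_, up s hs.2⟩⟩
    have := (h.strictMono_time (X t x)).monotone hs.1
    simp only [h.flow_zero] at this
    exact h0.le.trans this
  · have h1 : θ (X t x) ≤ t := by
      rw [← (h.strictMono_time (X t x)).le_iff_le]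
      simp only [hθ.flow_hit, h.flow_foot]
      exact hz.2.1
    refine ⟨θ (X t x), ⟨h.hit_nonneg hθ h0, h1⟩, Or.inr ⟨h0, rfl⟩, fun s hs =>
      ⟨(h.hit_nonneg hθ h0).trans hs.1, ?_, up s hs.2⟩⟩
    have := (h.strictMono_time (X t x)).monotone hs.1
    simpa only [hθ.flow_hit] using this

/-- The foot being constant, a characteristic through a point off the break set never meets it
inside the strip. Along it both solutions obey one linear equation, so their difference over the
growth factor is constant, and it vanishes at the entrance. -/
theorem eq_of_isSolutionUpTo_of_notMem (h : IsModel V A F Φ X) (hθ : IsHitting Φ X θ)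
    (hξ : ∀ i, ξ i ∈ Icc (0 : ℝ) 1) (hw₁ : IsSolutionUpTo T V A F φ b ξ w₁)
    (hw₂ : IsSolutionUpTo T V A F φ b ξ w₂) {t x : ℝ} (hz : (t, x) ∈ strip \ breakSet V ξ)
    (ht : t < T) : w₁ t x = w₂ t x := by
  obtain ⟨s₀, hs₀, hcase, hin⟩ := h.exists_entrance hθ hz.1
  set η := X t x with hη
  have hηr : η ∉ range ξ := fun hm => hz.2 ((h.mem_breakSet_iff hξ hz.1).2 hm)
  have along : ∀ {w : ℝ → ℝ → ℝ}, IsSolutionUpTo T V A F φ b ξ w → ∀ s ∈ Icc s₀ t,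
      HasDerivWithinAt (fun s => w s (Φ s η)) (A s (Φ s η) * w s (Φ s η) + F s (Φ s η))
        (Icc s₀ t) s := by
    intro w hw s hs
    have hm : (s, Φ s η) ∈ strip \ breakSet V ξ := ⟨hin s hs, fun hm => by
      rw [h.mem_breakSet_iff hξ (hin s hs), h.foot_flow] at hm
      exact hηr hm⟩
    obtain ⟨D, hD, hDe⟩ := h.hasFDerivWithinAt_of_isSolutionUpTo hξ hw hm (hs.2.trans_lt ht)
    rw [← hDe]
    have h1 : HasDerivWithinAt (fun s => (s, Φ s η)) (1, V s (Φ s η)) (Icc s₀ t) s :=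
      ((hasDerivAt_id s).prodMk (h.hasDerivAt_time s η)).hasDerivWithinAt
    exact hD.comp_hasDerivWithinAt s h1 hin
  have hd : ∀ s ∈ Icc s₀ t, HasDerivWithinAt
      (fun s => (w₁ s (Φ s η) - w₂ s (Φ s η)) / growth A Φ s η) 0 (Icc s₀ t) s := by
    intro s hs
    have g0 := (growth_pos A Φ s η).ne'
    refine (((along hw₁ s hs).sub (along hw₂ s hs)).div
      (h.hasDerivAt_growth s η).hasDerivWithinAt g0).congr_deriv ?_
    simp only [Pi.sub_apply]
    field_simp
    ring
  have hconst := constant_of_derivWithin_zero (fun s hs => (hd s hs).differentiableWithinAt)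
    (fun s hs => (hd s (Ico_subset_Icc_self hs)).derivWithin
      (uniqueDiffOn_Icc (hs.1.trans_lt hs.2) s (Ico_subset_Icc_self hs))) t ⟨hs₀.2, le_rfl⟩
  have hstart : w₁ s₀ (Φ s₀ η) = w₂ s₀ (Φ s₀ η) := by
    rcases hcase with ⟨h0, rfl⟩ | ⟨h0, rfl⟩
    · have h1 : η ∈ Ioc (0 : ℝ) 1 := ⟨h0, h.mapsTo_foot hz.1⟩
      rw [h.flow_zero, hw₁.init η h1, hw₂.init η h1]
    · have h1 : θ η < T := hs₀.2.trans_lt ht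
      rw [hθ.flow_hit, hw₁.bdry _ hs₀.1 h1, hw₂.bdry _ hs₀.1 h1]
  simp only [hstart, sub_self, zero_div] at hconst
  rw [div_eq_zero_iff, or_iff_left (growth_pos A Φ t η).ne', hη, h.flow_foot] at hconst
  exact sub_eq_zero.1 hconst

/-- Uniqueness for coefficients given on the whole plane. -/
theorem eq_of_isSolutionUpTo (h : IsModel V A F Φ X) (hθ : IsHitting Φ X θ)
    (hξ : ∀ i, ξ i ∈ Icc (0 : ℝ) 1) (hw₁ : IsSolutionUpTo T V A F φ b ξ w₁)
    (hw₂ : IsSolutionUpTo T V A F φ b ξ w₂) {t x : ℝ} (hz : (t, x) ∈ strip) (ht : t < T) :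
    w₁ t x = w₂ t x := by
  rcases hz.2.1.eq_or_lt with hx | hx
  · simp only at hx
    rw [← hx, hw₁.bdry t hz.1 ht, hw₂.bdry t hz.1 ht]
  -- Each time line carries finitely many break points, so immediately to the left of `x` the
  -- solutions agree; left-continuity then gives equality at `x` itself.
  have hfin : ((X t) ⁻¹' range ξ \ {x}).Finite :=
    ((finite_range ξ).preimage (h.strictMono_foot t).injective.injOn).subset sdiff_subset
  have hev : w₁ t =ᶠ[𝓝[<] x] w₂ t := by
    filter_upwards [Ioo_mem_nhdsLT hx, nhdsWithin_le_nhds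
      (hfin.isClosed.isOpen_compl.mem_nhds (by simp : x ∈ ((X t) ⁻¹' range ξ \ {x})ᶜ))] with y hy hyX
    have hyz : (t, y) ∈ strip := ⟨hz.1, hy.1.le, hy.2.le.trans hz.2.2⟩
    refine h.eq_of_isSolutionUpTo_of_notMem hθ hξ hw₁ hw₂ ⟨hyz, fun hm => hyX ⟨?_, hy.2.ne⟩⟩ ht
    exact (h.mem_breakSet_iff hξ hyz).1 hm
  exact tendsto_nhds_unique ((hw₁.pc1 t hz.1 ht).leftCont x ⟨hx, hz.2.2⟩)
    (((hw₂.pc1 t hz.1 ht).leftCont x ⟨hx, hz.2.2⟩).congr' (hev.mono fun _ => Eq.symm))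

end IsModel

namespace Admissible

variable {N : ℕ} {v a f : ℝ → ℝ → ℝ} {φ b : ℝ → ℝ} {ξ : Fin (N + 1) → ℝ}

/-- The coefficients can be replaced by coefficients on the whole plane up to a given time. -/
theorem exists_isModel (h : Admissible v a f φ b ξ) {T : ℝ} (hT : 0 < T) :
    ∃ V A F Φ X θ, IsModel V A F Φ X ∧ IsHitting Φ X θ ∧
      AgreeUpTo T v V ∧ AgreeUpTo T a A ∧ AgreeUpTo T f F := by
  obtain ⟨V, hV, hl, ⟨M, hM⟩, ⟨K, hK⟩, hVv⟩ := exists_extension_pos h.speed h.speed_pos hT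
  obtain ⟨A, hA, -, hAa⟩ := exists_extension h.coeff hT
  obtain ⟨F, hF, -, hFf⟩ := exists_extension h.source hT
  obtain ⟨Φ, X, hflow⟩ := exists_isFlow hV hM hK
  have hm : IsModel V A F Φ X :=
    { toIsFlow := hflow, contDiff_speed := hV, contDiff_coeff := hA, contDiff_source := hF,
      lower := hl, lip := ⟨K, fun t =>
        lipschitzWith_of_nnnorm_deriv_le (fun x => (hasDerivAt_px hV t x).differentiableAt)
          fun x => by rw [(hasDerivAt_px hV t x).deriv]; exact hK t x⟩ }
  obtain ⟨θ, hθ⟩ := hm.exists_isHitting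
  exact ⟨V, A, F, Φ, X, θ, hm, hθ, hVv, hAa, hFf⟩

theorem exists_isSolutionUpTo (h : Admissible v a f φ b ξ) {T : ℝ} (hT : 0 < T) :
    ∃ w, IsSolutionUpTo T v a f φ b ξ w := by
  obtain ⟨V, A, F, Φ, X, θ, hm, hθ, hV, hA, hF⟩ := h.exists_isModel hT
  exact ⟨_, ((hm.isSolution_mixedSol hθ h.bdry h.init h.mem h.zero h.init_c1).upTo T).congr_coeff
    hV.symm hA.symm hF.symm⟩

theorem unique (h : Admissible v a f φ b ξ) {T : ℝ} {w₁ w₂ : ℝ → ℝ → ℝ}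
    (hw₁ : IsSolutionUpTo T v a f φ b ξ w₁) (hw₂ : IsSolutionUpTo T v a f φ b ξ w₂) {t x : ℝ}
    (hz : (t, x) ∈ strip) (ht : t < T) : w₁ t x = w₂ t x := by
  obtain ⟨V, A, F, Φ, X, θ, hm, hθ, hV, hA, hF⟩ := h.exists_isModel (lt_of_le_of_lt hz.1 ht)
  exact hm.eq_of_isSolutionUpTo hθ h.mem (hw₁.congr_coeff hV hA hF) (hw₂.congr_coeff hV hA hF) hz ht

/-- Existence of a solution. -/
theorem exists_isSolution (h : Admissible v a f φ b ξ) : ∃ w, IsSolution v a f φ b ξ w := by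
  have hex : ∀ n : ℕ, ∃ w, IsSolutionUpTo (n + 1 : ℝ) v a f φ b ξ w := fun n =>
    h.exists_isSolutionUpTo (by positivity)
  choose W hW using hex
  -- The piece with index ⌊t⌋₊ lives up to ⌊t⌋₊ + 1 > t. By uniqueness, near any time the patched
  -- function coincides with a single piece, also across integers.
  let w : ℝ → ℝ → ℝ := fun t x => W ⌊t⌋₊ t x
  have hw : ∀ n : ℕ, ∀ t x, (t, x) ∈ strip → t < n + 1 → w t x = W n t x := by
    intro n t x hz ht
    have h1 : ⌊t⌋₊ ≤ n := by
      have := Nat.floor_le (show 0 ≤ t from hz.1)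
      exact Nat.lt_add_one_iff.1 (by exact_mod_cast this.trans_lt ht)
    exact h.unique (hW _) ((hW n).mono (by gcongr)) hz (Nat.lt_floor_add_one t)
  have hev : ∀ n : ℕ, ∀ z ∈ strip, z.1 < n + 1 →
      Function.uncurry w =ᶠ[𝓝[strip] z] Function.uncurry (W n) := by
    intro n z hz ht
    filter_upwards [self_mem_nhdsWithin, nhdsWithin_le_nhds
      ((isOpen_lt continuous_fst continuous_const).mem_nhds ht)] with y hy hy1
    exact hw n y.1 y.2 hy hy1
  refine ⟨w, fun z hz => ?_, fun t ht => ?_, fun t x hz => ?_, fun x hx => ?_, fun t ht => ?_⟩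
  · have ht : z.1 < (⌊z.1⌋₊ : ℝ) + 1 := Nat.lt_floor_add_one _
    have h1 := (hW ⌊z.1⌋₊).c1 z ⟨hz, ht⟩
    have h2 : ContDiffWithinAt ℝ 1 (Function.uncurry (W ⌊z.1⌋₊)) (strip \ breakSet v ξ) z :=
      h1.mono_of_mem_nhdsWithin (inter_mem_nhdsWithin _
        ((isOpen_lt continuous_fst continuous_const).mem_nhds ht))
    exact h2.congr_of_eventuallyEq ((hev _ z hz.1 ht).filter_mono
      (nhdsWithin_mono z sdiff_subset)) (hw _ z.1 z.2 hz.1 ht)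
  · exact (hW ⌊t⌋₊).pc1 t ht (Nat.lt_floor_add_one t)
  · have ht : t < (⌊t⌋₊ : ℝ) + 1 := Nat.lt_floor_add_one _
    have h1 := (hW ⌊t⌋₊).pde t x hz ht
    have e1 : dt w t x = dt (W ⌊t⌋₊) t x := by
      refine Filter.EventuallyEq.derivWithin_eq ?_ rfl
      filter_upwards [self_mem_nhdsWithin, nhdsWithin_le_nhds (Iio_mem_nhds ht)] with s hs hs1
      exact hw _ s x ⟨hs, hz.1.2⟩ hs1
    rw [e1]
    exact h1
  · exact (hW ⌊(0 : ℝ)⌋₊).init x hx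
  · exact (hW ⌊t⌋₊).bdry t ht (Nat.lt_floor_add_one t)

end Admissible

/-! ### Pointwise bounds and change of variables along characteristics. -/

namespace IsModel

variable {V A F Φ X : ℝ → ℝ → ℝ} {θ φ b : ℝ → ℝ} {t m α D : ℝ}

/-- Variation of constants along a characteristic. -/
theorem cauchySol_flow (h : IsModel V A F Φ X) (ψ : ℝ → ℝ) (s t η : ℝ) :
    cauchySol A F Φ X ψ t (Φ t η) =
      growth A Φ t η / growth A Φ s η * cauchySol A F Φ X ψ s (Φ s η) +
        ∫ r in s..t, growth A Φ t η / growth A Φ r η * F r (Φ r η) := by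
  have hc : Continuous fun r => F r (Φ r η) / growth A Φ r η :=
    h.contDiff_integrand.continuous.comp (by fun_prop : Continuous fun r : ℝ => (r, η))
  have h1 : accum A F Φ t η = accum A F Φ s η + ∫ r in s..t, F r (Φ r η) / growth A Φ r η :=
    (intervalIntegral.integral_add_adjacent_intervals (hc.intervalIntegrable _ _)
      (hc.intervalIntegrable _ _)).symm
  have h2 : ∫ r in s..t, growth A Φ t η / growth A Φ r η * F r (Φ r η) =
      growth A Φ t η * ∫ r in s..t, F r (Φ r η) / growth A Φ r η := by
    rw [← intervalIntegral.integral_const_mul]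
    exact intervalIntegral.integral_congr fun r _ => by ring
  have g0 := (growth_pos A Φ s η).ne'
  simp only [cauchySol, h.foot_flow, h2, h1]
  field_simp
  ring

theorem integral_le_mul {k : ℝ → ℝ} (hk : Continuous k) {s t c : ℝ} (hst : s ≤ t)
    (hc : ∀ r ∈ Icc s t, k r ≤ c) : ∫ r in s..t, k r ≤ c * (t - s) := by
  have := intervalIntegral.integral_mono_on (μ := volume) hst (hk.intervalIntegrable s t)
    (intervalIntegrable_const (c := c)) hc
  rw [intervalIntegral.integral_const, smul_eq_mul, mul_comm] at this
  exact this

theorem growth_div_le (h : IsModel V A F Φ X) {s t η : ℝ} (hst : s ≤ t)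
    (hA : ∀ r ∈ Icc s t, A r (Φ r η) ≤ α) :
    growth A Φ t η / growth A Φ s η ≤ Real.exp (α * (t - s)) := by
  have hc : Continuous fun r => A r (Φ r η) :=
    h.contDiff_coeff_flow.continuous.comp (by fun_prop : Continuous fun r : ℝ => (r, η))
  rw [growth, growth, ← Real.exp_sub, intervalIntegral.integral_interval_sub_left
    (hc.intervalIntegrable _ _) (hc.intervalIntegrable _ _)]
  exact Real.exp_le_exp.2 (integral_le_mul hc hst hA)

theorem mul_sub_le_flow_sub (h : IsModel V A F Φ X) {s t η : ℝ} (hst : s ≤ t)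
    (hV : ∀ r ∈ Icc s t, m ≤ V r (Φ r η)) : m * (t - s) ≤ Φ t η - Φ s η := by
  refine (convex_Icc s t).mul_sub_le_image_sub_of_le_deriv (f := fun t => Φ t η)
    (fun r _ => (h.hasDerivAt_time r η).continuousAt.continuousWithinAt)
    (fun r _ => (h.hasDerivAt_time r η).differentiableAt.differentiableWithinAt)
    (fun r hr => ?_) s ⟨le_rfl, hst⟩ t ⟨hst, le_rfl⟩ hst
  rw [(h.hasDerivAt_time r η).deriv]
  exact hV r (interior_subset hr)

theorem abs_cauchySol_flow_le (h : IsModel V A F Φ X) (ψ : ℝ → ℝ) {s t η : ℝ} (hst : s ≤ t)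
    (hA : ∀ r ∈ Icc s t, A r (Φ r η) ≤ α) :
    |cauchySol A F Φ X ψ t (Φ t η)| ≤
      Real.exp (α * (t - s)) * |cauchySol A F Φ X ψ s (Φ s η)| +
        ∫ r in s..t, Real.exp (α * (t - r)) * |F r (Φ r η)| := by
  have hF : Continuous fun r => F r (Φ r η) :=
    (h.contDiff_source.comp (contDiff_fst.prodMk h.contDiff_flow)).continuous.comp
      (by fun_prop : Continuous fun r : ℝ => (r, η))
  have hG : Continuous fun r => growth A Φ r η :=
    h.contDiff_growth.continuous.comp (by fun_prop : Continuous fun r : ℝ => (r, η))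
  rw [h.cauchySol_flow ψ s t η]
  refine (abs_add_le _ _).trans (add_le_add ?_ ?_)
  · rw [abs_mul, abs_of_pos (div_pos (growth_pos A Φ t η) (growth_pos A Φ s η))]
    exact mul_le_mul_of_nonneg_right (h.growth_div_le hst hA) (abs_nonneg _)
  · refine (intervalIntegral.abs_integral_le_integral_abs hst).trans ?_
    refine intervalIntegral.integral_mono_on hst (Continuous.intervalIntegrable ?_ _ _)
      (Continuous.intervalIntegrable
        ((by fun_prop : Continuous fun r => Real.exp (α * (t - r))).mul hF.abs) _ _) fun r hr => ?_
    · exact ((continuous_const.div hG fun r => (growth_pos A Φ r η).ne').mul hF).abs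
    · rw [abs_mul, abs_of_pos (div_pos (growth_pos A Φ t η) (growth_pos A Φ r η))]
      exact mul_le_mul_of_nonneg_right (h.growth_div_le hr.2 fun q hq =>
        hA q ⟨hr.1.trans hq.1, hq.2⟩) (abs_nonneg _)

/-- Pointwise bound for the solution of the initial-boundary value problem by the data at the point
where the characteristic enters the strip, and by the source. -/
theorem abs_mixedSol_le (h : IsModel V A F Φ X) (hθ : IsHitting Φ X θ)
    (hV : ∀ s ∈ Icc 0 t, ∀ y ∈ Icc (0 : ℝ) 1, m ≤ V s y)
    (hA : ∀ s ∈ Icc 0 t, ∀ y ∈ Icc (0 : ℝ) 1, A s y ≤ α) {x : ℝ} (hz : (t, x) ∈ strip) :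
    ∃ s₀ ∈ Icc 0 t, ∃ c, m * (t - s₀) ≤ x ∧ (∀ s ∈ Icc s₀ t, Φ s (X t x) ∈ Icc (0 : ℝ) 1) ∧
      (0 < X t x ∧ s₀ = 0 ∧ c = |φ (X t x)| ∧ m * t < 1 ∨ X t x ≤ 0 ∧ c = |b s₀|) ∧
      |mixedSol A F Φ X θ φ b t x| ≤ Real.exp (α * (t - s₀)) * c +
        ∫ r in s₀..t, Real.exp (α * (t - r)) * |F r (Φ r (X t x))| := by
  obtain ⟨s₀, hs₀, hcase, hin⟩ := h.exists_entrance hθ hz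
  have hb0 : ∀ s ∈ Icc s₀ t, s ∈ Icc 0 t := fun s hs => ⟨hs₀.1.trans hs.1, hs.2⟩
  have h1 := h.abs_cauchySol_flow_le (fullData A F Φ θ φ b) (η := X t x) hs₀.2
    fun r hr => hA r (hb0 r hr) _ (hin r hr).2
  have h2 := h.mul_sub_le_flow_sub (m := m) (η := X t x) hs₀.2
    fun r hr => hV r (hb0 r hr) _ (hin r hr).2
  rw [h.flow_foot] at h1 h2
  have h3 := (hin s₀ ⟨le_rfl, hs₀.2⟩).2.1
  simp only at h3
  refine ⟨s₀, hs₀, _, by linarith, fun s hs => (hin s hs).2, ?_, h1⟩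
  rcases hcase with ⟨h0, rfl⟩ | ⟨h0, rfl⟩
  · refine Or.inl ⟨h0, rfl, ?_, ?_⟩
    · rw [h.flow_zero]
      exact congrArg _ (h.mixedSol_initial (A := A) (F := F) (θ := θ) (b := b) h0)
    -- The foot is strictly positive and x ≤ 1, so m t ≤ x - X < 1: initial data are felt only while
    -- the cut-off is 1.
    · rw [h.flow_zero] at h2
      have : x ≤ 1 := hz.2.2
      linarith
  · refine Or.inr ⟨h0, ?_⟩
    rw [hθ.flow_hit]
    exact congrArg _ (h.mixedSol_boundary hθ hs₀.1)

/-- The Jacobian of the map from time s to time t is the quotient of the two Jacobians counted from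
time 0, so the integrals subtract. -/
theorem hasDerivAt_flow_foot (h : IsModel V A F Φ X) (s t y : ℝ) :
    HasDerivAt (fun y => Φ t (X s y)) (Real.exp (∫ r in s..t, px V r (Φ r (X s y)))) y := by
  have hc : Continuous fun r => px V r (Φ r (X s y)) :=
    (continuous_px h.contDiff_speed).comp (continuous_id.prodMk
      (h.continuous_flow.comp (by fun_prop : Continuous fun r : ℝ => (r, X s y))))
  have h1 := (hasDerivAt_px h.contDiff_foot s (Φ s (X s y))).comp (X s y)
    (h.hasDerivAt_space s (X s y))
  have h2 : HasDerivAt (X s ∘ Φ s) 1 (X s y) := by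
    have : X s ∘ Φ s = id := funext fun ξ => h.foot_flow s ξ
    rw [this]; exact hasDerivAt_id _
  have h3 := h1.unique h2
  rw [h.flow_foot] at h3
  have h4 := (h.hasDerivAt_space t (X s y)).comp y (hasDerivAt_px h.contDiff_foot s y)
  refine h4.congr_deriv ?_
  rw [← intervalIntegral.integral_interval_sub_left (hc.intervalIntegrable 0 t)
    (hc.intervalIntegrable 0 s), Real.exp_sub, eq_div_iff (Real.exp_pos _).ne', mul_assoc, h3, mul_one]

/-- Change of variables along the flow. -/
theorem lintegral_flow_le (h : IsModel V A F Φ X) {s : ℝ} (hs : s ∈ Icc 0 t)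
    (hD : ∀ s ∈ Icc 0 t, ∀ y ∈ Icc (0 : ℝ) 1, px V s y ≤ D) (g : ℝ → ENNReal) :
    ∫⁻ x in Icc (0 : ℝ) 1, (Icc (0 : ℝ) 1).indicator g (Φ s (X t x)) ≤
      ENNReal.ofReal (Real.exp (D * (t - s))) * ∫⁻ y in Icc (0 : ℝ) 1, g y := by
  have cY : ∀ s t, Continuous fun x => Φ s (X t x) := fun s t =>
    h.continuous_flow.comp (continuous_const.prodMk
      (h.continuous_foot.comp (by fun_prop : Continuous fun x : ℝ => (t, x))))
  set C : Set ℝ := {x | Φ s (X t x) ∈ Icc (0 : ℝ) 1} with hC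
  set B : Set ℝ := {y | Φ t (X s y) ∈ Icc (0 : ℝ) 1} ∩ Icc 0 1 with hB
  have mC : MeasurableSet C := (isClosed_Icc.preimage (cY s t)).measurableSet
  have mB : MeasurableSet B := (isClosed_Icc.preimage (cY t s)).measurableSet.inter measurableSet_Icc
  have hinj : Function.Injective fun y => Φ t (X s y) :=
    ((h.strictMono_flow t).comp (h.strictMono_foot s)).injective
  -- The points of [0, 1] that lay in [0, 1] at time `s` are parametrised by their position then;
  -- the Jacobian is evaluated on paths that stay in [0, 1] in between, where `D` bounds the slope.
  have himg : C ∩ Icc 0 1 = (fun y => Φ t (X s y)) '' B := by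
    ext x
    constructor
    · rintro ⟨h1, h2⟩
      refine ⟨Φ s (X t x), ⟨?_, h1⟩, ?_⟩
      · simp only [mem_ofPred_eq, h.foot_flow, h.flow_foot]; exact h2
      · simp only [h.foot_flow, h.flow_foot]
    · rintro ⟨y, ⟨h1, h2⟩, rfl⟩
      refine ⟨?_, h1⟩
      simp only [hC, mem_ofPred_eq, h.foot_flow, h.flow_foot]; exact h2
  have e1 : ∀ x, (Icc (0 : ℝ) 1).indicator g (Φ s (X t x)) =
      C.indicator (fun x => g (Φ s (X t x))) x := fun x => by
    by_cases hx : Φ s (X t x) ∈ Icc (0 : ℝ) 1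
    · rw [indicator_of_mem hx, indicator_of_mem (show x ∈ C from hx)]
    · rw [indicator_of_notMem hx, indicator_of_notMem (show x ∉ C from hx)]
  simp only [e1]
  rw [setLIntegral_indicator mC, himg, lintegral_image_eq_lintegral_abs_deriv_mul mB
    (fun y _ => (h.hasDerivAt_flow_foot s t y).hasDerivWithinAt) hinj.injOn]
  calc _ ≤ ∫⁻ y in B, ENNReal.ofReal (Real.exp (D * (t - s))) * g y := by
        refine setLIntegral_mono' mB fun y hy => ?_
        simp only [h.foot_flow, h.flow_foot]
        gcongr
        rw [Real.abs_exp]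
        refine Real.exp_le_exp.2 (integral_le_mul ?_ hs.2 fun r hr => hD r
          ⟨hs.1.trans hr.1, hr.2⟩ _ ⟨?_, ?_⟩)
        · exact (continuous_px h.contDiff_speed).comp (continuous_id.prodMk
            (h.continuous_flow.comp (by fun_prop : Continuous fun r : ℝ => (r, X s y))))
        · have := (h.strictMono_time (X s y)).monotone hr.1
          simp only [h.flow_foot] at this
          exact hy.2.1.trans this
        · have := (h.strictMono_time (X s y)).monotone hr.2
          exact this.trans hy.1.2
    _ = ENNReal.ofReal (Real.exp (D * (t - s))) * ∫⁻ y in B, g y :=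
        lintegral_const_mul' _ _ ENNReal.ofReal_ne_top
    _ ≤ _ := by
        gcongr
        exact inter_subset_right

end IsModel

/-! ### Norms of slices, memory maxima and extrema of the coefficients. -/

section Norms

variable {g : ℝ → ℝ}

instance isProbabilityMeasure_unitVol : IsProbabilityMeasure unitVol :=
  ⟨by simp [unitVol]⟩

theorem ae_unitVol_iff {P : ℝ → Prop} :
    (∀ᵐ x ∂unitVol, P x) ↔ ∀ᵐ x, x ∈ Icc (0 : ℝ) 1 → P x :=
  ae_restrict_iff' measurableSet_Icc

/-- Values outside [0, 1] are arbitrary, so only a cut-off version can be measurable; it differs at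
finitely many points from a function continuous on an open set and zero elsewhere. -/
theorem PC1.measurable_indicator (hg : PC1 g) : Measurable ((Ioc (0 : ℝ) 1).indicator g) := by
  obtain ⟨J, hJ, hd, -⟩ := hg.piecewise
  have ho : IsOpen (Ioo (0 : ℝ) 1 \ J) := isOpen_Ioo.sdiff J.finite_toSet.isClosed
  have hc : ContinuousOn g (Ioo (0 : ℝ) 1 \ J) := fun x hx =>
    (hd x hx).continuousAt.continuousWithinAt
  have h1 : Measurable ((Ioo (0 : ℝ) 1 \ J).indicator g) := by
    classical
    rw [← piecewise_eq_indicator]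
    exact hc.measurable_piecewise continuousOn_const ho.measurableSet
  refine h1.measurable_of_countable_ne (Set.Countable.mono ?_
    ((J.finite_toSet.union (finite_singleton 1)).countable))
  intro x hx
  by_contra hne
  simp only [mem_union, mem_singleton_iff, not_or] at hne
  refine hx ?_
  by_cases h2 : x ∈ Ioc (0 : ℝ) 1
  · have h3 : x ∈ Ioo (0 : ℝ) 1 \ J := ⟨⟨h2.1, lt_of_le_of_ne h2.2 hne.2⟩, hne.1⟩
    rw [indicator_of_mem h2, indicator_of_mem h3]
  · rw [indicator_of_notMem h2, indicator_of_notMem fun h3 => h2 ⟨h3.1.1, h3.1.2.le⟩]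

/-- The one-sided limits bound `g` near each point, and compactness of [0, 1] makes the bound
global. -/
theorem PC1.exists_bound (hg : PC1 g) : ∃ C, ∀ x ∈ Icc (0 : ℝ) 1, |g x| ≤ C := by
  have bd : ∀ {l : Filter ℝ} {c : ℝ}, Tendsto g l (𝓝 c) → ∃ C, ∀ᶠ y in l, |g y| ≤ C := by
    intro l c h
    refine ⟨|c| + 1, ?_⟩
    filter_upwards [h.abs.eventually (gt_mem_nhds (lt_add_one |c|))] with y hy using hy.le
  refine isCompact_Icc.induction_on (p := fun s => ∃ C, ∀ x ∈ s, |g x| ≤ C) ⟨0, by simp⟩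
    (fun s t hst ⟨C, hC⟩ => ⟨C, fun x hx => hC x (hst hx)⟩)
    (fun s t ⟨C, hC⟩ ⟨C', hC'⟩ => ⟨max C C', fun x hx => hx.elim
      (fun h => (hC x h).trans (le_max_left _ _)) fun h => (hC' x h).trans (le_max_right _ _)⟩)
    fun x hx => ?_
  have hleft : ∃ C, ∀ᶠ y in 𝓝[Icc 0 1 ∩ Iio x] x, |g y| ≤ C := by
    rcases hx.1.eq_or_lt with rfl | h0
    · refine ⟨0, ?_⟩
      have : Icc (0 : ℝ) 1 ∩ Iio 0 = ∅ := by ext y; simp; intro h _; exact h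
      rw [this]; simp
    · obtain ⟨C, hC⟩ := bd (hg.leftCont x ⟨h0, hx.2⟩)
      exact ⟨C, hC.filter_mono (nhdsWithin_mono x inter_subset_right)⟩
  have hright : ∃ C, ∀ᶠ y in 𝓝[Icc 0 1 ∩ Ioi x] x, |g y| ≤ C := by
    rcases hx.2.eq_or_lt with rfl | h0
    · refine ⟨0, ?_⟩
      have : Icc (0 : ℝ) 1 ∩ Ioi 1 = ∅ := by ext y; simp
      rw [this]; simp
    · obtain ⟨l, hl⟩ := hg.rightLim x ⟨hx.1, h0⟩
      obtain ⟨C, hC⟩ := bd hl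
      exact ⟨C, hC.filter_mono (nhdsWithin_mono x inter_subset_right)⟩
  obtain ⟨C, hC⟩ := hleft
  obtain ⟨C', hC'⟩ := hright
  refine ⟨{y | |g y| ≤ max |g x| (max C C')}, ?_, max |g x| (max C C'), fun y hy => hy⟩
  rw [eventually_nhdsWithin_iff] at hC hC'
  rw [mem_nhdsWithin_iff_eventually]
  filter_upwards [hC, hC'] with y h1 h2 hy
  rcases lt_trichotomy y x with h | rfl | h
  · exact (h1 ⟨hy, h⟩).trans ((le_max_left _ _).trans (le_max_right _ _))
  · exact le_max_left _ _
  · exact (h2 ⟨hy, h⟩).trans ((le_max_right _ _).trans (le_max_right _ _))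

theorem indicator_ae_eq : (Ioc (0 : ℝ) 1).indicator g =ᵐ[unitVol] g := by
  have h0 : ∀ᵐ x : ℝ, x ≠ 0 := by simp [ae_iff]
  filter_upwards [ae_unitVol_iff.2 (h0.mono fun x hx _ => hx),
    ae_unitVol_iff.2 (Eventually.of_forall fun x hx => hx)] with x hx hx1
  exact indicator_of_mem (show x ∈ Ioc (0 : ℝ) 1 from ⟨lt_of_le_of_ne hx1.1 hx.symm, hx1.2⟩) g

theorem PC1.aestronglyMeasurable (hg : PC1 g) : AEStronglyMeasurable g unitVol :=
  hg.measurable_indicator.aestronglyMeasurable.congr indicator_ae_eq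

theorem PC1.memLp (hg : PC1 g) (p : ENNReal) : MemLp g p unitVol := by
  obtain ⟨C, hC⟩ := hg.exists_bound
  exact MemLp.of_bound hg.aestronglyMeasurable C
    (ae_unitVol_iff.2 (Eventually.of_forall fun x hx => hC x hx))

theorem memLp_of_continuousOn (hg : ContinuousOn g (Icc 0 1)) (p : ENNReal) :
    MemLp g p unitVol := by
  obtain ⟨C, hC⟩ := isCompact_Icc.exists_bound_of_continuousOn hg
  exact MemLp.of_bound (hg.aestronglyMeasurable measurableSet_Icc) C
    (ae_unitVol_iff.2 (Eventually.of_forall fun x hx => hC x hx))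

theorem nrm_le_of_bound {C : ℝ} (hC0 : 0 ≤ C) (hC : ∀ᵐ x ∂unitVol, |g x| ≤ C) (p : ENNReal) :
    nrm p g ≤ C := by
  refine ENNReal.toReal_le_of_le_ofReal hC0 ?_
  have hC' : ∀ᵐ x ∂unitVol, ‖g x‖ ≤ C := hC
  simpa using eLpNorm_le_of_ae_bound (p := p) hC'

theorem ae_le_nrm_top (hg : MemLp g ⊤ unitVol) : ∀ᵐ x ∂unitVol, |g x| ≤ nrm ⊤ g := by
  have h1 := ae_le_eLpNormEssSup (f := g) (μ := unitVol)
  filter_upwards [h1] with x hx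
  rw [← eLpNorm_exponent_top] at hx
  have := ENNReal.toReal_mono hg.2.ne hx
  simpa [nrm] using this

theorem abs_le_nrm_top_of_continuousOn (hg : ContinuousOn g (Icc 0 1)) {x : ℝ}
    (hx : x ∈ Icc (0 : ℝ) 1) : |g x| ≤ nrm ⊤ g := by
  have h1 : (fun x => max |g x| (nrm ⊤ g)) =ᵐ[unitVol] fun _ => nrm ⊤ g := by
    filter_upwards [ae_le_nrm_top (memLp_of_continuousOn hg ⊤)] with y hy using max_eq_right hy
  have := Measure.eqOn_Icc_of_ae_eq volume zero_ne_one h1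
    (hg.abs.sup continuousOn_const) continuousOn_const hx
  exact (le_max_left _ _).trans this.le

/-- By left-continuity a violation at x would persist on an interval of positive length to its left.
The bound is needed at every point because the solution samples `φ` at individual feet. -/
theorem PC1.abs_le_nrm_top (hg : PC1 g) {x : ℝ} (hx : x ∈ Ioc (0 : ℝ) 1) : |g x| ≤ nrm ⊤ g := by
  have h1 := ae_unitVol_iff.1 (ae_le_nrm_top (hg.memLp ⊤))
  by_contra hne
  have h2 : ∀ᶠ y in 𝓝[<] x, nrm ⊤ g < |g y| :=
    (hg.leftCont x hx).abs.eventually (lt_mem_nhds (not_le.1 hne))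
  obtain ⟨c, hc, hcs⟩ := mem_nhdsLT_iff_exists_Ioo_subset.1 (h2.and (Ioo_mem_nhdsLT hx.1))
  have h3 : volume (Ioo c x) = 0 := by
    refine measure_mono_null ?_ (ae_iff.1 h1)
    intro y hy hy'
    have h4 := hcs hy
    exact absurd (hy' ⟨h4.2.1.le, h4.2.2.le.trans hx.2⟩) (not_le.2 h4.1)
  rw [Real.volume_Ioo, ENNReal.ofReal_eq_zero] at h3
  have : c < x := hc
  linarith

end Norms

section MemMax

variable {δ μ t C : ℝ} {g : ℝ → ℝ}

theorem le_memMax_mul (hμ : 0 ≤ μ) (hC : ∀ s ∈ Icc 0 t, |g s| ≤ C) {s : ℝ}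
    (hs : s ∈ Icc (max 0 (t - δ)) t) : g s ≤ memMax δ μ t g * Real.exp (μ * (t - s)) := by
  -- A real supremum over an unbounded set is 0 by convention, so boundedness is what makes `memMax`
  -- a true upper bound.
  have hbdd : BddAbove ((fun s => g s * Real.exp (-μ * (t - s))) '' Icc (max 0 (t - δ)) t) := by
    refine ⟨C, ?_⟩
    rintro _ ⟨r, hr, rfl⟩
    have hr0 : r ∈ Icc 0 t := ⟨(le_max_left _ _).trans hr.1, hr.2⟩
    have h1 : Real.exp (-μ * (t - r)) ≤ 1 :=
      Real.exp_le_one_iff.2 (by nlinarith [mul_nonneg hμ (sub_nonneg.2 hr.2)])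
    calc g r * Real.exp (-μ * (t - r)) ≤ |g r| * 1 :=
          mul_le_mul (le_abs_self _) h1 (Real.exp_pos _).le (abs_nonneg _)
      _ ≤ C := by rw [mul_one]; exact hC r hr0
  have h1 : g s * Real.exp (-μ * (t - s)) ≤ memMax δ μ t g := le_csSup hbdd ⟨s, hs, rfl⟩
  have h2 := mul_le_mul_of_nonneg_right h1 (Real.exp_pos (μ * (t - s))).le
  rwa [mul_assoc, ← Real.exp_add, neg_mul, neg_add_cancel, Real.exp_zero, mul_one] at h2

theorem memMax_nonneg (hμ : 0 ≤ μ) (hC : ∀ s ∈ Icc 0 t, |g s| ≤ C) (ht : 0 ≤ t) (hδ : 0 ≤ δ)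
    (hg : 0 ≤ g t) : 0 ≤ memMax δ μ t g := by
  have := le_memMax_mul (δ := δ) hμ hC (s := t) ⟨max_le ht (by linarith), le_rfl⟩
  rw [sub_self, mul_zero, Real.exp_zero, mul_one] at this
  exact hg.trans this

end MemMax

section Extrema

variable {u : ℝ → ℝ → ℝ} {t : ℝ}

theorem isCompact_image_upTo (hu : ContinuousOn (Function.uncurry u) strip) (t : ℝ) :
    IsCompact (Function.uncurry u '' (Icc 0 t ×ˢ Icc 0 1)) :=
  (isCompact_Icc.prod isCompact_Icc).image_of_continuousOn
    (hu.mono (prod_mono Icc_subset_Ici_self subset_rfl))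

theorem minUpTo_le (hu : ContinuousOn (Function.uncurry u) strip) :
    ∀ s ∈ Icc 0 t, ∀ y ∈ Icc (0 : ℝ) 1, minUpTo u t ≤ u s y := fun s hs y hy =>
  csInf_le (isCompact_image_upTo hu t).bddBelow ⟨(s, y), ⟨hs, hy⟩, rfl⟩

theorem le_maxUpTo (hu : ContinuousOn (Function.uncurry u) strip) :
    ∀ s ∈ Icc 0 t, ∀ y ∈ Icc (0 : ℝ) 1, u s y ≤ maxUpTo u t := fun s hs y hy =>
  le_csSup (isCompact_image_upTo hu t).bddAbove ⟨(s, y), ⟨hs, hy⟩, rfl⟩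

theorem minUpTo_pos (hu : ContinuousOn (Function.uncurry u) strip) (ht : 0 ≤ t)
    (hpos : ∀ t x : ℝ, 0 ≤ t → x ∈ Icc (0 : ℝ) 1 → 0 < u t x) : 0 < minUpTo u t := by
  obtain ⟨z, hz, he⟩ := (isCompact_image_upTo hu t).sInf_mem
    ⟨_, ⟨(0, 0), ⟨⟨le_rfl, ht⟩, ⟨le_rfl, zero_le_one⟩⟩, rfl⟩⟩
  rw [minUpTo, ← he]
  exact hpos z.1 z.2 hz.1.1 hz.2

theorem continuousOn_dx (hu : C1On u strip) : ContinuousOn (Function.uncurry (dx u)) strip := by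
  have h1 : ContinuousOn (fun z => fderivWithin ℝ (Function.uncurry u) strip z (0, 1)) strip :=
    (hu.continuousOn_fderivWithin uniqueDiffOn_strip (by norm_num)).clm_apply continuousOn_const
  exact h1.congr fun z hz => IsModel.dx_of_hasFDerivWithinAt hz
    (hu.differentiableOn (by norm_num) z hz).hasFDerivWithinAt

theorem AgreeUpTo.dx_eq {T : ℝ} {U : ℝ → ℝ → ℝ} (h : AgreeUpTo T u U)
    (hU : ContDiff ℝ 1 (Function.uncurry U)) {s y : ℝ} (hs : s ∈ Icc 0 T)
    (hy : y ∈ Icc (0 : ℝ) 1) : px U s y = dx u s y := by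
  have h1 : HasDerivWithinAt (u s) (px U s y) (Icc 0 1) y :=
    (hasDerivAt_px hU s y).hasDerivWithinAt.congr (fun x hx => (h s hs x hx).symm)
      (h s hs y hy).symm
  exact (h1.derivWithin (uniqueDiffOn_Icc one_pos y hy)).symm

/-- The norms of the slices are bounded on bounded time intervals. -/
theorem exists_bound_nrm (hu : ContinuousOn (Function.uncurry u) strip) (p : ENNReal) (t : ℝ) :
    ∃ C, ∀ s ∈ Icc 0 t, |nrm p (u s)| ≤ C := by
  obtain ⟨C, hC⟩ := (isCompact_Icc.prod isCompact_Icc).exists_bound_of_continuousOn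
    (hu.mono (prod_mono (Icc_subset_Ici_self : Icc 0 t ⊆ Ici 0) subset_rfl))
  refine ⟨|C|, fun s hs => ?_⟩
  have h0 : 0 ≤ nrm p (u s) := ENNReal.toReal_nonneg
  rw [abs_of_nonneg h0]
  exact nrm_le_of_bound (abs_nonneg _) (ae_unitVol_iff.2 (Eventually.of_forall fun y hy =>
    (hC (s, y) ⟨hs, hy⟩).trans (le_abs_self _))) p

end Extrema

/-! ### The sup and L^p estimates for the model problem. -/

/-- A form of Minkowski's integral inequality with a uniform bound for the integrand. -/
theorem lintegral_rpow_lintegral_le {α β : Type*} [MeasurableSpace α] [MeasurableSpace β]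
    {μ : Measure α} {ν : Measure β} [SFinite μ] [IsFiniteMeasure ν] {K : β → α → ENNReal}
    (hK : Measurable (Function.uncurry K)) {p : ℝ} (hp : 1 < p) {B : ENNReal}
    (hB : ∀ᵐ s ∂ν, ∫⁻ x, K s x ^ p ∂μ ≤ B ^ p) :
    (∫⁻ x, (∫⁻ s, K s x ∂ν) ^ p ∂μ) ^ (1 / p) ≤ ν univ * B := by
  have p0 : 0 < p := one_pos.trans hp
  -- Since the bound `B` is uniform in `s`, Hölder and Tonelli suffice: the factors ν^(p-1) and ν
  -- combine to ν^p.
  have holder : ∀ x, (∫⁻ s, K s x ∂ν) ^ p ≤ (∫⁻ s, K s x ^ p ∂ν) * ν univ ^ (p - 1) := by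
    intro x
    have hm : Measurable fun s => K s x := hK.comp (measurable_id.prodMk measurable_const)
    have h1 := eLpNorm'_le_eLpNorm'_mul_rpow_measure_univ one_pos hp.le
      (hm.aestronglyMeasurable (μ := ν))
    simp only [eLpNorm', enorm_eq_self, ENNReal.rpow_one, div_one] at h1
    refine (ENNReal.rpow_le_rpow h1 p0.le).trans_eq ?_
    rw [ENNReal.mul_rpow_of_nonneg _ _ p0.le, ← ENNReal.rpow_mul, ← ENNReal.rpow_mul,
      one_div_mul_cancel p0.ne', ENNReal.rpow_one]
    congr 2
    field_simp
  have hKp : Measurable (Function.uncurry fun s x => K s x ^ p) := hK.pow_const p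
  have h2 : ∫⁻ x, (∫⁻ s, K s x ∂ν) ^ p ∂μ ≤ (ν univ * B) ^ p := by
    calc ∫⁻ x, (∫⁻ s, K s x ∂ν) ^ p ∂μ ≤ ∫⁻ x, (∫⁻ s, K s x ^ p ∂ν) * ν univ ^ (p - 1) ∂μ :=
          lintegral_mono holder
      _ = (∫⁻ x, ∫⁻ s, K s x ^ p ∂ν ∂μ) * ν univ ^ (p - 1) :=
          lintegral_mul_const' _ _ (ENNReal.rpow_ne_top_of_nonneg (by linarith) (measure_ne_top _ _))
      _ = (∫⁻ s, ∫⁻ x, K s x ^ p ∂μ ∂ν) * ν univ ^ (p - 1) := by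
          rw [lintegral_lintegral_swap]
          exact (hKp.comp measurable_swap).aemeasurable
      _ ≤ (∫⁻ _, B ^ p ∂ν) * ν univ ^ (p - 1) := by
          gcongr ?_ * _
          exact lintegral_mono_ae hB
      _ = (ν univ * B) ^ p := by
          rw [lintegral_const, ENNReal.mul_rpow_of_nonneg _ _ p0.le, mul_assoc, mul_comm]
          congr 1
          nth_rw 1 [← ENNReal.rpow_one (ν univ)]
          rw [← ENNReal.rpow_add_of_nonneg _ _ zero_le_one (by linarith)]
          congr 1
          ring
  refine (ENNReal.rpow_le_rpow h2 (by positivity)).trans_eq ?_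
  rw [← ENNReal.rpow_mul, mul_one_div_cancel p0.ne', ENNReal.rpow_one]

namespace IsModel

variable {V A F Φ X : ℝ → ℝ → ℝ} {θ φ b : ℝ → ℝ} {t m α D μ Mb Mf p : ℝ}

theorem continuous_source_flow (h : IsModel V A F Φ X) (η : ℝ) :
    Continuous fun r => F r (Φ r η) :=
  (h.contDiff_source.comp (contDiff_fst.prodMk h.contDiff_flow)).continuous.comp
    (by fun_prop : Continuous fun r : ℝ => (r, η))

theorem time_bounds (hm : 0 < m) {s₀ x : ℝ} (hs₀ : s₀ ∈ Icc 0 t) (hx : x ≤ 1)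
    (hle : m * (t - s₀) ≤ x) :
    t - s₀ ≤ x / m ∧ t - s₀ ≤ 1 / m ∧ ∀ r ∈ Icc s₀ t, r ∈ Icc (max 0 (t - 1 / m)) t := by
  have h1 : t - s₀ ≤ x / m := by rw [le_div_iff₀ hm]; linarith
  have h2 : t - s₀ ≤ 1 / m := h1.trans (by gcongr)
  exact ⟨h1, h2, fun r hr => ⟨max_le (hs₀.1.trans hr.1) (by linarith [hr.1]), hr.2⟩⟩

/-- Growth at rate α and fading memory at rate μ combine to the exponent (μ + α)(t - r), which
increases with the elapsed time. The bound `y` on that time is 1/m in the sup estimate and x/m for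
the L^p boundary term. -/
theorem exp_mul_le {s₀ r c y B : ℝ} (hB : 0 ≤ B) (hσ : 0 ≤ μ + α) (hr : s₀ ≤ r)
    (hty : t - s₀ ≤ y) (hc : c ≤ B * Real.exp (μ * (t - r))) :
    Real.exp (α * (t - r)) * c ≤ Real.exp ((μ + α) * y) * B := by
  calc Real.exp (α * (t - r)) * c ≤ Real.exp (α * (t - r)) * (B * Real.exp (μ * (t - r))) := by
        gcongr
    _ = Real.exp ((μ + α) * (t - r)) * B := by
        rw [mul_comm B, ← mul_assoc, ← Real.exp_add]; ring_nf
    _ ≤ Real.exp ((μ + α) * y) * B := by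
        gcongr
        linarith

theorem abs_mixedSol_le_of_sup (h : IsModel V A F Φ X) (hθ : IsHitting Φ X θ) (hφ : PC1 φ)
    (hm : 0 < m) (hσ : 0 < μ + α) (hMb0 : 0 ≤ Mb) (hMf0 : 0 ≤ Mf)
    (hV : ∀ s ∈ Icc 0 t, ∀ y ∈ Icc (0 : ℝ) 1, m ≤ V s y)
    (hA : ∀ s ∈ Icc 0 t, ∀ y ∈ Icc (0 : ℝ) 1, A s y ≤ α)
    (hMb : ∀ s ∈ Icc (max 0 (t - 1 / m)) t, |b s| ≤ Mb * Real.exp (μ * (t - s)))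
    (hMf : ∀ s ∈ Icc (max 0 (t - 1 / m)) t, nrm ⊤ (F s) ≤ Mf * Real.exp (μ * (t - s)))
    {x : ℝ} (hz : (t, x) ∈ strip) :
    |mixedSol A F Φ X θ φ b t x| ≤ Real.exp (t * α) * cut (t - 1 / m) * nrm ⊤ φ +
      1 / m * Real.exp (1 + (μ + α) / m) * Mf + Real.exp ((μ + α) / m) * Mb := by
  obtain ⟨s₀, hs₀, c, hle, hin, hcase, hbound⟩ := h.abs_mixedSol_le (φ := φ) (b := b) hθ hV hA hz
  obtain ⟨-, ht1, hsub⟩ := time_bounds hm hs₀ hz.2.2 hle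
  have e1 : (μ + α) * (1 / m) = (μ + α) / m := by ring
  have hint : ∫ r in s₀..t, Real.exp (α * (t - r)) * |F r (Φ r (X t x))| ≤
      1 / m * Real.exp (1 + (μ + α) / m) * Mf := by
    have h1 : ∫ r in s₀..t, Real.exp (α * (t - r)) * |F r (Φ r (X t x))| ≤
        Real.exp ((μ + α) / m) * Mf * (t - s₀) := by
      refine integral_le_mul ((by fun_prop : Continuous fun r => Real.exp (α * (t - r))).mul
        (h.continuous_source_flow _).abs) hs₀.2 fun r hr => ?_
      rw [← e1]
      refine exp_mul_le hMf0 hσ.le hr.1 ht1 (le_trans ?_ (hMf r (hsub r hr)))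
      exact abs_le_nrm_top_of_continuousOn
        (h.contDiff_source.continuous.comp (by fun_prop : Continuous fun y : ℝ => (r, y))).continuousOn
        (hin r hr)
    calc _ ≤ Real.exp ((μ + α) / m) * Mf * (t - s₀) := h1
      _ ≤ Real.exp (1 + (μ + α) / m) * Mf * (1 / m) := by
        have ht0 : 0 ≤ t - s₀ := sub_nonneg.2 hs₀.2
        -- The extra factor e is slack in the sup estimate; in L^p it covers a possibly negative
        -- exponent.
        have he : Real.exp ((μ + α) / m) ≤ Real.exp (1 + (μ + α) / m) :=
          Real.exp_le_exp.2 (by linarith)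
        gcongr
      _ = _ := by ring
  have n0 : 0 ≤ nrm ⊤ φ := ENNReal.toReal_nonneg
  have c0 : 0 ≤ cut (t - 1 / m) := by unfold cut; split_ifs <;> norm_num
  have hstart : Real.exp (α * (t - s₀)) * c ≤
      Real.exp (t * α) * cut (t - 1 / m) * nrm ⊤ φ + Real.exp ((μ + α) / m) * Mb := by
    rcases hcase with ⟨h0, rfl, rfl, hlt⟩ | ⟨-, rfl⟩
    · have hc1 : cut (t - 1 / m) = 1 := if_pos (by
        rw [sub_neg, lt_div_iff₀ hm]; linarith)
      have h3 : |φ (X t x)| ≤ nrm ⊤ φ := hφ.abs_le_nrm_top ⟨h0, h.mapsTo_foot hz⟩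
      rw [hc1, mul_one, sub_zero, mul_comm α t]
      have : 0 ≤ Real.exp ((μ + α) / m) * Mb := by positivity
      nlinarith [mul_le_mul_of_nonneg_left h3 (Real.exp_pos (t * α)).le]
    · have h1 := exp_mul_le hMb0 hσ.le le_rfl ht1 (hMb s₀ (hsub s₀ ⟨le_rfl, hs₀.2⟩))
      rw [e1] at h1
      have : 0 ≤ Real.exp (t * α) * cut (t - 1 / m) * nrm ⊤ φ := by positivity
      linarith
  linarith

/-- The contribution of the source to the bound, as an extended nonnegative kernel. -/
def sourceKernel (F Φ X : ℝ → ℝ → ℝ) (α t s x : ℝ) : ENNReal :=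
  (Icc (0 : ℝ) 1).indicator (fun y => ENNReal.ofReal (Real.exp (α * (t - s))) * ‖F s y‖ₑ)
    (Φ s (X t x))

theorem measurable_sourceKernel (h : IsModel V A F Φ X) (α t : ℝ) :
    Measurable (Function.uncurry (sourceKernel F Φ X α t)) := by
  have c1 : Continuous fun z : ℝ × ℝ => Φ z.1 (X t z.2) :=
    h.continuous_flow.comp (continuous_fst.prodMk
      (h.continuous_foot.comp (continuous_const.prodMk continuous_snd)))
  have c2 : Continuous fun z : ℝ × ℝ => F z.1 (Φ z.1 (X t z.2)) :=
    h.contDiff_source.continuous.comp (continuous_fst.prodMk c1)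
  have m1 : Measurable fun z : ℝ × ℝ => ENNReal.ofReal (Real.exp (α * (t - z.1))) *
      ‖F z.1 (Φ z.1 (X t z.2))‖ₑ :=
    ((by fun_prop : Continuous fun z : ℝ × ℝ => Real.exp (α * (t - z.1))).measurable.ennreal_ofReal
      ).mul c2.measurable.enorm
  have := m1.indicator (isClosed_Icc.preimage c1 : IsClosed ((fun z : ℝ × ℝ => Φ z.1 (X t z.2)) ⁻¹'
    Icc 0 1)).measurableSet
  exact this

theorem indicator_rpow {g : ℝ → ENNReal} (hp : 0 < p) (y : ℝ) :
    (Icc (0 : ℝ) 1).indicator g y ^ p = (Icc (0 : ℝ) 1).indicator (fun y => g y ^ p) y := by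
  by_cases hy : y ∈ Icc (0 : ℝ) 1
  · rw [indicator_of_mem hy, indicator_of_mem hy]
  · rw [indicator_of_notMem hy, indicator_of_notMem hy, ENNReal.zero_rpow_of_pos hp]

theorem ofReal_exp_rpow (c : ℝ) : ENNReal.ofReal (Real.exp c) ^ p = ENNReal.ofReal (Real.exp (p * c)) := by
  rw [ENNReal.ofReal_rpow_of_pos (Real.exp_pos _), ← Real.exp_mul, mul_comm]

theorem lintegral_enorm_rpow {g : ℝ → ℝ} (hp : 0 < p)
    (hg : MemLp g (ENNReal.ofReal p) unitVol) :
    ∫⁻ x in Icc (0 : ℝ) 1, ‖g x‖ₑ ^ p = ENNReal.ofReal (nrm (ENNReal.ofReal p) g) ^ p := by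
  have h1 : ENNReal.ofReal p ≠ 0 := (ENNReal.ofReal_pos.2 hp).ne'
  rw [nrm, ENNReal.ofReal_toReal hg.2.ne,
    eLpNorm_eq_lintegral_rpow_enorm_toReal h1 ENNReal.ofReal_ne_top, ENNReal.toReal_ofReal hp.le,
    ← ENNReal.rpow_mul, one_div_mul_cancel hp.ne', ENNReal.rpow_one]
  rfl

/-- The source term of the `L^p` estimate. -/
theorem lintegral_sourceKernel_le (h : IsModel V A F Φ X) (hp : 1 < p) (hm : 0 < m)
    (hκ : -m < μ + p⁻¹ * D + α) (hMf0 : 0 ≤ Mf)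
    (hD : ∀ s ∈ Icc 0 t, ∀ y ∈ Icc (0 : ℝ) 1, px V s y ≤ D)
    (hMf : ∀ s ∈ Icc (max 0 (t - 1 / m)) t,
      nrm (ENNReal.ofReal p) (F s) ≤ Mf * Real.exp (μ * (t - s))) :
    (∫⁻ x in Icc (0 : ℝ) 1, (∫⁻ s in Icc (max 0 (t - 1 / m)) t, sourceKernel F Φ X α t s x) ^ p)
        ^ (1 / p) ≤
      ENNReal.ofReal (1 / m * Real.exp (1 + (μ + p⁻¹ * D + α) / m) * Mf) := by
  have p0 : 0 < p := one_pos.trans hp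
  set κ := μ + p⁻¹ * D + α with hκd
  have hvol : (volume.restrict (Icc (max 0 (t - 1 / m)) t)) univ ≤ ENNReal.ofReal (1 / m) := by
    rw [Measure.restrict_apply_univ, Real.volume_Icc]
    exact ENNReal.ofReal_le_ofReal (by linarith [le_max_right 0 (t - 1 / m)])
  have hB : ∀ s ∈ Icc (max 0 (t - 1 / m)) t,
      ∫⁻ x in Icc (0 : ℝ) 1, sourceKernel F Φ X α t s x ^ p ≤
        ENNReal.ofReal (Real.exp (1 + κ / m) * Mf) ^ p := by
    intro s hs
    have hs0 : s ∈ Icc 0 t := ⟨(le_max_left _ _).trans hs.1, hs.2⟩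
    have hFs : MemLp (F s) (ENNReal.ofReal p) unitVol := memLp_of_continuousOn
      (h.contDiff_source.continuous.comp (by fun_prop : Continuous fun y : ℝ => (s, y))).continuousOn _
    simp only [sourceKernel, indicator_rpow p0]
    refine (h.lintegral_flow_le hs0 hD _).trans ?_
    simp only [ENNReal.mul_rpow_of_nonneg _ _ p0.le]
    rw [lintegral_const_mul' _ _ (ENNReal.rpow_ne_top_of_nonneg p0.le ENNReal.ofReal_ne_top),
      lintegral_enorm_rpow p0 hFs, ofReal_exp_rpow, ← mul_assoc, ← ENNReal.ofReal_mul (by positivity),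
      ← Real.exp_add]
    -- After the p-th root the Jacobian bound contributes only D / p to the rate.
    have e : D * (t - s) + p * (α * (t - s)) = p * ((p⁻¹ * D + α) * (t - s)) := by
      field_simp
    rw [e, ← ofReal_exp_rpow, ← ENNReal.mul_rpow_of_nonneg _ _ p0.le,
      ← ENNReal.ofReal_mul (by positivity)]
    refine ENNReal.rpow_le_rpow (ENNReal.ofReal_le_ofReal ?_) p0.le
    have hts : 0 ≤ t - s := by linarith [hs.2]
    have hts' : t - s ≤ 1 / m := by linarith [(le_max_right 0 (t - 1 / m)).trans hs.1]
    -- The reason for the 1 in the exponent: `κ` may be negative, but κ > -m keeps 1 + κ/m positive,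
    -- hence above κ (t - s) ≤ 0.
    have hk : κ * (t - s) ≤ 1 + κ / m := by
      have h1 : 0 < 1 + κ / m := by
        have : -1 < κ / m := by rw [lt_div_iff₀ hm]; linarith
        linarith
      rcases le_total κ 0 with hk0 | hk0
      · nlinarith
      · have := mul_le_mul_of_nonneg_left hts' hk0
        rw [mul_one_div] at this
        linarith
    calc Real.exp ((p⁻¹ * D + α) * (t - s)) * nrm (ENNReal.ofReal p) (F s)
        ≤ Real.exp ((p⁻¹ * D + α) * (t - s)) * (Mf * Real.exp (μ * (t - s))) := by
          gcongr
          exact hMf s hs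
      _ = Real.exp (κ * (t - s)) * Mf := by
          rw [mul_comm Mf, ← mul_assoc, ← Real.exp_add, hκd]; ring_nf
      _ ≤ _ := by gcongr
  have := lintegral_rpow_lintegral_le (μ := volume.restrict (Icc (0 : ℝ) 1))
    (ν := volume.restrict (Icc (max 0 (t - 1 / m)) t)) (h.measurable_sourceKernel α t) hp
    ((ae_restrict_iff' measurableSet_Icc).2 (Eventually.of_forall hB))
  refine this.trans ((mul_le_mul_left hvol _).trans ?_)
  rw [← ENNReal.ofReal_mul (by positivity), mul_assoc]

/-- The initial term of the `L^p` estimate. -/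
theorem lintegral_initial_le (h : IsModel V A F Φ X) (hφ : PC1 φ) (hp : 1 < p) (ht : 0 ≤ t)
    (hD : ∀ s ∈ Icc 0 t, ∀ y ∈ Icc (0 : ℝ) 1, px V s y ≤ D) {c : ℝ} (hc : cut (t - 1 / m) = c) :
    (∫⁻ x in Icc (0 : ℝ) 1, (ENNReal.ofReal (Real.exp (α * t) * c) *
        ‖(Ioc (0 : ℝ) 1).indicator φ (X t x)‖ₑ) ^ p) ^ (1 / p) ≤
      ENNReal.ofReal (Real.exp ((α + p⁻¹ * D) * t) * c * nrm (ENNReal.ofReal p) φ) := by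
  have p0 : 0 < p := one_pos.trans hp
  have c0 : 0 ≤ c := by rw [← hc]; unfold cut; split_ifs <;> norm_num
  have hle : ∫⁻ x in Icc (0 : ℝ) 1, ‖(Ioc (0 : ℝ) 1).indicator φ (X t x)‖ₑ ^ p ≤
      ENNReal.ofReal (Real.exp (D * t)) * ENNReal.ofReal (nrm (ENNReal.ofReal p) φ) ^ p := by
    have h1 := h.lintegral_flow_le (g := fun y => ‖(Ioc (0 : ℝ) 1).indicator φ y‖ₑ ^ p)
      (left_mem_Icc.2 ht) hD
    simp only [h.flow_zero, sub_zero] at h1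
    have h2 : ∀ y, (Icc (0 : ℝ) 1).indicator
        (fun y => ‖(Ioc (0 : ℝ) 1).indicator φ y‖ₑ ^ p) y = ‖(Ioc (0 : ℝ) 1).indicator φ y‖ₑ ^ p := by
      intro y
      by_cases hy : y ∈ Icc (0 : ℝ) 1
      · rw [indicator_of_mem hy]
      · rw [indicator_of_notMem hy, indicator_of_notMem fun hy' => hy (Ioc_subset_Icc_self hy'),
          enorm_zero, ENNReal.zero_rpow_of_pos p0]
    simp only [h2] at h1
    refine h1.trans ?_
    rw [← lintegral_enorm_rpow p0 (hφ.memLp _)]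
    gcongr with y
    by_cases hy : y ∈ Ioc (0 : ℝ) 1
    · rw [indicator_of_mem hy]
    · rw [indicator_of_notMem hy, enorm_zero]; exact zero_le
  simp only [ENNReal.mul_rpow_of_nonneg _ _ p0.le]
  rw [lintegral_const_mul' _ _ (ENNReal.rpow_ne_top_of_nonneg p0.le ENNReal.ofReal_ne_top)]
  refine (ENNReal.rpow_le_rpow (mul_le_mul_right hle _) (by positivity)).trans_eq ?_
  have e : ENNReal.ofReal (Real.exp (D * t)) = ENNReal.ofReal (Real.exp (p⁻¹ * D * t)) ^ p := by
    rw [ofReal_exp_rpow]; congr 2; field_simp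
  rw [e, ← ENNReal.mul_rpow_of_nonneg _ _ p0.le, ← ENNReal.mul_rpow_of_nonneg _ _ p0.le,
    ← ENNReal.rpow_mul, mul_one_div_cancel p0.ne', ENNReal.rpow_one,
    ← ENNReal.ofReal_mul (by positivity), ← ENNReal.ofReal_mul (by positivity)]
  congr 1
  rw [add_mul, Real.exp_add]
  ring

/-- The boundary term of the `L^p` estimate. -/
theorem lintegral_boundary_le (hp : 1 < p) (hm : 0 < m) (hσ : 0 < μ + α) :
    (∫⁻ x in Icc (0 : ℝ) 1, ENNReal.ofReal (Real.exp ((μ + α) * (x / m)) * Mb) ^ p) ^ (1 / p) ≤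
      ENNReal.ofReal ((m * ((Real.exp (p * (μ + α) / m) - 1) / (p * (μ + α)))) ^ (1 / p) * Mb) := by
  have p0 : 0 < p := one_pos.trans hp
  -- The integral of exp(k x) over [0, 1] is (exp k - 1) / k, which is the constant in front of the
  -- boundary term.
  set k := p * (μ + α) / m with hk
  have k0 : 0 < k := by positivity
  have e1 : ∀ x : ℝ, ENNReal.ofReal (Real.exp ((μ + α) * (x / m)) * Mb) ^ p =
      ENNReal.ofReal (Real.exp (k * x)) * ENNReal.ofReal Mb ^ p := by
    intro x
    rw [ENNReal.ofReal_mul (Real.exp_pos _).le, ENNReal.mul_rpow_of_nonneg _ _ p0.le, ofReal_exp_rpow]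
    congr 3
    rw [hk]; ring
  have e2 : ∫⁻ x in Icc (0 : ℝ) 1, ENNReal.ofReal (Real.exp (k * x)) =
      ENNReal.ofReal (m * ((Real.exp k - 1) / (p * (μ + α)))) := by
    have hc : Continuous fun x => Real.exp (k * x) := by fun_prop
    rw [← ofReal_integral_eq_lintegral_ofReal hc.integrableOn_Icc
      (Eventually.of_forall fun x => (Real.exp_pos _).le), integral_Icc_eq_integral_Ioc,
      ← intervalIntegral.integral_of_le zero_le_one]
    congr 1
    have hd : ∀ x ∈ uIcc (0 : ℝ) 1, HasDerivAt (fun x => Real.exp (k * x) / k) (Real.exp (k * x)) x := by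
      intro x _
      have := (((hasDerivAt_id x).const_mul k).exp).div_const k
      simp only [id, mul_one] at this
      rwa [mul_div_cancel_right₀ _ k0.ne'] at this
    rw [intervalIntegral.integral_eq_sub_of_hasDerivAt hd (hc.intervalIntegrable _ _)]
    simp only [mul_one, mul_zero, Real.exp_zero]
    rw [← sub_div, hk]
    field_simp
  simp only [e1]
  rw [lintegral_mul_const' _ _ (ENNReal.rpow_ne_top_of_nonneg p0.le ENNReal.ofReal_ne_top), e2,
    ENNReal.mul_rpow_of_nonneg _ _ (by positivity), ← ENNReal.rpow_mul, mul_one_div_cancel p0.ne',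
    ENNReal.rpow_one]
  have h0 : 0 ≤ m * ((Real.exp k - 1) / (p * (μ + α))) := by
    have : 0 ≤ Real.exp k - 1 := by linarith [Real.one_le_exp k0.le]
    positivity
  rw [ENNReal.ofReal_mul (Real.rpow_nonneg h0 _), ENNReal.ofReal_rpow_of_nonneg h0 (by positivity)]

/-- The solution is dominated pointwise by initial, source and boundary parts `G₁`, `G₂`, `G₃`; the
triangle inequality in L^p leaves each to its own lemma. -/
theorem eLpNorm_mixedSol_le (h : IsModel V A F Φ X) (hθ : IsHitting Φ X θ) (hφ : PC1 φ)
    (hp : 1 < p) (ht : 0 ≤ t) (hm : 0 < m) (hσ : 0 < μ + α) (hκ : -m < μ + p⁻¹ * D + α)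
    (hMb0 : 0 ≤ Mb) (hMf0 : 0 ≤ Mf)
    (hV : ∀ s ∈ Icc 0 t, ∀ y ∈ Icc (0 : ℝ) 1, m ≤ V s y)
    (hA : ∀ s ∈ Icc 0 t, ∀ y ∈ Icc (0 : ℝ) 1, A s y ≤ α)
    (hD : ∀ s ∈ Icc 0 t, ∀ y ∈ Icc (0 : ℝ) 1, px V s y ≤ D)
    (hMb : ∀ s ∈ Icc (max 0 (t - 1 / m)) t, |b s| ≤ Mb * Real.exp (μ * (t - s)))
    (hMf : ∀ s ∈ Icc (max 0 (t - 1 / m)) t,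
      nrm (ENNReal.ofReal p) (F s) ≤ Mf * Real.exp (μ * (t - s))) :
    eLpNorm (mixedSol A F Φ X θ φ b t) (ENNReal.ofReal p) unitVol ≤
      ENNReal.ofReal (Real.exp ((α + p⁻¹ * D) * t) * cut (t - 1 / m) * nrm (ENNReal.ofReal p) φ +
        1 / m * Real.exp (1 + (μ + p⁻¹ * D + α) / m) * Mf +
        (m * ((Real.exp (p * (μ + α) / m) - 1) / (p * (μ + α)))) ^ (1 / p) * Mb) := by
  have p0 : 0 < p := one_pos.trans hp
  have hP0 : ENNReal.ofReal p ≠ 0 := (ENNReal.ofReal_pos.2 p0).ne'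
  have hP1 : 1 ≤ ENNReal.ofReal p := by
    rw [← ENNReal.ofReal_one]; exact ENNReal.ofReal_le_ofReal hp.le
  have c0 : 0 ≤ cut (t - 1 / m) := by unfold cut; split_ifs <;> norm_num
  set I := Icc (max 0 (t - 1 / m)) t with hI
  let G₁ : ℝ → ENNReal := fun x => ENNReal.ofReal (Real.exp (α * t) * cut (t - 1 / m)) *
    ‖(Ioc (0 : ℝ) 1).indicator φ (X t x)‖ₑ
  -- The entrance time depends on `x`, the window `I` does not. Enlarging the range of integration
  -- is harmless as the kernel is nonnegative, and its indicator discards times when the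
  -- characteristic is outside [0, 1].
  let G₂ : ℝ → ENNReal := fun x => ∫⁻ s in I, sourceKernel F Φ X α t s x
  let G₃ : ℝ → ENNReal := fun x => ENNReal.ofReal (Real.exp ((μ + α) * (x / m)) * Mb)
  have cX : Continuous (X t) := h.continuous_foot.comp (by fun_prop : Continuous fun x : ℝ => (t, x))
  have m₁ : Measurable G₁ :=
    ((hφ.measurable_indicator.comp cX.measurable).enorm).const_mul _
  have m₂ : Measurable G₂ :=
    Measurable.lintegral_prod_left' (h.measurable_sourceKernel α t)
  have m₃ : Measurable G₃ :=
    (by fun_prop : Continuous fun x => Real.exp ((μ + α) * (x / m)) * Mb).measurable.ennreal_ofReal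
  have hpt : ∀ᵐ x ∂unitVol, ‖mixedSol A F Φ X θ φ b t x‖ₑ ≤ ‖(G₁ + G₂ + G₃) x‖ₑ := by
    refine ae_unitVol_iff.2 (Eventually.of_forall fun x hx => ?_)
    have hz : (t, x) ∈ strip := ⟨ht, hx⟩
    obtain ⟨s₀, hs₀, c, hle, hin, hcase, hbound⟩ := h.abs_mixedSol_le (φ := φ) (b := b) hθ hV hA hz
    obtain ⟨htx, ht1, hsub⟩ := time_bounds hm hs₀ hx.2 hle
    have hcF : Continuous fun r => Real.exp (α * (t - r)) * |F r (Φ r (X t x))| :=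
      (by fun_prop : Continuous fun r => Real.exp (α * (t - r))).mul
        (h.continuous_source_flow _).abs
    have hi0 : 0 ≤ ∫ r in s₀..t, Real.exp (α * (t - r)) * |F r (Φ r (X t x))| :=
      intervalIntegral.integral_nonneg hs₀.2 fun r _ => by positivity
    have hG₂ : ENNReal.ofReal (∫ r in s₀..t, Real.exp (α * (t - r)) * |F r (Φ r (X t x))|) ≤ G₂ x := by
      rw [intervalIntegral.integral_of_le hs₀.2, ← integral_Icc_eq_integral_Ioc,
        ofReal_integral_eq_lintegral_ofReal hcF.integrableOn_Icc
          (Eventually.of_forall fun r => by positivity)]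
      refine le_trans (setLIntegral_mono' measurableSet_Icc fun r hr => ?_)
        (lintegral_mono_set fun r hr => hsub r hr)
      rw [sourceKernel, indicator_of_mem (hin r hr), ENNReal.ofReal_mul (Real.exp_pos _).le,
        Real.enorm_eq_ofReal_abs]
    have hstart : ENNReal.ofReal (Real.exp (α * (t - s₀)) * c) ≤ G₁ x + G₃ x := by
      rcases hcase with ⟨h0, rfl, rfl, hlt⟩ | ⟨-, rfl⟩
      · refine le_add_right ?_
        have hc1 : cut (t - 1 / m) = 1 := if_pos (by rw [sub_neg, lt_div_iff₀ hm]; linarith)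
        have hmem : X t x ∈ Ioc (0 : ℝ) 1 := ⟨h0, h.mapsTo_foot hz⟩
        simp only [G₁, hc1, mul_one, indicator_of_mem hmem, sub_zero, Real.enorm_eq_ofReal_abs]
        rw [ENNReal.ofReal_mul (Real.exp_pos _).le]
      · refine le_add_left (ENNReal.ofReal_le_ofReal ?_)
        exact exp_mul_le hMb0 hσ.le le_rfl htx (hMb s₀ (hsub s₀ ⟨le_rfl, hs₀.2⟩))
    have hc0 : 0 ≤ c := by rcases hcase with ⟨-, -, rfl, -⟩ | ⟨-, rfl⟩ <;> exact abs_nonneg _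
    rw [enorm_eq_self, Real.enorm_eq_ofReal_abs]
    refine (ENNReal.ofReal_le_ofReal hbound).trans ?_
    rw [ENNReal.ofReal_add (by positivity) hi0]
    refine (add_le_add hstart hG₂).trans_eq ?_
    simp only [Pi.add_apply]
    ring
  have r0 : 0 ≤ Real.exp ((α + p⁻¹ * D) * t) * cut (t - 1 / m) * nrm (ENNReal.ofReal p) φ := by
    have : 0 ≤ nrm (ENNReal.ofReal p) φ := ENNReal.toReal_nonneg
    positivity
  have r1 : 0 ≤ 1 / m * Real.exp (1 + (μ + p⁻¹ * D + α) / m) * Mf := by positivity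
  have r2 : 0 ≤ (m * ((Real.exp (p * (μ + α) / m) - 1) / (p * (μ + α)))) ^ (1 / p) * Mb := by
    have : 0 ≤ Real.exp (p * (μ + α) / m) - 1 := by
      linarith [Real.one_le_exp (x := p * (μ + α) / m) (by positivity)]
    positivity
  have nrm_eq : ∀ G : ℝ → ENNReal, eLpNorm G (ENNReal.ofReal p) unitVol =
      (∫⁻ x in Icc (0 : ℝ) 1, G x ^ p) ^ (1 / p) := fun G => by
    rw [eLpNorm_eq_lintegral_rpow_enorm_toReal hP0 ENNReal.ofReal_ne_top, ENNReal.toReal_ofReal p0.le]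
    rfl
  calc eLpNorm (mixedSol A F Φ X θ φ b t) (ENNReal.ofReal p) unitVol
      ≤ eLpNorm (G₁ + G₂ + G₃) (ENNReal.ofReal p) unitVol := eLpNorm_mono_enorm_ae hpt
    _ ≤ eLpNorm G₁ (ENNReal.ofReal p) unitVol + eLpNorm G₂ (ENNReal.ofReal p) unitVol +
        eLpNorm G₃ (ENNReal.ofReal p) unitVol :=
      (eLpNorm_add_le (m₁.add m₂).aestronglyMeasurable m₃.aestronglyMeasurable hP1).trans
        (add_le_add (eLpNorm_add_le m₁.aestronglyMeasurable m₂.aestronglyMeasurable hP1) le_rfl)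
    _ ≤ _ := by
      rw [ENNReal.ofReal_add (by positivity) r2, ENNReal.ofReal_add r0 r1, nrm_eq, nrm_eq, nrm_eq]
      exact add_le_add (add_le_add (h.lintegral_initial_le hφ hp ht hD rfl)
        (h.lintegral_sourceKernel_le hp hm hκ hMf0 hD hMf)) (lintegral_boundary_le hp hm hσ)

end IsModel

/-! ### Transfer to the original coefficients and the main theorem. -/

section Representation

variable {N : ℕ} {v a f w : ℝ → ℝ → ℝ} {φ b : ℝ → ℝ} {ξ : Fin (N + 1) → ℝ}

/-- Up to a given time, a solution is given by the explicit formula. -/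
theorem IsSolution.exists_eq_mixedSol (hw : IsSolution v a f φ b ξ w)
    (h : Admissible v a f φ b ξ) {T : ℝ} (hT : 0 < T) :
    ∃ V A F Φ X θ, IsModel V A F Φ X ∧ IsHitting Φ X θ ∧
      AgreeUpTo T v V ∧ AgreeUpTo T a A ∧ AgreeUpTo T f F ∧
      ∀ t x, (t, x) ∈ strip → t < T → w t x = mixedSol A F Φ X θ φ b t x := by
  obtain ⟨V, A, F, Φ, X, θ, hm, hθ, hV, hA, hF⟩ := h.exists_isModel hT
  refine ⟨V, A, F, Φ, X, θ, hm, hθ, hV, hA, hF, fun t x hz ht => ?_⟩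
  exact hm.eq_of_isSolutionUpTo hθ h.mem ((hw.upTo T).congr_coeff hV hA hF)
    ((hm.isSolution_mixedSol hθ h.bdry h.init h.mem h.zero h.init_c1).upTo T) hz ht

theorem eventuallyEq_of_upTo {T : ℝ} {u : ℝ → ℝ → ℝ}
    (hu : ∀ t x, (t, x) ∈ strip → t < T → w t x = u t x) {z : ℝ × ℝ} (hz : z.1 < T) :
    Function.uncurry w =ᶠ[𝓝[strip] z] Function.uncurry u := by
  filter_upwards [self_mem_nhdsWithin, nhdsWithin_le_nhds
    ((isOpen_lt continuous_fst continuous_const).mem_nhds hz)] with y hy hy1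
  exact hu y.1 y.2 hy hy1

theorem nrm_congr {g g' : ℝ → ℝ} (h : EqOn g g' (Icc 0 1)) (p : ENNReal) : nrm p g = nrm p g' := by
  rw [nrm, nrm, eLpNorm_congr_ae (ae_unitVol_iff.2 (Eventually.of_forall fun x hx => h hx))]

theorem IsSolution.continuousOn (hw : IsSolution v a f φ b ξ w) (h : Admissible v a f φ b ξ)
    (h0 : b 0 = φ 0) (hφ : ContinuousOn φ (Icc 0 1)) : ContinuousOn (Function.uncurry w) strip := by
  intro z hz
  have hz0 : 0 ≤ z.1 := hz.1
  obtain ⟨V, A, F, Φ, X, θ, hm, hθ, -, -, -, he⟩ :=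
    hw.exists_eq_mixedSol h (T := z.1 + 1) (by linarith)
  exact (hm.continuousOn_mixedSol hθ h.bdry hφ h0 z hz).congr_of_eventuallyEq
    (eventuallyEq_of_upTo he (lt_add_one _)) (he z.1 z.2 hz (lt_add_one _))

theorem IsSolution.c1On (hw : IsSolution v a f φ b ξ w) (h : Admissible v a f φ b ξ)
    (hφ : ContDiffOn ℝ 1 φ (Icc 0 1)) (h0 : b 0 = φ 0)
    (h1 : derivWithin b (Ici 0) 0 + v 0 0 * derivWithin φ (Icc 0 1) 0 = a 0 0 * b 0 + f 0 0) :
    C1On w strip := by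
  intro z hz
  have hz0 : 0 ≤ z.1 := hz.1
  obtain ⟨V, A, F, Φ, X, θ, hm, hθ, hV, hA, hF, he⟩ :=
    hw.exists_eq_mixedSol h (T := z.1 + 1) (by linarith)
  have m0 : (0 : ℝ) ∈ Icc 0 (z.1 + 1) := ⟨le_rfl, by linarith⟩
  have m1 : (0 : ℝ) ∈ Icc (0 : ℝ) 1 := ⟨le_rfl, zero_le_one⟩
  rw [← hV 0 m0 0 m1, ← hA 0 m0 0 m1, ← hF 0 m0 0 m1] at h1
  exact (hm.c1On_mixedSol hθ h.bdry hφ h0 h1 z hz).congr_of_eventuallyEq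
    (eventuallyEq_of_upTo he (lt_add_one _)) (he z.1 z.2 hz (lt_add_one _))

theorem Admissible.exists_bound_bdry (h : Admissible v a f φ b ξ) (t : ℝ) :
    ∃ C, ∀ s ∈ Icc 0 t, |(|b s|)| ≤ C := by
  obtain ⟨C, hC⟩ := isCompact_Icc.exists_bound_of_continuousOn
    (h.bdry.continuousOn.mono (Icc_subset_Ici_self : Icc 0 t ⊆ Ici 0))
  exact ⟨C, fun s hs => by rw [abs_abs]; exact hC s hs⟩

/-- The estimate in the norm of `L^p`. -/
theorem IsSolution.nrm_le (hw : IsSolution v a f φ b ξ w) (h : Admissible v a f φ b ξ)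
    {t p μ m D α : ℝ} (ht : 0 ≤ t) (hp : 1 < p) (hμ : 0 ≤ μ) (hm : m = minUpTo v t)
    (hD : D = maxUpTo (dx v) t) (hα : α = maxUpTo a t) (hσ : μ > -α)
    (hκ : μ > -p⁻¹ * D - α - m) :
    nrm (ENNReal.ofReal p) (w t) ≤
      Real.exp ((α + p⁻¹ * D) * t) * cut (t - 1 / m) * nrm (ENNReal.ofReal p) φ
        + 1 / m * Real.exp (1 + (μ + p⁻¹ * D + α) / m) *
          memMax (1 / m) μ t (fun s => nrm (ENNReal.ofReal p) (f s))
        + (m * ((Real.exp (p * (μ + α) / m) - 1) / (p * (μ + α)))) ^ (1 / p) *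
          memMax (1 / m) μ t (fun s => |b s|) := by
  obtain ⟨V, A, F, Φ, X, θ, hM, hθ, hV, hA, hF, he⟩ :=
    hw.exists_eq_mixedSol h (T := t + 1) (by linarith)
  have m0 : 0 < m := hm ▸ minUpTo_pos h.speed.continuousOn ht h.speed_pos
  have hT : ∀ s ∈ Icc 0 t, s ∈ Icc 0 (t + 1) := fun s hs => ⟨hs.1, by linarith [hs.2]⟩
  obtain ⟨Cf, hCf⟩ := exists_bound_nrm h.source.continuousOn (ENNReal.ofReal p) t
  obtain ⟨Cb, hCb⟩ := h.exists_bound_bdry t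
  have hδ : 0 ≤ 1 / m := by positivity
  have b0 := memMax_nonneg hμ hCb ht hδ (abs_nonneg (b t))
  have f0 := memMax_nonneg hμ hCf ht hδ ENNReal.toReal_nonneg
  have n0 : 0 ≤ nrm (ENNReal.ofReal p) φ := ENNReal.toReal_nonneg
  have c0 : 0 ≤ cut (t - 1 / m) := by unfold cut; split_ifs <;> norm_num
  have σ0 : 0 < μ + α := by linarith
  have p0 : 0 < p := one_pos.trans hp
  have e0 : 0 ≤ Real.exp (p * (μ + α) / m) - 1 := by
    linarith [Real.one_le_exp (x := p * (μ + α) / m) (by positivity)]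
  rw [nrm_congr (fun x hx => he t x ⟨ht, hx⟩ (lt_add_one t))]
  refine ENNReal.toReal_le_of_le_ofReal (by positivity)
    (hM.eLpNorm_mixedSol_le hθ h.init hp ht m0 σ0 (by linarith) b0 f0
      (fun s hs y hy => ?_) (fun s hs y hy => ?_) (fun s hs y hy => ?_)
      (fun s hs => le_memMax_mul hμ hCb hs) fun s hs => ?_)
  · rw [hV s (hT s hs) y hy, hm]; exact minUpTo_le h.speed.continuousOn s hs y hy
  · rw [hA s (hT s hs) y hy, hα]; exact le_maxUpTo h.coeff.continuousOn s hs y hy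
  · rw [hV.dx_eq hM.contDiff_speed (hT s hs) hy, hD]
    exact le_maxUpTo (continuousOn_dx h.speed) s hs y hy
  · rw [nrm_congr fun x hx => hF s (hT s ⟨(le_max_left _ _).trans hs.1, hs.2⟩) x hx]
    exact le_memMax_mul hμ hCf hs

/-- The estimate in the norm of `L^∞`. -/
theorem IsSolution.nrm_top_le (hw : IsSolution v a f φ b ξ w) (h : Admissible v a f φ b ξ)
    {t μ m α : ℝ} (ht : 0 ≤ t) (hμ : 0 ≤ μ) (hm : m = minUpTo v t) (hα : α = maxUpTo a t)
    (hσ : μ > -α) :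
    nrm ⊤ (w t) ≤ Real.exp (t * α) * cut (t - 1 / m) * nrm ⊤ φ
        + 1 / m * Real.exp (1 + (μ + α) / m) * memMax (1 / m) μ t (fun s => nrm ⊤ (f s))
        + Real.exp ((μ + α) / m) * memMax (1 / m) μ t (fun s => |b s|) := by
  obtain ⟨V, A, F, Φ, X, θ, hM, hθ, hV, hA, hF, he⟩ :=
    hw.exists_eq_mixedSol h (T := t + 1) (by linarith)
  have m0 : 0 < m := hm ▸ minUpTo_pos h.speed.continuousOn ht h.speed_pos
  have hT : ∀ s ∈ Icc 0 t, s ∈ Icc 0 (t + 1) := fun s hs => ⟨hs.1, by linarith [hs.2]⟩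
  obtain ⟨Cf, hCf⟩ := exists_bound_nrm h.source.continuousOn ⊤ t
  obtain ⟨Cb, hCb⟩ := h.exists_bound_bdry t
  have hδ : 0 ≤ 1 / m := by positivity
  have b0 := memMax_nonneg hμ hCb ht hδ (abs_nonneg (b t))
  have f0 := memMax_nonneg hμ hCf ht hδ ENNReal.toReal_nonneg
  have n0 : 0 ≤ nrm ⊤ φ := ENNReal.toReal_nonneg
  have c0 : 0 ≤ cut (t - 1 / m) := by unfold cut; split_ifs <;> norm_num
  refine nrm_le_of_bound (by positivity)
    (ae_unitVol_iff.2 (Eventually.of_forall fun x hx => ?_)) ⊤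
  rw [he t x ⟨ht, hx⟩ (lt_add_one t)]
  refine hM.abs_mixedSol_le_of_sup hθ h.init m0 (by linarith) b0 f0
    (fun s hs y hy => ?_) (fun s hs y hy => ?_)
    (fun s hs => le_memMax_mul hμ hCb hs) (fun s hs => ?_) ⟨ht, hx⟩
  · rw [hV s (hT s hs) y hy, hm]; exact minUpTo_le h.speed.continuousOn s hs y hy
  · rw [hA s (hT s hs) y hy, hα]; exact le_maxUpTo h.coeff.continuousOn s hs y hy
  · rw [nrm_congr fun x hx => hF s (hT s ⟨(le_max_left _ _).trans hs.1, hs.2⟩) x hx]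
    exact le_memMax_mul hμ hCf hs

end Representation

end LinTransport

end

theorem theorem2p3 {N : ℕ} (v a f : ℝ → ℝ → ℝ) (φ b : ℝ → ℝ) (ξ : Fin (N + 1) → ℝ)
    (hv : LinTransport.C1On v LinTransport.strip)
    (hvpos : ∀ t x : ℝ, 0 ≤ t → x ∈ Icc (0 : ℝ) 1 → 0 < v t x)
    (ha : LinTransport.C1On a LinTransport.strip)
    (hf : LinTransport.C1On f LinTransport.strip)
    (hb : ContDiffOn ℝ 1 b (Ici 0))
    (hφ : LinTransport.PC1 φ)
    (hξ : ∀ i, ξ i ∈ Icc (0 : ℝ) 1) (hξ0 : ξ 0 = 0)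
    (hφξ : ContDiffOn ℝ 1 φ (Icc 0 1 \ range ξ)) :
    -- existence
    (∃ w : ℝ → ℝ → ℝ, LinTransport.IsSolution v a f φ b ξ w) ∧
    -- uniqueness
    (∀ w₁ w₂ : ℝ → ℝ → ℝ, LinTransport.IsSolution v a f φ b ξ w₁ →
      LinTransport.IsSolution v a f φ b ξ w₂ →
      ∀ t x : ℝ, 0 ≤ t → x ∈ Icc (0 : ℝ) 1 → w₁ t x = w₂ t x) ∧
    ∀ w : ℝ → ℝ → ℝ, LinTransport.IsSolution v a f φ b ξ w →
      -- the estimate in the norm of `L^p`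
      (∀ t p μ vmin vmax A : ℝ, 0 ≤ t → 1 < p → 0 ≤ μ →
        vmin = LinTransport.minUpTo v t →
        vmax = LinTransport.maxUpTo (LinTransport.dx v) t →
        A = LinTransport.maxUpTo a t →
        μ > -A → μ > -p⁻¹ * vmax - A - vmin →
        MemLp (w t) (ENNReal.ofReal p) LinTransport.unitVol ∧
        LinTransport.nrm (ENNReal.ofReal p) (w t) ≤
          Real.exp ((A + p⁻¹ * vmax) * t) * LinTransport.cut (t - 1 / vmin) *
              LinTransport.nrm (ENNReal.ofReal p) φ
            + 1 / vmin * Real.exp (1 + (μ + p⁻¹ * vmax + A) / vmin) *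
              LinTransport.memMax (1 / vmin) μ t
                (fun s => LinTransport.nrm (ENNReal.ofReal p) (f s))
            + (vmin * ((Real.exp (p * (μ + A) / vmin) - 1) / (p * (μ + A)))) ^ (1 / p) *
              LinTransport.memMax (1 / vmin) μ t (fun s => |b s|)) ∧
      -- the estimate in the norm of `L^∞`
      (∀ t μ vmin A : ℝ, 0 ≤ t → 0 ≤ μ →
        vmin = LinTransport.minUpTo v t → A = LinTransport.maxUpTo a t →
        μ > -A →
        MemLp (w t) ⊤ LinTransport.unitVol ∧
        LinTransport.nrm ⊤ (w t) ≤
          Real.exp (t * A) * LinTransport.cut (t - 1 / vmin) * LinTransport.nrm ⊤ φ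
            + 1 / vmin * Real.exp (1 + (μ + A) / vmin) *
              LinTransport.memMax (1 / vmin) μ t (fun s => LinTransport.nrm ⊤ (f s))
            + Real.exp ((μ + A) / vmin) *
              LinTransport.memMax (1 / vmin) μ t (fun s => |b s|)) ∧
      -- continuity of the solution
      (b 0 = φ 0 → ContinuousOn φ (Icc 0 1) →
        ContinuousOn (Function.uncurry w) LinTransport.strip) ∧
      -- continuous differentiability of the solution
      (ContDiffOn ℝ 1 φ (Icc 0 1) → b 0 = φ 0 →
        derivWithin b (Ici 0) 0 + v 0 0 * derivWithin φ (Icc 0 1) 0 = a 0 0 * b 0 + f 0 0 →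
        LinTransport.C1On w LinTransport.strip) := by
  have h : LinTransport.Admissible v a f φ b ξ := ⟨hv, hvpos, ha, hf, hb, hφ, hξ, hξ0, hφξ⟩
  refine ⟨h.exists_isSolution, fun w₁ w₂ h₁ h₂ t x ht hx =>
    h.unique (h₁.upTo (t + 1)) (h₂.upTo (t + 1)) ⟨ht, hx⟩ (lt_add_one t), fun w hw =>
    ⟨?_, ?_, hw.continuousOn h, hw.c1On h⟩⟩
  · intro t p μ m D α ht hp hμ hm hD hα hσ hκ
    -- `nrm` sends an infinite norm to 0, so membership in L^p is what gives the inequality its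
    -- content.
    exact ⟨(hw.pc1 t ht).memLp _, hw.nrm_le h ht hp hμ hm hD hα hσ hκ⟩
  · intro t μ m α ht hμ hm hα hσ
    exact ⟨(hw.pc1 t ht).memLp _, hw.nrm_top_le h ht hμ hm hα hσ⟩
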